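/- Let $X$ be a compact complex manifold of dimension $n$, $L\to X$ a holomorphic line bundle, and $E\subset H^0(X;L)$ a subspace of finite dimension $d$ giving a projective embedding $X\to\mathbf{P}(E^*)$. A smooth Hermitian metric $h$ on $L$ determines a real $(1,1)$-form $\omega_h$ such that the Chern connection of $h$ has curvature $-i\omega_h$; put $d\mu_h=\omega_h^n/n!$, let $\mathcal{K}$ be the set of $h$ with $\omega_h>0$, and let $V$ be the volume of $X$ with respect to $d\mu_h$ (the same for all $h\in\mathcal{K}$). Let $M$ be the set of Hermitian metrics (positive definite Hermitian forms) on $E$. For $h\in\mathcal{K}$ let ${\rm Hilb}(h)\in M$ be the metric $\Vert s\Vert^2_{{\rm Hilb}(h)}=\frac{d}{V}\int_X\vert s\vert_h^2\,d\mu_h$. For $H\in M$ let $FS(H)$ be the metric on $L$ with $\sum_\alpha\vert s_\alpha\vert^2_{FS(H)}=1$ pointwise on $X$ for every $H$-orthonormal basis $(s_\alpha)$ of $E$. A point $H\in M$ is called balanced if ${\rm Hilb}(FS(H))=H$. The geodesics in $M\cong GL(d,\mathbf{C})/U(d)$ are the curves $H_t$, $t\in\mathbf{R}$, which are of the form ${\rm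 diag}(e^{\lambda_\alpha t})$ with respect to some basis of $E$, for some real $\lambda_1,\dots,\lambda_d$. Fix a basis of $E$, and let $\det H$ be the determinant of the matrix of $H\in M$ in this basis. Then $FS(H)\in\mathcal{K}$ for every $H\in M$; there is a functional $I:\mathcal{K}\to\mathbf{R}$ such that $$\frac{d}{dt}I(h_t)=\int_X\dot\phi_t\,d\mu_{h_t}$$ for every smooth path $h_t=e^{\phi_t}h_0$ in $\mathcal{K}$; and any two points of $M$ are joined by a geodesic. For any such $I$ put $Z=-I\circ FS$ and $$\tilde Z=Z+\frac{V}{d}\log\det : M\to\mathbf{R}.$$ Then $\tilde Z$ is convex along every geodesic in $M$, and if $H^*\in M$ is a balanced point, then $H^*$ is an absolute minimum of $\tilde Z$ on $M$, that is, $\tilde Z(H^*)\le\tilde Z(H)$ for all $H\in M$. -/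

import Mathlib

open scoped Manifold ContDiff Bundle ComplexConjugate

noncomputable section

namespace KahlerQuantization

/-! ### Complex coordinates -/

/-- The Wirtinger derivative `∂u/∂z_j` of a complex-valued function on `ℂⁿ`. -/
def dz {n : ℕ} (j : Fin n) (u : (Fin n → ℂ) → ℂ) (z : Fin n → ℂ) : ℂ :=
  (1 / 2 : ℂ) * (fderiv ℝ u z (Pi.single j 1) - Complex.I * fderiv ℝ u z (Pi.single j Complex.I))

/-- The Wirtinger derivative `∂u/∂z̄_k` of a complex-valued function on `ℂⁿ`. -/
def dzbar {n : ℕ} (k : Fin n) (u : (Fin n → ℂ) → ℂ) (z : Fin n → ℂ) : ℂ :=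
  (1 / 2 : ℂ) * (fderiv ℝ u z (Pi.single k 1) + Complex.I * fderiv ℝ u z (Pi.single k Complex.I))

/-! ### Hermitian metrics on a holomorphic line bundle -/

section Metrics

variable {n : ℕ} {X : Type*} [TopologicalSpace X] [ChartedSpace (Fin n → ℂ) X]
variable (L : X → Type*) [TopologicalSpace (Bundle.TotalSpace ℂ L)]
  [∀ x, AddCommGroup (L x)] [∀ x, Module ℂ (L x)] [∀ x, TopologicalSpace (L x)]
  [FiberBundle ℂ L] [VectorBundle ℂ ℂ L]

/-- The local frame of `L` given by the preferred trivialization around `x₀`. -/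
def frame (x₀ x : X) : L x := (trivializationAt ℂ L x₀).symm x 1

/-- A smooth Hermitian metric on the line bundle `L`. The fibres are complex lines, so that a
Hermitian metric on a fibre is the same as its squared norm `|v|²`, a positive function of `v ≠ 0`
with `|c v|² = |c|² |v|²`. -/
structure HermMetric (n : ℕ) {X : Type*} [TopologicalSpace X] [ChartedSpace (Fin n → ℂ) X]
    (L : X → Type*) [TopologicalSpace (Bundle.TotalSpace ℂ L)]
    [∀ x, AddCommGroup (L x)] [∀ x, Module ℂ (L x)] [∀ x, TopologicalSpace (L x)]
    [FiberBundle ℂ L] [VectorBundle ℂ ℂ L] where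
  /-- the squared norm on the fibres -/
  normSq : ∀ x, L x → ℝ
  normSq_smul : ∀ (x : X) (c : ℂ) (v : L x), normSq x (c • v) = ‖c‖ ^ 2 * normSq x v
  normSq_pos : ∀ (x : X) (v : L x), v ≠ 0 → 0 < normSq x v
  smooth : ∀ x₀ : X, ContMDiffOn 𝓘(ℝ, Fin n → ℂ) 𝓘(ℝ, ℝ) ∞
    (fun x => normSq x (frame L x₀ x)) (trivializationAt ℂ L x₀).baseSet

variable {L}

/-- `log |e|²_h`, for the local holomorphic frame `e` of `L` around `x₀`, in the preferred
holomorphic coordinates around `x₀`. -/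
def HermMetric.logWeight (h : HermMetric n L) (x₀ : X) (z : Fin n → ℂ) : ℂ :=
  (Real.log (h.normSq ((chartAt (Fin n → ℂ) x₀).symm z)
    (frame L x₀ ((chartAt (Fin n → ℂ) x₀).symm z))) : ℝ)

/-- The curvature of the Chern connection of `h` is `∂̄∂ log |e|²_h = -i ω_h`, so that
`ω_h = i ∂̄∂ log |e|²_h = i ∑ g_{jk} dz_j ∧ dz̄_k` with the Hermitian matrix
`g_{jk} = - ∂²/∂z_j∂z̄_k log |e|²_h`. -/
def HermMetric.curvMatrix (h : HermMetric n L) (x₀ : X) (z : Fin n → ℂ) :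
    Matrix (Fin n) (Fin n) ℂ :=
  Matrix.of fun j k => - dz j (dzbar k (h.logWeight x₀)) z

open scoped ComplexOrder in
/-- `h` belongs to the space `𝒦`: the form `ω_h` is positive at every point. -/
def HermMetric.IsPositive (h : HermMetric n L) : Prop :=
  ∀ x : X, (h.curvMatrix x (chartAt (Fin n → ℂ) x x)).PosDef

/-- The domain in `ℂⁿ` of the preferred coordinates around `x₀` over which the preferred
trivialization of `L` around `x₀` is defined. -/
def coordDomain (L : X → Type*) [TopologicalSpace (Bundle.TotalSpace ℂ L)]
    [∀ x, AddCommGroup (L x)] [∀ x, Module ℂ (L x)] [∀ x, TopologicalSpace (L x)]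
    [FiberBundle ℂ L] [VectorBundle ℂ ℂ L] (x₀ : X) : Set (Fin n → ℂ) :=
  (chartAt (Fin n → ℂ) x₀).target ∩
    (chartAt (Fin n → ℂ) x₀).symm ⁻¹' (trivializationAt ℂ L x₀).baseSet

/-- The measure `ω_h^n / n!` on the coordinate neighbourhood of `x₀`, extended by zero. Since
`i dz ∧ dz̄ = 2 dx ∧ dy`, it is `2ⁿ det (g_{jk})` times Lebesgue measure. -/
def HermMetric.localMeasure [MeasurableSpace X] (h : HermMetric n L) (x₀ : X) :
    MeasureTheory.Measure X :=
  (((MeasureTheory.volume : MeasureTheory.Measure (Fin n → ℂ)).restrict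
    (coordDomain L x₀)).withDensity
      (fun z => ENNReal.ofReal (2 ^ n * (h.curvMatrix x₀ z).det.re))).map
    (chartAt (Fin n → ℂ) x₀).symm

/-- The measure `dμ_h = ω_h^n / n!` on `X`. The local measures agree on overlaps of coordinate
neighbourhoods, and their supremum in the lattice of measures is the measure obtained by gluing
them. -/
def HermMetric.measure [MeasurableSpace X] (h : HermMetric n L) : MeasureTheory.Measure X :=
  ⨆ x₀ : X, h.localMeasure x₀

/-- The volume of `X` with respect to `dμ_h`. -/
def HermMetric.vol [MeasurableSpace X] (h : HermMetric n L) : ℝ :=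
  (h.measure Set.univ).toReal

/-- `I` is a functional on `𝒦` with `dI/dt = ∫_X φ̇ dμ_{h_t}` along every smooth path
`h_t = e^{φ_t} h₀` in `𝒦`. (Values of `I` outside `𝒦` are irrelevant.) -/
def IsEnergyFunctional [MeasurableSpace X] (I : HermMetric n L → ℝ) : Prop :=
  ∀ (h₀ : HermMetric n L) (h : ℝ → HermMetric n L) (φ : ℝ → X → ℝ), h₀.IsPositive →
    ContMDiff (𝓘(ℝ, ℝ).prod 𝓘(ℝ, Fin n → ℂ)) 𝓘(ℝ, ℝ) ∞ (fun p : ℝ × X => φ p.1 p.2) →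
    (∀ (t : ℝ) (x : X) (v : L x), (h t).normSq x v = Real.exp (φ t x) * h₀.normSq x v) →
    (∀ t, (h t).IsPositive) →
    ∀ t, HasDerivAt (fun r => I (h r)) (∫ x, deriv (fun r => φ r x) t ∂(h t).measure) t

/-! ### Linear systems -/

/-- The value of a holomorphic section `s` at `x`, in the preferred trivialization of `L` around
`x₀`. -/
def localCoord (x₀ x : X) (s : Cₛ^ω⟮𝓘(ℂ, Fin n → ℂ); ℂ, L⟯) : ℂ :=
  (trivializationAt ℂ L x₀ ⟨x, s x⟩).2

end Metrics

section Evaluation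

variable {n : ℕ} {X : Type*} [TopologicalSpace X] [ChartedSpace (Fin n → ℂ) X]
variable {L : X → Type*} [TopologicalSpace (Bundle.TotalSpace ℂ L)]
  [∀ x, AddCommGroup (L x)] [∀ x, Module ℂ (L x)] [∀ x, TopologicalSpace (L x)]
  [FiberBundle ℂ L] [VectorBundle ℂ ℂ L]

/-- Evaluation at `x` as a linear form on `E`, the fibre `L_x` being identified with `ℂ`. -/
def evalForm (E : Submodule ℂ (Cₛ^ω⟮𝓘(ℂ, Fin n → ℂ); ℂ, L⟯)) (x : X) : Module.Dual ℂ E where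
  toFun s := localCoord x x (s : Cₛ^ω⟮𝓘(ℂ, Fin n → ℂ); ℂ, L⟯)
  map_add' _ _ :=
    ((trivializationAt ℂ L x).linear ℂ (FiberBundle.mem_baseSet_trivializationAt' x)).map_add _ _
  map_smul' _ _ :=
    ((trivializationAt ℂ L x).linear ℂ (FiberBundle.mem_baseSet_trivializationAt' x)).map_smul _ _

/-- The linear system `E` gives a projective embedding `x ↦ [evaluation at x]` of `X` in `ℙ(E*)`:
the map is well defined, injective and immersive. As `X` is compact, it is then an embedding. -/
structure GivesProjectiveEmbedding
    (E : Submodule ℂ (Cₛ^ω⟮𝓘(ℂ, Fin n → ℂ); ℂ, L⟯)) : Prop where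
  evalForm_ne_zero : ∀ x : X, evalForm E x ≠ 0
  injective : Function.Injective fun x : X =>
    Projectivization.mk ℂ (evalForm E x) (evalForm_ne_zero x)
  /-- The derivative at `x` of the local lift of the map to `E*` is injective modulo the line
  spanned by the value of the lift at `x`. -/
  immersive : ∀ (x : X) (v : Fin n → ℂ) (c : ℂ),
    (∀ s : E, fderiv ℂ (fun z => localCoord x ((chartAt (Fin n → ℂ) x).symm z)
      (s : Cₛ^ω⟮𝓘(ℂ, Fin n → ℂ); ℂ, L⟯)) (chartAt (Fin n → ℂ) x x) v = c * evalForm E x s) →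
    v = 0

end Evaluation

/-! ### Hermitian metrics on a finite-dimensional vector space -/

section Finite

variable {E : Type*} [AddCommGroup E] [Module ℂ E]

/-- The basis `s` is orthonormal with respect to the Hermitian metric `H`. -/
def IsONB (H : InnerProductSpace.Core ℂ E) {ι : Type*} [DecidableEq ι] (s : Module.Basis ι ℂ E) :
    Prop :=
  ∀ i j, H.inner (s i) (s j) = if i = j then 1 else 0

theorem exists_isONB [FiniteDimensional ℂ E] (H : InnerProductSpace.Core ℂ E) :
    ∃ s : Module.Basis (Fin (Module.finrank ℂ E)) ℂ E, IsONB H s := by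
  let : NormedAddCommGroup E := @InnerProductSpace.Core.toNormedAddCommGroup ℂ E _ _ _ H
  let : InnerProductSpace ℂ E := InnerProductSpace.ofCore H.toCore
  refine ⟨(stdOrthonormalBasis ℂ E).toBasis, fun i j => ?_⟩
  have h := (orthonormal_iff_ite.mp (stdOrthonormalBasis ℂ E).orthonormal) i j
  simpa using h

theorem sum_sq_eq_of_isONB [FiniteDimensional ℂ E] (H : InnerProductSpace.Core ℂ E)
    (f : Module.Dual ℂ E) {ι κ : Type*} [Fintype ι] [DecidableEq ι] [Fintype κ] [DecidableEq κ]
    (s : Module.Basis ι ℂ E) (hs : IsONB H s) (u : Module.Basis κ ℂ E) (hu : IsONB H u) :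
    ∑ α, ‖f (s α)‖ ^ 2 = ∑ α, ‖f (u α)‖ ^ 2 := by
  let : NormedAddCommGroup E := @InnerProductSpace.Core.toNormedAddCommGroup ℂ E _ _ _ H
  let : InnerProductSpace ℂ E := InnerProductSpace.ofCore H.toCore
  have hso : Orthonormal ℂ s := orthonormal_iff_ite.mpr hs
  have huo : Orthonormal ℂ u := orthonormal_iff_ite.mpr hu
  have : FiniteDimensional ℂ E := ‹_›
  have : CompleteSpace E := FiniteDimensional.complete ℂ E
  let w := (InnerProductSpace.toDual ℂ E).symm (LinearMap.toContinuousLinearMap f)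
  have hw : ∀ v, f v = inner ℂ w v := fun v => by
    rw [InnerProductSpace.toDual_symm_apply]
    rfl
  simp only [hw]
  have h1 := (s.toOrthonormalBasis hso).sum_sq_norm_inner_left w
  have h2 := (u.toOrthonormalBasis huo).sum_sq_norm_inner_left w
  simp only [Module.Basis.coe_toOrthonormalBasis] at h1 h2
  rw [h1, h2]

/-- A choice of an orthonormal basis. -/
def onb [FiniteDimensional ℂ E] (H : InnerProductSpace.Core ℂ E) :
    Module.Basis (Fin (Module.finrank ℂ E)) ℂ E :=
  (exists_isONB H).choose

/-- The logarithm of the determinant of `H`, that is, of its matrix with respect to a basis `b`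
with `b₁ ∧ ⋯ ∧ b_d = Θ`. Every non-zero `Θ` in the top exterior power of `E` is of this form. -/
def logDet {d : ℕ} (b : Module.Basis (Fin d) ℂ E) (H : InnerProductSpace.Core ℂ E) : ℝ :=
  Real.log (Matrix.of fun i j => H.inner (b i) (b j)).det.re

/-- The geodesics of the symmetric space `M = GL(d, ℂ) / U(d)` of Hermitian metrics on `E`:
the curves `H_t = diag (e^{λ_α t})` with respect to some basis of `E`, which is then
orthonormal with respect to `H_0`. -/
def IsGeodesic (γ : ℝ → InnerProductSpace.Core ℂ E) : Prop :=
  ∃ (s : Module.Basis (Fin (Module.finrank ℂ E)) ℂ E) (l : Fin (Module.finrank ℂ E) → ℝ),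
    ∀ t i j, (γ t).inner (s i) (s j) = if i = j then (Real.exp (l i * t) : ℂ) else 0

end Finite

/-! ### The Fubini-Study map and balanced metrics -/

section FubiniStudy

variable {n : ℕ} {X : Type*} [TopologicalSpace X] [ChartedSpace (Fin n → ℂ) X]
variable {L : X → Type*} [TopologicalSpace (Bundle.TotalSpace ℂ L)]
  [∀ x, AddCommGroup (L x)] [∀ x, Module ℂ (L x)] [∀ x, TopologicalSpace (L x)]
  [FiberBundle ℂ L] [VectorBundle ℂ ℂ L]
  {E : Submodule ℂ (Cₛ^ω⟮𝓘(ℂ, Fin n → ℂ); ℂ, L⟯)}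

theorem contMDiffOn_real {f : X → ℂ} {U : Set X}
    (hf : ContMDiffOn 𝓘(ℂ, Fin n → ℂ) 𝓘(ℂ, ℂ) ω f U) :
    ContMDiffOn 𝓘(ℝ, Fin n → ℂ) 𝓘(ℝ, ℂ) ∞ f U := by
  intro x hx
  have h := hf x hx
  rw [contMDiffWithinAt_iff] at h ⊢
  exact ⟨h.1, (h.2.restrict_scalars ℝ).of_le le_top⟩

theorem localCoord_smul_frame (x₀ x : X) (hx : x ∈ (trivializationAt ℂ L x₀).baseSet)
    (v : L x) : v = (trivializationAt ℂ L x₀ ⟨x, v⟩).2 • frame L x₀ x := by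
  have h1 := (trivializationAt ℂ L x₀).symm_apply_apply_mk hx v
  have h2 := ((trivializationAt ℂ L x₀).symmₗ ℂ x).map_smul
    (trivializationAt ℂ L x₀ ⟨x, v⟩).2 1
  simp only [Bundle.Trivialization.coe_symmₗ _ hx, smul_eq_mul, mul_one] at h2
  exact h1.symm.trans h2

theorem evalForm_sum_pos [FiniteDimensional ℂ E] {x : X} (hx : evalForm E x ≠ 0) {ι : Type*}
    [Fintype ι] (s : Module.Basis ι ℂ E) : 0 < ∑ α, ‖evalForm E x (s α)‖ ^ 2 := by
  refine lt_of_le_of_ne (Finset.sum_nonneg fun _ _ => by positivity) fun h => hx ?_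
  refine s.ext fun α => ?_
  have := (Finset.sum_eq_zero_iff_of_nonneg (fun _ _ => by positivity)).1 h.symm α
    (Finset.mem_univ α)
  simpa using this

theorem triv_smul (x : X) (c : ℂ) (v : L x) : (trivializationAt ℂ L x ⟨x, c • v⟩).2 =
    c * (trivializationAt ℂ L x ⟨x, v⟩).2 :=
  ((trivializationAt ℂ L x).linear ℂ (FiberBundle.mem_baseSet_trivializationAt' x)).map_smul c v

/-- The metric `FS(H)` on `L`: `|v|² = |v|²_τ / ∑ |s_α(x)|²_τ` for `v ∈ L_x`, where `(s_α)` is an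
`H`-orthonormal basis of `E` and `|·|_τ` is the norm on `L_x` given by a trivialization. It is the
metric with `∑ |s_α|² = 1`, see `sum_FS_normSq`. -/
def FS [ContMDiffVectorBundle ω ℂ L 𝓘(ℂ, Fin n → ℂ)]
    [FiniteDimensional ℂ E] (hE : GivesProjectiveEmbedding E) (H : InnerProductSpace.Core ℂ E) :
    HermMetric n L where
  normSq x v := ‖(trivializationAt ℂ L x ⟨x, v⟩).2‖ ^ 2 / ∑ α, ‖evalForm E x (onb H α)‖ ^ 2
  normSq_smul x c v := by
    rw [triv_smul, norm_mul, mul_pow, mul_div_assoc]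
  normSq_pos x v hv := by
    refine div_pos ?_ (evalForm_sum_pos (hE.evalForm_ne_zero x) _)
    have h := localCoord_smul_frame x x (FiberBundle.mem_baseSet_trivializationAt' x) v
    have : (trivializationAt ℂ L x ⟨x, v⟩).2 ≠ 0 := fun h0 => hv (by rw [h, h0, zero_smul])
    positivity
  smooth x₀ := by
    have key : ∀ x ∈ (trivializationAt ℂ L x₀).baseSet,
        (∑ α, ‖localCoord x₀ x (onb H α : Cₛ^ω⟮𝓘(ℂ, Fin n → ℂ); ℂ, L⟯)‖ ^ 2) ≠ 0 ∧
        ‖(trivializationAt ℂ L x ⟨x, frame L x₀ x⟩).2‖ ^ 2 /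
          ∑ α, ‖evalForm E x (onb H α)‖ ^ 2 =
        (∑ α, ‖localCoord x₀ x (onb H α : Cₛ^ω⟮𝓘(ℂ, Fin n → ℂ); ℂ, L⟯)‖ ^ 2)⁻¹ := by
      intro x hx
      have hs : ∀ α, ‖evalForm E x (onb H α)‖ ^ 2 =
          ‖localCoord x₀ x (onb H α : Cₛ^ω⟮𝓘(ℂ, Fin n → ℂ); ℂ, L⟯)‖ ^ 2 *
            ‖(trivializationAt ℂ L x ⟨x, frame L x₀ x⟩).2‖ ^ 2 := by
        intro α
        have h := localCoord_smul_frame x₀ x hx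
          ((onb H α : Cₛ^ω⟮𝓘(ℂ, Fin n → ℂ); ℂ, L⟯) x)
        rw [← mul_pow, ← norm_mul, localCoord, ← triv_smul, ← h]
        rfl
      have hpos := evalForm_sum_pos (hE.evalForm_ne_zero x) (onb H)
      simp only [hs, ← Finset.sum_mul] at hpos ⊢
      have h1 := left_ne_zero_of_mul hpos.ne'
      have h2 := right_ne_zero_of_mul hpos.ne'
      exact ⟨h1, by rw [div_mul_cancel_right₀ h2]⟩
    refine ContMDiffOn.congr ?_ fun x hx => (key x hx).2
    refine ContMDiffOn.inv₀ ?_ fun x hx => (key x hx).1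
    refine contMDiffOn_finsetSum fun α _ => ?_
    have h1 := ((trivializationAt ℂ L x₀).contMDiffOn_section_baseSet_iff).1
      ((onb H α : Cₛ^ω⟮𝓘(ℂ, Fin n → ℂ); ℂ, L⟯).contMDiff.contMDiffOn)
    have h2 := contMDiffOn_real h1
    exact (contDiff_norm_sq ℝ (E := ℂ)).contMDiff.comp_contMDiffOn h2

/-- The defining property of `FS(H)`: `∑ |s_α|²_{FS(H)} = 1` pointwise on `X` for every
`H`-orthonormal basis `(s_α)` of `E`. -/
theorem sum_FS_normSq [ContMDiffVectorBundle ω ℂ L 𝓘(ℂ, Fin n → ℂ)]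
    [FiniteDimensional ℂ E] (hE : GivesProjectiveEmbedding E) (H : InnerProductSpace.Core ℂ E)
    {ι : Type*} [Fintype ι] [DecidableEq ι] (s : Module.Basis ι ℂ E) (hs : IsONB H s) (x : X) :
    ∑ α, (FS hE H).normSq x ((s α : Cₛ^ω⟮𝓘(ℂ, Fin n → ℂ); ℂ, L⟯) x) = 1 := by
  have h := sum_sq_eq_of_isONB H (evalForm E x) s hs (onb H) (exists_isONB H).choose_spec
  have hpos := evalForm_sum_pos (hE.evalForm_ne_zero x) (onb H)
  change ∑ α, ‖evalForm E x (s α)‖ ^ 2 / ∑ α, ‖evalForm E x (onb H α)‖ ^ 2 = 1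
  rw [← Finset.sum_div, h, div_self hpos.ne']

variable [MeasurableSpace X]

/-- The squared norm of a section in the metric `Hilb(h)` on `E`, where `V` is the volume of `X`:
`‖s‖² = (d / V) ∫ |s|²_h dμ_h`. -/
def hilbNormSq (V : ℝ) (h : HermMetric n L) (s : E) : ℝ :=
  (Module.finrank ℂ E / V) *
    ∫ x, h.normSq x ((s : Cₛ^ω⟮𝓘(ℂ, Fin n → ℂ); ℂ, L⟯) x) ∂h.measure

variable [ContMDiffVectorBundle ω ℂ L 𝓘(ℂ, Fin n → ℂ)] [FiniteDimensional ℂ E]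

/-- `H` is a balanced point of `M`: `Hilb(FS(H)) = H`. (A Hermitian metric on `E` is determined
by its squared norm.) -/
def IsBalanced (V : ℝ) (hE : GivesProjectiveEmbedding E) (H : InnerProductSpace.Core ℂ E) :
    Prop :=
  ∀ s : E, (hilbNormSq V (FS hE H) s : ℂ) = H.inner s s

/-- The functional `Z = - I ∘ FS` on `M`. -/
def Z (I : HermMetric n L → ℝ) (hE : GivesProjectiveEmbedding E)
    (H : InnerProductSpace.Core ℂ E) : ℝ :=
  - I (FS hE H)

/-- The functional `Z̃ = Z + (V / d) log det` on `M`, where `V` is the volume of `X` and the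
determinant is taken with respect to the basis `b` of `E`. -/
def Ztilde (V : ℝ) (I : HermMetric n L → ℝ) (hE : GivesProjectiveEmbedding E)
    (b : Module.Basis (Fin (Module.finrank ℂ E)) ℂ E) (H : InnerProductSpace.Core ℂ E) : ℝ :=
  Z I hE H + V / Module.finrank ℂ E * logDet b H

end FubiniStudy

end KahlerQuantization

end

/-! Along a geodesic `diag(e^{l_α t})` in a basis `s`, the sections `e^{-l_α t/2} s_α` are
orthonormal at time `t`. Hence `FS(γ t) = e^{φ_t} FS(γ 0)` with `φ_t = -log ∑ e^{-l_α t} |s_α|²`,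
the norms being those of `FS(γ 0)`. Consequently `φ̇_t` is the mean of the numbers `l_α` for the
pointwise weights `|u_α|²_{FS(γ t)}`, where `u` is the rescaled basis, and `φ̈_t` is minus their
variance (`timeDeriv_fsPotential_eq_meanFS`, `timeDeriv_timeDeriv_fsPotential`). Since `log det` is
affine along the geodesic, the derivative of `Z̃` is `-∫ φ̇_t dμ_t + (V/d) ∑ l_α`, and convexity
means that `∫ φ̇_t dμ_t` decreases.

Its derivative is `∫ (φ̈ + |∂φ̇|²) dμ_t`: the variation of the volume form contributes `-φ̇
tr(∂∂̄φ̇)`, which integrates to `|∂φ̇|²` (`antitone_integral_timeDeriv`). What remains is the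
pointwise inequality `|∂φ̇|² ≤ variance` (`gradRatio_meanFS_le`). In a local lift `f = (f_α)` the
gradient of the mean `m` pairs the derivative of `f` with the vector `e_α = (l_α - m) f_α`, which is
orthogonal to `f`. The Fubini-Study length of a tangent vector is the length of the part of the
derivative of `f` orthogonal to `f`, divided by `|f|`. The inequality is therefore Cauchy-Schwarz,
and `|e|²/|f|²` is the variance (`fsMatrix_form`, `re_adjugate_fsMatrix_le`).

If `γ 0` is balanced, every `∫ |s_α|² dμ_0` equals `V/d`, so the derivative of `Z̃` vanishes at `t =
0`. Any other point is reached from `γ 0` by a geodesic, by simultaneous diagonalization, and a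
convex function is minimal at a critical point.

The analytic input is the self-adjointness of `u ↦ tr(adj(N) ∂∂̄u)`, where `N` is the curvature of
`e^{sφ} h` (`integral_mul_trRatio_symm`). On `ℂⁿ` it follows from the vanishing divergence of the
adjugate of a complex Hessian; a partition of unity globalizes it. The same symmetry makes the
`1`-form defining `I` closed, so that integration along segments from a base metric produces `I`
(`hasDerivAt_energy`). Global integrals are written against one fixed measure `dμ_h`, with the
coordinate-free ratios `maRatio` and `trRatio` as densities. -/

set_option linter.unusedSectionVars false

noncomputable section

namespace KahlerQuantization

/-! ### Wirtinger calculus -/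

section Wirtinger

open Filter Topology

variable {W : Type*} [NormedAddCommGroup W] [NormedSpace ℝ W]

/-- The first order operator `(∂_a + c ∂_b) / 2`; both Wirtinger derivatives are of this form. -/
def wirt (a b : W) (c : ℂ) (u : W → ℂ) (p : W) : ℂ :=
  (1 / 2 : ℂ) * (fderiv ℝ u p a + c * fderiv ℝ u p b)

variable {a b a' b' : W} {c c' : ℂ} {u v : W → ℂ} {p : W}

theorem wirt_congr (h : u =ᶠ[𝓝 p] v) : wirt a b c u p = wirt a b c v p := by
  simp only [wirt, h.fderiv_eq]

theorem wirt_eventuallyEq (h : u =ᶠ[𝓝 p] v) : wirt a b c u =ᶠ[𝓝 p] wirt a b c v :=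
  h.eventuallyEq_nhds.mono fun _ hq => wirt_congr hq

/-- Ordinary directional derivatives belong to the same family of operators, so time derivatives can
later be commuted with Wirtinger derivatives by `wirt_comm`. -/
theorem wirt_self (u : W → ℂ) (p : W) : wirt a a 1 u p = fderiv ℝ u p a := by
  simp only [wirt]; ring

theorem wirt_const (k : ℂ) : wirt a b c (fun _ => k) p = 0 := by
  simp [wirt]

theorem wirt_add (hu : DifferentiableAt ℝ u p) (hv : DifferentiableAt ℝ v p) :
    wirt a b c (fun q => u q + v q) p = wirt a b c u p + wirt a b c v p := by
  simp only [wirt, fderiv_fun_add hu hv, _root_.add_apply]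
  ring

theorem wirt_mul (hu : DifferentiableAt ℝ u p) (hv : DifferentiableAt ℝ v p) :
    wirt a b c (fun q => u q * v q) p = wirt a b c u p * v p + u p * wirt a b c v p := by
  simp only [wirt, fderiv_fun_mul hu hv, _root_.add_apply,
    _root_.smul_apply, smul_eq_mul]
  ring

theorem wirt_const_mul (k : ℂ) (hu : DifferentiableAt ℝ u p) :
    wirt a b c (fun q => k * u q) p = k * wirt a b c u p := by
  rw [wirt_mul (differentiableAt_const k) hu, wirt_const]
  ring

theorem wirt_sum {ι : Type*} {s : Finset ι} {f : ι → W → ℂ}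
    (hf : ∀ i ∈ s, DifferentiableAt ℝ (f i) p) :
    wirt a b c (fun q => ∑ i ∈ s, f i q) p = ∑ i ∈ s, wirt a b c (f i) p := by
  simp only [wirt, fderiv_fun_sum hf, _root_.sum_apply, Finset.mul_sum,
    ← Finset.sum_add_distrib]

theorem wirt_inv (hu : DifferentiableAt ℝ u p) (h0 : u p ≠ 0) :
    wirt a b c (fun q => (u q)⁻¹) p = - wirt a b c u p / u p ^ 2 := by
  have h := (hasDerivAt_inv h0).hasFDerivAt.restrictScalars ℝ |>.comp p hu.hasFDerivAt
  simp only [wirt]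
  rw [show (fun q => (u q)⁻¹) = Inv.inv ∘ u from rfl, h.fderiv]
  simp
  ring

theorem fderiv_conj_comp (hu : DifferentiableAt ℝ u p) (w : W) :
    fderiv ℝ (fun q => conj (u q)) p w = conj (fderiv ℝ u p w) := by
  have h := (Complex.conjCLE.toContinuousLinearMap.hasFDerivAt (x := u p)).comp p hu.hasFDerivAt
  have h2 : (fun q => conj (u q)) = Complex.conjCLE.toContinuousLinearMap ∘ u := by
    ext q; simp
  rw [h2, h.fderiv]
  simp

theorem wirt_conj (hu : DifferentiableAt ℝ u p) :
    wirt a b c (fun q => conj (u q)) p = conj (wirt a b (conj c) u p) := by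
  have h : conj (1 / 2 : ℂ) = 1 / 2 := by norm_num [Complex.ext_iff]
  simp only [wirt, fderiv_conj_comp hu, map_mul, map_add, Complex.conj_conj, h]

theorem _root_.ContDiffAt.wirt (hu : ContDiffAt ℝ ∞ u p) : ContDiffAt ℝ ∞ (wirt a b c u) p := by
  have h : ContDiffAt ℝ ∞ (fderiv ℝ u) p := hu.fderiv_right (by simp)
  exact contDiffAt_const.mul ((h.clm_apply contDiffAt_const).add
    (contDiffAt_const.mul (h.clm_apply contDiffAt_const)))

theorem _root_.ContDiffAt.diff (hu : ContDiffAt ℝ ∞ u p) : DifferentiableAt ℝ u p :=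
  hu.differentiableAt (by simp)

theorem _root_.ContDiffAt.eventually_diff (hu : ContDiffAt ℝ ∞ u p) :
    ∀ᶠ q in 𝓝 p, DifferentiableAt ℝ u q := by
  have h1 : ContDiffAt ℝ 1 u p := hu.of_le (by exact_mod_cast le_top)
  exact (h1.eventually (by simp)).mono fun q hq => hq.differentiableAt (by simp)

/-- Both sides are the same combination of values of the second derivative, which is symmetric. The
two operators are unrelated on purpose: the lemma serves `∂_i ∂_j`, `∂_j ∂̄_k` and the exchange of
`∂_t` with either. -/
theorem wirt_comm (hu : ContDiffAt ℝ ∞ u p) :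
    wirt a b c (wirt a' b' c' u) p = wirt a' b' c' (wirt a b c u) p := by
  have h : ContDiffAt ℝ ∞ (fderiv ℝ u) p := hu.fderiv_right (by simp)
  have hd : DifferentiableAt ℝ (fderiv ℝ u) p := h.differentiableAt (by simp)
  have key : ∀ (a b w : W) (c : ℂ), fderiv ℝ (wirt a b c u) p w =
      (1 / 2 : ℂ) * (fderiv ℝ (fderiv ℝ u) p w a + c * fderiv ℝ (fderiv ℝ u) p w b) := by
    intro a b w c
    have hab : ∀ a, HasFDerivAt (fun q => fderiv ℝ u q a)
        ((fderiv ℝ (fderiv ℝ u) p).flip a) p := fun a => by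
      have := hd.hasFDerivAt.clm_apply (hasFDerivAt_const a p)
      simpa using this
    have := ((hab a).add ((hab b).const_mul c)).const_mul (1 / 2 : ℂ)
    have h2 : fderiv ℝ (wirt a b c u) p = _ := this.fderiv
    rw [h2]
    simp
    ring
  have hs : IsSymmSndFDerivAt ℝ u p :=
    hu.isSymmSndFDerivAt (by simpa using WithTop.coe_le_coe.2 (le_top : (2 : ℕ∞) ≤ ⊤))
  change (1 / 2 : ℂ) * (fderiv ℝ (wirt a' b' c' u) p a + c * fderiv ℝ (wirt a' b' c' u) p b) =
    (1 / 2 : ℂ) * (fderiv ℝ (wirt a b c u) p a' + c' * fderiv ℝ (wirt a b c u) p b')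
  simp only [key]
  rw [hs.eq a' a, hs.eq a' b, hs.eq b' a, hs.eq b' b]
  ring

end Wirtinger

/-! ### Wirtinger derivatives and the complex Hessian on `ℂⁿ`. -/

section Complex

open Filter Topology

variable {n : ℕ} {u v : (Fin n → ℂ) → ℂ} {z : Fin n → ℂ} {j k : Fin n}

theorem dz_eq_wirt (j : Fin n) :
    dz j = wirt (Pi.single j (1 : ℂ)) (Pi.single j Complex.I) (-Complex.I) := by
  ext u z
  simp only [dz, wirt]
  ring

theorem dzbar_eq_wirt (k : Fin n) :
    dzbar k = wirt (Pi.single k (1 : ℂ)) (Pi.single k Complex.I) Complex.I := by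
  ext u z
  simp only [dzbar, wirt]

/-- The complex Hessian `∂²u/∂z_j∂z̄_k`. -/
def hess (u : (Fin n → ℂ) → ℂ) (z : Fin n → ℂ) : Matrix (Fin n) (Fin n) ℂ :=
  Matrix.of fun j k => dz j (dzbar k u) z

theorem hess_apply (u : (Fin n → ℂ) → ℂ) (z : Fin n → ℂ) (j k : Fin n) :
    hess u z j k = dz j (dzbar k u) z := rfl

theorem hess_congr (h : u =ᶠ[𝓝 z] v) : hess u z = hess v z := by
  ext j k
  simp only [hess_apply, dz_eq_wirt, dzbar_eq_wirt]
  exact wirt_congr (wirt_eventuallyEq h)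

theorem hess_const (a : ℂ) : hess (fun _ => a) z = 0 := by
  ext j k
  have h : dzbar k (fun _ : Fin n → ℂ => a) = fun _ => 0 := by
    ext w; rw [dzbar_eq_wirt, wirt_const]
  simp [hess_apply, h, dz_eq_wirt, wirt_const]

theorem dz_conj (hu : DifferentiableAt ℝ u z) :
    dz j (fun w => conj (u w)) z = conj (dzbar j u z) := by
  rw [dz_eq_wirt, dzbar_eq_wirt, wirt_conj hu, map_neg, Complex.conj_I, neg_neg]

theorem dzbar_conj (hu : DifferentiableAt ℝ u z) :
    dzbar j (fun w => conj (u w)) z = conj (dz j u z) := by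
  rw [dz_eq_wirt, dzbar_eq_wirt, wirt_conj hu, Complex.conj_I]

theorem contDiffAt_dz (hu : ContDiffAt ℝ ∞ u z) : ContDiffAt ℝ ∞ (dz j u) z := by
  rw [dz_eq_wirt]; exact ContDiffAt.wirt hu

theorem contDiffAt_dzbar (hu : ContDiffAt ℝ ∞ u z) : ContDiffAt ℝ ∞ (dzbar j u) z := by
  rw [dzbar_eq_wirt]; exact ContDiffAt.wirt hu

theorem hess_add (hu : ContDiffAt ℝ ∞ u z) (hv : ContDiffAt ℝ ∞ v z) :
    hess (fun w => u w + v w) z = hess u z + hess v z := by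
  ext j k
  have h : dzbar k (fun w => u w + v w) =ᶠ[𝓝 z] fun w => dzbar k u w + dzbar k v w := by
    filter_upwards [ContDiffAt.eventually_diff hu, ContDiffAt.eventually_diff hv] with w h1 h2
    rw [dzbar_eq_wirt, wirt_add h1 h2]
  simp only [Matrix.add_apply, hess_apply]
  rw [dz_eq_wirt, wirt_congr h,
    wirt_add (contDiffAt_dzbar hu).diff (contDiffAt_dzbar hv).diff]

theorem hess_const_mul (a : ℂ) (hu : ContDiffAt ℝ ∞ u z) :
    hess (fun w => a * u w) z = a • hess u z := by
  ext j k
  have h : dzbar k (fun w => a * u w) =ᶠ[𝓝 z] fun w => a * dzbar k u w := by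
    filter_upwards [ContDiffAt.eventually_diff hu] with w h1
    rw [dzbar_eq_wirt, wirt_const_mul a h1]
  simp only [Matrix.smul_apply, hess_apply, smul_eq_mul]
  rw [dz_eq_wirt, wirt_congr h, wirt_const_mul a (contDiffAt_dzbar hu).diff]

theorem hess_sum {ι : Type*} {s : Finset ι} {f : ι → (Fin n → ℂ) → ℂ}
    (hf : ∀ i ∈ s, ContDiffAt ℝ ∞ (f i) z) :
    hess (fun w => ∑ i ∈ s, f i w) z = ∑ i ∈ s, hess (f i) z := by
  ext j k
  have h : dzbar k (fun w => ∑ i ∈ s, f i w) =ᶠ[𝓝 z] fun w => ∑ i ∈ s, dzbar k (f i) w := by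
    have : ∀ᶠ w in 𝓝 z, ∀ i ∈ s, DifferentiableAt ℝ (f i) w :=
      (Finset.eventually_all s).2 fun i hi => ContDiffAt.eventually_diff (hf i hi)
    filter_upwards [this] with w h1
    rw [dzbar_eq_wirt, wirt_sum h1]
  simp only [Matrix.sum_apply, hess_apply]
  rw [dz_eq_wirt, wirt_congr h, wirt_sum fun i hi => (contDiffAt_dzbar (hf i hi)).diff]

theorem hess_mul (hu : ContDiffAt ℝ ∞ u z) (hv : ContDiffAt ℝ ∞ v z) :
    hess (fun w => u w * v w) z j k = hess u z j k * v z + u z * hess v z j k +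
      dz j u z * dzbar k v z + dz j v z * dzbar k u z := by
  have h : dzbar k (fun w => u w * v w) =ᶠ[𝓝 z]
      fun w => dzbar k u w * v w + u w * dzbar k v w := by
    filter_upwards [ContDiffAt.eventually_diff hu, ContDiffAt.eventually_diff hv] with w h1 h2
    rw [dzbar_eq_wirt, wirt_mul h1 h2]
  simp only [hess_apply]
  have hu' := (contDiffAt_dzbar (j := k) hu).diff
  have hv' := (contDiffAt_dzbar (j := k) hv).diff
  rw [dz_eq_wirt, wirt_congr h, wirt_add (u := fun w => dzbar k u w * v w)
    (v := fun w => u w * dzbar k v w) (hu'.mul hv.diff) (hu.diff.mul hv'),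
    wirt_mul hu' hv.diff, wirt_mul hu.diff hv']
  ring

/-- The complex Hessian of a real function is Hermitian. -/
theorem hess_conj_of_real (hu : ContDiffAt ℝ ∞ u z) (hr : ∀ᶠ w in 𝓝 z, conj (u w) = u w)
    (j k : Fin n) : conj (hess u z j k) = hess u z k j := by
  -- For a real function `∂̄_k u` is the conjugate of `∂_k u`; one more conjugation leaves `∂̄_j ∂_k
  -- u`, and the two derivatives commute.
  have h1 : dzbar k u =ᶠ[𝓝 z] fun w => conj (dz k u w) := by
    filter_upwards [hr.eventually_nhds, ContDiffAt.eventually_diff hu] with w hw hd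
    rw [← dzbar_conj hd, dzbar_eq_wirt]
    exact wirt_congr (hw.mono fun _ h => h.symm)
  rw [hess_apply, hess_apply, dz_eq_wirt j, wirt_congr h1, ← dz_eq_wirt,
    dz_conj (contDiffAt_dz hu).diff, Complex.conj_conj, dz_eq_wirt, dzbar_eq_wirt,
    wirt_comm hu]

/-- A real-linear form in terms of the Wirtinger derivatives. -/
theorem fderiv_eq_sum_dz (u : (Fin n → ℂ) → ℂ) (z w : Fin n → ℂ) :
    fderiv ℝ u z w = ∑ l, (dz l u z * w l + dzbar l u z * conj (w l)) := by
  have hw : w = ∑ l, ((w l).re • (Pi.single l 1 : Fin n → ℂ) +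
      (w l).im • (Pi.single l Complex.I : Fin n → ℂ)) := by
    ext i
    simp only [Finset.sum_apply, Pi.add_apply, Pi.smul_apply, Pi.single_apply]
    rw [Finset.sum_eq_single i (fun l _ hl => by simp [hl.symm]) (by simp)]
    simp only [if_pos, Complex.real_smul, mul_one]
    exact (Complex.re_add_im (w i)).symm
  conv_lhs => rw [hw]
  rw [map_sum]
  refine Finset.sum_congr rfl fun l _ => ?_
  rw [map_add, map_smul, map_smul, dz, dzbar]
  conv_rhs => rw [← Complex.re_add_im (w l)]
  simp only [map_add, map_mul, Complex.conj_ofReal, Complex.conj_I, Complex.real_smul]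
  linear_combination ((w l).im * fderiv ℝ u z (Pi.single l Complex.I)) * Complex.I_sq

/-- The Jacobian matrix of a holomorphic map. -/
def jacobian (T : (Fin n → ℂ) → (Fin n → ℂ)) (z : Fin n → ℂ) : Matrix (Fin n) (Fin n) ℂ :=
  Matrix.of fun l k => fderiv ℂ T z (Pi.single k 1) l

theorem fderiv_real_single_I {F : Type*} [NormedAddCommGroup F] [NormedSpace ℂ F]
    {T : (Fin n → ℂ) → F} (k : Fin n) :
    fderiv ℂ T z (Pi.single k Complex.I) = Complex.I • fderiv ℂ T z (Pi.single k 1) := by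
  rw [← map_smul, ← Pi.single_smul]
  simp

/-- Since `T` is holomorphic, the chain rule does not mix types: the terms with `∂̄u` cancel. -/
theorem dz_comp {T : (Fin n → ℂ) → (Fin n → ℂ)} (hT : DifferentiableAt ℂ T z)
    (hu : DifferentiableAt ℝ u (T z)) :
    dz k (fun w => u (T w)) z = ∑ l, dz l u (T z) * jacobian T z l k := by
  have h := (hu.hasFDerivAt.comp z (hT.hasFDerivAt.restrictScalars ℝ)).fderiv
  rw [dz, show (fun w => u (T w)) = u ∘ T from rfl, h]
  simp only [ContinuousLinearMap.comp_apply, ContinuousLinearMap.coe_restrictScalars',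
    fderiv_real_single_I, fderiv_eq_sum_dz u, jacobian, Matrix.of_apply, Pi.smul_apply,
    smul_eq_mul, map_mul, Complex.conj_I, Finset.mul_sum, ← Finset.sum_sub_distrib]
  refine Finset.sum_congr rfl fun l _ => ?_
  linear_combination (-1 / 2 * dz l u (T z) * fderiv ℂ T z (Pi.single k 1) l +
    1 / 2 * dzbar l u (T z) * conj (fderiv ℂ T z (Pi.single k 1) l)) * Complex.I_sq

theorem dzbar_comp {T : (Fin n → ℂ) → (Fin n → ℂ)} (hT : DifferentiableAt ℂ T z)
    (hu : DifferentiableAt ℝ u (T z)) :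
    dzbar k (fun w => u (T w)) z = ∑ l, dzbar l u (T z) * conj (jacobian T z l k) := by
  have h := (hu.hasFDerivAt.comp z (hT.hasFDerivAt.restrictScalars ℝ)).fderiv
  rw [dzbar, show (fun w => u (T w)) = u ∘ T from rfl, h]
  simp only [ContinuousLinearMap.comp_apply, ContinuousLinearMap.coe_restrictScalars',
    fderiv_real_single_I, fderiv_eq_sum_dz u, jacobian, Matrix.of_apply, Pi.smul_apply,
    smul_eq_mul, map_mul, Complex.conj_I, Finset.mul_sum, ← Finset.sum_add_distrib]
  refine Finset.sum_congr rfl fun l _ => ?_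
  linear_combination (1 / 2 * dz l u (T z) * fderiv ℂ T z (Pi.single k 1) l -
    1 / 2 * dzbar l u (T z) * conj (fderiv ℂ T z (Pi.single k 1) l)) * Complex.I_sq

theorem dzbar_of_holomorphic (hu : DifferentiableAt ℂ u z) : dzbar k u z = 0 := by
  have h := (hu.hasFDerivAt.restrictScalars ℝ).fderiv
  rw [dzbar, h]
  simp only [ContinuousLinearMap.coe_restrictScalars', fderiv_real_single_I, smul_eq_mul]
  linear_combination (1 / 2 * fderiv ℂ u z (Pi.single k 1)) * Complex.I_sq

theorem dz_of_holomorphic (hu : DifferentiableAt ℂ u z) :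
    dz k u z = fderiv ℂ u z (Pi.single k 1) := by
  have h := (hu.hasFDerivAt.restrictScalars ℝ).fderiv
  rw [dz, h]
  simp only [ContinuousLinearMap.coe_restrictScalars', fderiv_real_single_I, smul_eq_mul]
  linear_combination (-1 / 2 * fderiv ℂ u z (Pi.single k 1)) * Complex.I_sq

theorem contDiffAt_real_of_complex {F G : Type*} [NormedAddCommGroup F] [NormedSpace ℂ F]
    [NormedAddCommGroup G] [NormedSpace ℂ G] {f : F → G} {x : F} (hf : ContDiffAt ℂ ω f x) :
    ContDiffAt ℝ ∞ f x :=
  (hf.restrict_scalars ℝ).of_le le_top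

theorem eventually_differentiable_of_analytic {F G : Type*} [NormedAddCommGroup F]
    [NormedSpace ℂ F] [NormedAddCommGroup G] [NormedSpace ℂ G] {f : F → G} {x : F}
    (hf : ContDiffAt ℂ ω f x) : ∀ᶠ y in 𝓝 x, DifferentiableAt ℂ f y :=
  (hf.eventually (by simp)).mono fun _ hy => hy.differentiableAt (by simp)

theorem contDiffAt_jacobian {T : (Fin n → ℂ) → (Fin n → ℂ)} (hT : ContDiffAt ℂ ω T z)
    (l k : Fin n) : ContDiffAt ℂ ω (fun w => jacobian T w l k) z := by
  have h : ContDiffAt ℂ ω (fderiv ℂ T) z := hT.fderiv_right (by simp)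
  have h2 : ContDiffAt ℂ ω (fun w => fderiv ℂ T w (Pi.single k 1)) z :=
    h.clm_apply contDiffAt_const
  exact contDiffAt_pi.1 h2 l

/-- Transformation of the complex Hessian under holomorphic maps. -/
theorem hess_comp {T : (Fin n → ℂ) → (Fin n → ℂ)} (hT : ContDiffAt ℂ ω T z)
    (hu : ContDiffAt ℝ ∞ u (T z)) :
    hess (fun w => u (T w)) z =
      (jacobian T z).transpose * hess u (T z) * (jacobian T z).map conj := by
  have hTd := eventually_differentiable_of_analytic hT
  have hTR := contDiffAt_real_of_complex hT
  ext j k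
  have h1 : dzbar k (fun w => u (T w)) =ᶠ[𝓝 z]
      fun w => ∑ l, dzbar l u (T w) * conj (jacobian T w l k) := by
    filter_upwards [hTd, hT.continuousAt.eventually (ContDiffAt.eventually_diff hu)] with w h1 h2
    exact dzbar_comp h1 h2
  have hJ : ∀ l, DifferentiableAt ℂ (fun w => jacobian T w l k) z := fun l =>
    (contDiffAt_jacobian hT l k).differentiableAt (by simp)
  have hJc : ∀ l, DifferentiableAt ℝ (fun w => conj (jacobian T w l k)) z := fun l =>
    Complex.conjCLE.differentiableAt.comp z ((hJ l).restrictScalars ℝ)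
  have hd : ∀ l, DifferentiableAt ℝ (fun w => dzbar l u (T w)) z := fun l =>
    ((contDiffAt_dzbar hu).comp z hTR).diff
  -- The conjugate Jacobian is antiholomorphic, so `∂_j` kills it. No first derivatives of `u`
  -- survive, and the Hessian transforms as a Hermitian form.
  have hJ0 : ∀ l, dz j (fun w => conj (jacobian T w l k)) z = 0 := fun l => by
    rw [dz_conj ((hJ l).restrictScalars ℝ), dzbar_of_holomorphic (hJ l), map_zero]
  have hdz : ∀ l, dz j (fun w => dzbar l u (T w)) z =
      ∑ m, hess u (T z) m l * jacobian T z m j := fun l =>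
    dz_comp hTd.self_of_nhds (contDiffAt_dzbar hu).diff
  rw [hess_apply, dz_eq_wirt, wirt_congr h1, wirt_sum
    (f := fun l w => dzbar l u (T w) * conj (jacobian T w l k)) fun l _ => (hd l).mul (hJc l)]
  simp only [wirt_mul (hd _) (hJc _), ← dz_eq_wirt, hJ0, hdz, Matrix.mul_apply,
    Matrix.transpose_apply, Matrix.map_apply, mul_zero, add_zero]
  refine Finset.sum_congr rfl fun l _ => ?_
  congr 1
  exact Finset.sum_congr rfl fun m _ => mul_comm _ _

/-- The complex Hessian of the logarithm of a positive function. -/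
theorem hess_log {S : (Fin n → ℂ) → ℂ} (hS : ContDiffAt ℝ ∞ S z)
    (hr : ∀ᶠ w in 𝓝 z, ((S w).re : ℂ) = S w) (h0 : 0 < (S z).re) :
    hess (fun w => (Real.log (S w).re : ℂ)) z j k =
      hess S z j k / S z - dz j S z * dzbar k S z / S z ^ 2 := by
  have hpos : ∀ᶠ w in 𝓝 z, 0 < (S w).re :=
    (Complex.continuous_re.continuousAt.comp hS.continuousAt).eventually_mem
      (isOpen_Ioi.mem_nhds h0)
  have h1 : dzbar k (fun w => (Real.log (S w).re : ℂ)) =ᶠ[𝓝 z]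
      fun w => dzbar k S w * (S w)⁻¹ := by
    filter_upwards [hpos, hr.eventually_nhds, ContDiffAt.eventually_diff hS] with w hw hrw hd
    have hre : HasFDerivAt (fun w => (S w).re) (Complex.reCLM.comp (fderiv ℝ S w)) w :=
      Complex.reCLM.hasFDerivAt.comp w hd.hasFDerivAt
    have hlog := Complex.ofRealCLM.hasFDerivAt.comp w (hre.log hw.ne')
    -- `S` agrees with its real part near `w`, so its derivative takes real values.
    have hSeq : fderiv ℝ S w = Complex.ofRealCLM.comp (Complex.reCLM.comp (fderiv ℝ S w)) := by
      have h3 := (Complex.ofRealCLM.hasFDerivAt.comp w hre).congr_of_eventuallyEq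
        (hrw.mono fun _ h => h.symm)
      exact h3.fderiv
    have hval : ∀ a, fderiv ℝ (fun w => (Real.log (S w).re : ℂ)) w a =
        (S w)⁻¹ * fderiv ℝ S w a := by
      intro a
      have h4 : fderiv ℝ (fun w => (Real.log (S w).re : ℂ)) w = _ := hlog.fderiv
      have h5 : fderiv ℝ S w a = ((fderiv ℝ S w a).re : ℂ) := by
        conv_lhs => rw [hSeq]
        rfl
      rw [h4, h5, ← hrw.self_of_nhds]
      simp
    simp only [dzbar, hval]
    ring
  have hne : S z ≠ 0 := fun h => by simp [h] at h0
  have hinv : DifferentiableAt ℝ (fun w => (S w)⁻¹) z := hS.diff.inv hne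
  rw [hess_apply, dz_eq_wirt, wirt_congr h1, wirt_mul (contDiffAt_dzbar hS).diff hinv,
    wirt_inv hS.diff hne, hess_apply, dz_eq_wirt]
  field_simp
  ring

end Complex

/-! ### Determinants of matrix-valued functions and integration by parts on `ℂⁿ` -/

section Determinant

variable {n : ℕ} {W : Type*} [NormedAddCommGroup W] [NormedSpace ℝ W] {p : W}

/-- Smoothness and derivatives of adjugates are thereby reduced to those of determinants. -/
theorem adjugate_eq_det_updateCol (A : Matrix (Fin n) (Fin n) ℂ) (i j : Fin n) :
    A.adjugate i j = (A.updateCol i (Pi.single j 1)).det := by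
  rw [← Matrix.cramer_apply, Matrix.cramer_eq_adjugate_mulVec, Matrix.mulVec_single_one,
    Matrix.col_apply]

/-- Jacobi's formula. Differentiate the Leibniz expansion factor by factor and collect, for each
entry `(i, j)`, the permutations with `σ j = i`; the remaining products sum to the cofactor. -/
theorem hasFDerivAt_det {M : W → Matrix (Fin n) (Fin n) ℂ} {M' : Fin n → Fin n → W →L[ℝ] ℂ}
    (h : ∀ i j, HasFDerivAt (fun q => M q i j) (M' i j) p) :
    HasFDerivAt (fun q => (M q).det) (∑ i, ∑ j, (M p).adjugate j i • M' i j) p := by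
  have hσ : ∀ σ : Equiv.Perm (Fin n), HasFDerivAt
      (fun q => ((Equiv.Perm.sign σ : ℤ) : ℂ) * ∏ i, M q (σ i) i)
      (((Equiv.Perm.sign σ : ℤ) : ℂ) •
        ∑ i, (∏ k ∈ Finset.univ.erase i, M p (σ k) k) • M' (σ i) i) p := fun σ =>
    (HasFDerivAt.finsetProd (u := Finset.univ) (fun i _ => h (σ i) i)).const_mul _
  have hs := HasFDerivAt.fun_sum (u := Finset.univ) fun σ _ => hσ σ
  simp only [Matrix.det_apply']
  refine hs.congr_fderiv ?_
  have hadj : ∀ i j, (M p).adjugate j i = ∑ σ : Equiv.Perm (Fin n),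
      ((Equiv.Perm.sign σ : ℤ) : ℂ) *
        if σ j = i then ∏ k ∈ Finset.univ.erase j, M p (σ k) k else 0 := by
    intro i j
    rw [adjugate_eq_det_updateCol, Matrix.det_apply']
    refine Finset.sum_congr rfl fun σ _ => ?_
    congr 1
    rw [← Finset.mul_prod_erase _ _ (Finset.mem_univ j), Matrix.updateCol_self, Pi.single_apply,
      ite_mul, one_mul, zero_mul]
    refine if_congr Iff.rfl (Finset.prod_congr rfl fun k hk => ?_) rfl
    rw [Matrix.updateCol_ne (Finset.ne_of_mem_erase hk)]
  ext w
  simp only [hadj, _root_.sum_apply, _root_.smul_apply, smul_eq_mul, Finset.sum_mul,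
    Finset.mul_sum]
  rw [Finset.sum_comm]
  rw [Finset.sum_comm (s := Finset.univ (α := Fin n)) (t := Finset.univ (α := Fin n))]
  refine Finset.sum_congr rfl fun j _ => ?_
  rw [Finset.sum_comm]
  refine Finset.sum_congr rfl fun σ _ => ?_
  rw [Finset.sum_eq_single (σ j) (fun i _ hi => by rw [if_neg hi.symm]; simp) (by simp),
    if_pos rfl, mul_assoc]

theorem hasDerivAt_det {M : ℝ → Matrix (Fin n) (Fin n) ℂ} {M' : Matrix (Fin n) (Fin n) ℂ} {t : ℝ}
    (h : ∀ i j, HasDerivAt (fun r => M r i j) (M' i j) t) :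
    HasDerivAt (fun r => (M r).det) ((M t).adjugate * M').trace t := by
  have := (hasFDerivAt_det fun i j => (h i j).hasFDerivAt).hasDerivAt
  convert this using 1
  simp only [Matrix.trace, Matrix.diag, Matrix.mul_apply, _root_.sum_apply, _root_.smul_apply]
  rw [Finset.sum_comm]
  simp

theorem wirt_det {M : W → Matrix (Fin n) (Fin n) ℂ} {a b : W} {c : ℂ}
    (h : ∀ i j, DifferentiableAt ℝ (fun q => M q i j) p) :
    wirt a b c (fun q => (M q).det) p =
      ∑ i, ∑ j, (M p).adjugate j i * wirt a b c (fun q => M q i j) p := by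
  simp only [wirt, (hasFDerivAt_det fun i j => (h i j).hasFDerivAt).fderiv, _root_.sum_apply,
    _root_.smul_apply, smul_eq_mul, Finset.mul_sum, ← Finset.sum_add_distrib]
  refine Finset.sum_congr rfl fun i _ => Finset.sum_congr rfl fun j _ => ?_
  ring

theorem contDiffAt_det {M : W → Matrix (Fin n) (Fin n) ℂ}
    (h : ∀ i j, ContDiffAt ℝ ∞ (fun q => M q i j) p) :
    ContDiffAt ℝ ∞ (fun q => (M q).det) p := by
  simp only [Matrix.det_apply']
  exact ContDiffAt.sum fun σ _ => contDiffAt_const.mul (contDiffAt_prod fun i _ => h _ _)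

theorem contDiffAt_adjugate {M : W → Matrix (Fin n) (Fin n) ℂ}
    (h : ∀ i j, ContDiffAt ℝ ∞ (fun q => M q i j) p) (i j : Fin n) :
    ContDiffAt ℝ ∞ (fun q => (M q).adjugate i j) p := by
  simp only [adjugate_eq_det_updateCol]
  refine contDiffAt_det fun k l => ?_
  simp only [Matrix.updateCol_apply]
  split_ifs
  · exact contDiffAt_const
  · exact h k l

/-- The divergence of the rows of the adjugate of a Jacobian matrix vanishes. -/
theorem sum_wirt_adjugate_eq_zero {M : W → Matrix (Fin n) (Fin n) ℂ} {a b : Fin n → W}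
    {c : Fin n → ℂ} (h : ∀ i j, DifferentiableAt ℝ (fun q => M q i j) p)
    (hsymm : ∀ i j l, wirt (a j) (b j) (c j) (fun q => M q i l) p =
      wirt (a i) (b i) (c i) (fun q => M q j l) p) (k : Fin n) :
    ∑ j, wirt (a j) (b j) (c j) (fun q => (M q).adjugate k j) p = 0 := by
  have hd : ∀ j i l, DifferentiableAt ℝ
      (fun q => ((M q).updateCol k (Pi.single j 1)) i l) p := fun j i l => by
    simp only [Matrix.updateCol_apply]
    split_ifs
    · exact differentiableAt_const _
    · exact h i l
  have hw : ∀ j i l, wirt (a j) (b j) (c j)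
      (fun q => ((M q).updateCol k (Pi.single j 1)) i l) p =
      if l = k then 0 else wirt (a j) (b j) (c j) (fun q => M q i l) p := fun j i l => by
    simp only [Matrix.updateCol_apply]
    split_ifs
    · exact wirt_const _
    · rfl
  simp only [adjugate_eq_det_updateCol (i := k), wirt_det (hd _), hw]
  -- This entry is the determinant of `M` with columns `k` and `l` replaced by the unit vectors `j`
  -- and `i`. Exchanging the columns exchanges `i` and `j`, so the entry is antisymmetric in them,
  -- whereas the derivatives are symmetric by `hsymm`; the double sum then equals its own negative.
  have hX : ∀ i j l, l ≠ k → ((M p).updateCol k (Pi.single j 1)).adjugate l i =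
      - ((M p).updateCol k (Pi.single i 1)).adjugate l j := by
    intro i j l hl
    rw [adjugate_eq_det_updateCol, adjugate_eq_det_updateCol]
    have := Matrix.det_permute' (Equiv.swap k l)
      (((M p).updateCol k (Pi.single i 1)).updateCol l (Pi.single j 1))
    rw [Equiv.Perm.sign_swap hl.symm] at this
    simp only [Units.val_neg, Units.val_one, Int.cast_neg, Int.cast_one, neg_mul, one_mul] at this
    rw [← this]
    congr 1
    ext r s
    simp only [Matrix.submatrix_apply, id, Matrix.updateCol_apply]
    by_cases hsl : s = l
    · subst hsl; simp [hl.symm]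
    · by_cases hsk : s = k
      · subst hsk; simp [hsl]
      · simp [Equiv.swap_apply_of_ne_of_ne hsk hsl, hsl, hsk]
  have hanti : ∀ l, ∑ j, ∑ i, ((M p).updateCol k (Pi.single j 1)).adjugate l i *
      (if l = k then 0 else wirt (a j) (b j) (c j) (fun q => M q i l) p) = 0 := by
    intro l
    by_cases hl : l = k
    · simp [hl]
    · simp only [if_neg hl]
      refine self_eq_neg.1 ?_
      conv_lhs => rw [Finset.sum_comm]
      simp only [← Finset.sum_neg_distrib]
      refine Finset.sum_congr rfl fun i _ => Finset.sum_congr rfl fun j _ => ?_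
      rw [hX _ _ _ hl, hsymm]
      ring
  calc _ = ∑ l, ∑ j, ∑ i, ((M p).updateCol k (Pi.single j 1)).adjugate l i *
      (if l = k then 0 else wirt (a j) (b j) (c j) (fun q => M q i l) p) := by
        rw [Finset.sum_comm]
        rw [Finset.sum_comm]
        conv_rhs => rw [Finset.sum_comm]
        exact Finset.sum_congr rfl fun j _ => Finset.sum_comm
    _ = 0 := Finset.sum_eq_zero fun l _ => hanti l

end Determinant

section IntegrationByParts

open MeasureTheory

variable {n : ℕ}

/-- Each directional derivative has integral zero by integration by parts against the constant `1`.
-/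
theorem integral_wirt_eq_zero {a b : Fin n → ℂ} {c : ℂ} {u : (Fin n → ℂ) → ℂ}
    (hu : ContDiff ℝ ∞ u) (hc : HasCompactSupport u) : ∫ z, wirt a b c u z = 0 := by
  have hcont : ∀ a : Fin n → ℂ, Continuous fun z => fderiv ℝ u z a := fun a =>
    (hu.continuous_fderiv (by simp)).clm_apply continuous_const
  have hsupp : ∀ a : Fin n → ℂ, HasCompactSupport fun z => fderiv ℝ u z a := fun a =>
    hc.fderiv_apply (𝕜 := ℝ) a
  have hint : ∀ a : Fin n → ℂ, Integrable fun z => fderiv ℝ u z a := fun a =>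
    (hcont a).integrable_of_hasCompactSupport (hsupp a)
  have key : ∀ a : Fin n → ℂ, ∫ z, fderiv ℝ u z a = 0 := fun a => by
    have := integral_mul_fderiv_eq_neg_fderiv_mul_of_integrable (μ := volume) (v := a)
      (f := fun _ : Fin n → ℂ => (1 : ℂ)) (g := u) (by simp) (by simpa using hint a)
      (by simpa using hu.continuous.integrable_of_hasCompactSupport hc)
      (fun _ _ => differentiableAt_const _) (fun z _ => hu.contDiffAt.diff)
    simpa using this
  simp only [wirt]
  rw [integral_const_mul, integral_add (hint a) ((hint b).const_mul c), integral_const_mul,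
    key, key]
  simp

variable {u v w : (Fin n → ℂ) → ℂ}

theorem contDiff_dz (hu : ContDiff ℝ ∞ u) (j : Fin n) : ContDiff ℝ ∞ (dz j u) :=
  contDiff_iff_contDiffAt.2 fun _ => contDiffAt_dz hu.contDiffAt

theorem contDiff_dzbar (hu : ContDiff ℝ ∞ u) (j : Fin n) : ContDiff ℝ ∞ (dzbar j u) :=
  contDiff_iff_contDiffAt.2 fun _ => contDiffAt_dzbar hu.contDiffAt

theorem contDiff_adjugate_hess (hw : ContDiff ℝ ∞ w) (i j : Fin n) :
    ContDiff ℝ ∞ (fun z => (hess w z).adjugate i j) :=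
  contDiff_iff_contDiffAt.2 fun _ => contDiffAt_adjugate
    (fun _ _ => (contDiff_dz (contDiff_dzbar hw _) _).contDiffAt) i j

/-- The matrix `∂_i ∂̄_l w` is the Jacobian of the functions `∂̄_l w`, so the required symmetry is
`∂_j ∂_i = ∂_i ∂_j`. This is the coordinate form of the closedness of `(∂∂̄w)^{n-1}`. -/
theorem sum_dz_adjugate_hess (hw : ContDiff ℝ ∞ w) (k : Fin n) (z : Fin n → ℂ) :
    ∑ j, dz j (fun z => (hess w z).adjugate k j) z = 0 := by
  simp only [dz_eq_wirt]
  refine sum_wirt_adjugate_eq_zero (M := hess w)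
    (fun i j => (contDiff_dz (contDiff_dzbar hw j) i).contDiffAt.diff) (fun i j l => ?_) k
  change wirt _ _ _ (dz i (dzbar l w)) z = wirt _ _ _ (dz j (dzbar l w)) z
  rw [dz_eq_wirt i, dz_eq_wirt j, ← wirt_comm (contDiff_dzbar hw l).contDiffAt]

theorem hasCompactSupport_dz (hu : HasCompactSupport u) (j : Fin n) :
    HasCompactSupport (dz j u) := by
  refine ((hu.fderiv (𝕜 := ℝ)).comp_left (g := fun A : (Fin n → ℂ) →L[ℝ] ℂ =>
    (1 / 2 : ℂ) * (A (Pi.single j 1) - Complex.I * A (Pi.single j Complex.I))) ?_)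
  simp

theorem hasCompactSupport_dzbar (hu : HasCompactSupport u) (j : Fin n) :
    HasCompactSupport (dzbar j u) := by
  refine ((hu.fderiv (𝕜 := ℝ)).comp_left (g := fun A : (Fin n → ℂ) →L[ℝ] ℂ =>
    (1 / 2 : ℂ) * (A (Pi.single j 1) + Complex.I * A (Pi.single j Complex.I))) ?_)
  simp

/-- Integrate the divergence of the field `u adj_{kj} ∂̄_k v`. Of the three terms of the product
rule, the one differentiating the adjugate disappears by `sum_dz_adjugate_hess`. Compact support of
either factor suffices, which allows `u` and `v` to be exchanged afterwards. -/
theorem integral_mul_trace_adjugate_hess (hu : ContDiff ℝ ∞ u) (hv : ContDiff ℝ ∞ v)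
    (hw : ContDiff ℝ ∞ w) (hc : HasCompactSupport u ∨ HasCompactSupport v) :
    Integrable (fun z => u z * ((hess w z).adjugate * hess v z).trace) ∧
    ∫ z, u z * ((hess w z).adjugate * hess v z).trace =
      - ∫ z, ∑ k, ∑ j, (hess w z).adjugate k j * dz j u z * dzbar k v z := by
  have hadj := contDiff_adjugate_hess hw
  have hY : ∀ k j, ContDiff ℝ ∞ fun z => u z * ((hess w z).adjugate k j * dzbar k v z) :=
    fun k j => hu.mul ((hadj k j).mul (contDiff_dzbar hv k))
  have hYc : ∀ k j, HasCompactSupport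
      fun z => u z * ((hess w z).adjugate k j * dzbar k v z) := fun k j => by
    rcases hc with hc | hc
    · exact hc.mul_right
    · exact ((hasCompactSupport_dzbar hc k).mul_left).mul_left
  have hZi : ∀ k j, Integrable fun z => dz j (fun z => u z * ((hess w z).adjugate k j *
      dzbar k v z)) z := fun k j =>
    (contDiff_dz (hY k j) j).continuous.integrable_of_hasCompactSupport
      (hasCompactSupport_dz (hYc k j) j)
  have hBi : ∀ k j, Integrable fun z => (hess w z).adjugate k j * dz j u z * dzbar k v z :=
    fun k j => by
      refine (((hadj k j).mul (contDiff_dz hu j)).mul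
        (contDiff_dzbar hv k)).continuous.integrable_of_hasCompactSupport ?_
      rcases hc with hc | hc
      · exact ((hasCompactSupport_dz hc j).mul_left).mul_right
      · exact (hasCompactSupport_dzbar hc k).mul_left
  have hpt : ∀ z, u z * ((hess w z).adjugate * hess v z).trace =
      ∑ k, ∑ j, dz j (fun z => u z * ((hess w z).adjugate k j * dzbar k v z)) z -
        ∑ k, ∑ j, (hess w z).adjugate k j * dz j u z * dzbar k v z := by
    intro z
    have h1 : ∀ k j, dz j (fun z => u z * ((hess w z).adjugate k j * dzbar k v z)) z =
        (hess w z).adjugate k j * dz j u z * dzbar k v z +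
        u z * dzbar k v z * dz j (fun z => (hess w z).adjugate k j) z +
        u z * ((hess w z).adjugate k j * hess v z j k) := fun k j => by
      rw [dz_eq_wirt, wirt_mul (v := fun z => (hess w z).adjugate k j * dzbar k v z)
        hu.contDiffAt.diff ((hadj k j).mul (contDiff_dzbar hv k)).contDiffAt.diff,
        wirt_mul (hadj k j).contDiffAt.diff (contDiff_dzbar hv k).contDiffAt.diff,
        hess_apply, dz_eq_wirt]
      ring
    simp only [h1, Finset.sum_add_distrib, ← Finset.mul_sum, sum_dz_adjugate_hess hw,
      Matrix.trace, Matrix.diag, Matrix.mul_apply]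
    simp
  have hZ : ∀ k j, ∫ z, dz j (fun z => u z * ((hess w z).adjugate k j *
      dzbar k v z)) z = 0 := fun k j => by
    simp only [dz_eq_wirt]
    exact integral_wirt_eq_zero (hY k j) (hYc k j)
  have hS1 := integrable_finsetSum Finset.univ fun k _ =>
    integrable_finsetSum Finset.univ fun j _ => hZi k j
  have hS2 := integrable_finsetSum Finset.univ fun k _ =>
    integrable_finsetSum Finset.univ fun j _ => hBi k j
  refine ⟨(hS1.sub hS2).congr (Filter.Eventually.of_forall fun z => (hpt z).symm), ?_⟩
  simp only [hpt]
  rw [integral_sub hS1 hS2, integral_finsetSum _ fun k _ =>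
    integrable_finsetSum Finset.univ fun j _ => hZi k j]
  simp only [integral_finsetSum _ fun j _ => hZi _ j, hZ]
  simp

theorem conj_adjugate_of_hermitian {M : Matrix (Fin n) (Fin n) ℂ}
    (h : ∀ j k, conj (M j k) = M k j) (j k : Fin n) :
    conj (M.adjugate j k) = M.adjugate k j := by
  have hM : M.map conj = M.transpose := by
    ext j k; exact h j k
  have h1 := (starRingEnd ℂ).map_adjugate M
  have h2 : (starRingEnd ℂ).mapMatrix M = M.transpose := hM
  rw [h2, ← Matrix.adjugate_transpose] at h1
  exact congrFun (congrFun h1 j) k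

/-- Both sides become real parts of the first-order form `-∫ ∑ adj_{kj} ∂_j u ∂̄_k v` and its
exchange. For real functions the adjugate of the Hessian of `w` is Hermitian, so conjugation
exchanges `u` and `v` and leaves the real part unchanged. -/
theorem integral_mul_trace_adjugate_hess_symm {u v w : (Fin n → ℂ) → ℝ} (hu : ContDiff ℝ ∞ u)
    (hv : ContDiff ℝ ∞ v) (hw : ContDiff ℝ ∞ w) (hc : HasCompactSupport u) :
    ∫ z, u z * ((hess (fun z => (w z : ℂ)) z).adjugate * hess (fun z => (v z : ℂ)) z).trace.re =
    ∫ z, v z *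
      ((hess (fun z => (w z : ℂ)) z).adjugate * hess (fun z => (u z : ℂ)) z).trace.re := by
  have hC : ∀ {f : (Fin n → ℂ) → ℝ}, ContDiff ℝ ∞ f → ContDiff ℝ ∞ fun z => (f z : ℂ) :=
    fun hf => Complex.ofRealCLM.contDiff.comp hf
  have hcC : HasCompactSupport fun z => (u z : ℂ) := hc.comp_left Complex.ofReal_zero
  obtain ⟨i1, e1⟩ := integral_mul_trace_adjugate_hess (hC hu) (hC hv) (hC hw) (Or.inl hcC)
  obtain ⟨i2, e2⟩ := integral_mul_trace_adjugate_hess (hC hv) (hC hu) (hC hw) (Or.inr hcC)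
  have hre : ∀ {f : (Fin n → ℂ) → ℝ} {g : (Fin n → ℂ) → ℂ},
      Integrable (fun z => (f z : ℂ) * g z) →
      ∫ z, f z * (g z).re = (∫ z, (f z : ℂ) * g z).re := fun hi => by
    have := integral_re hi
    simpa [Complex.re_ofReal_mul] using this
  rw [hre i1, hre i2, e1, e2, ← Complex.conj_re, map_neg, ← integral_conj]
  congr 4
  ext z
  simp only [map_sum, map_mul]
  rw [Finset.sum_comm]
  refine Finset.sum_congr rfl fun j _ => Finset.sum_congr rfl fun k _ => ?_
  have hdu : ∀ l, conj (dz l (fun z => (u z : ℂ)) z) = dzbar l (fun z => (u z : ℂ)) z :=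
    fun l => by
      rw [← dzbar_conj (hC hu).contDiffAt.diff]
      simp
  have hdv : ∀ l, conj (dzbar l (fun z => (v z : ℂ)) z) = dz l (fun z => (v z : ℂ)) z :=
    fun l => by
      rw [← dz_conj (hC hv).contDiffAt.diff]
      simp
  rw [conj_adjugate_of_hermitian fun j k =>
    hess_conj_of_real (hC hw).contDiffAt (Filter.Eventually.of_forall fun _ => by simp) j k,
    hdu, hdv]
  ring

/-- Every smooth function on an open set agrees near a given compact subset with a smooth
function on the whole space. -/
theorem exists_contDiff_eventuallyEq {Ω K : Set (Fin n → ℂ)} (hΩ : IsOpen Ω) (hK : IsCompact K)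
    (hKΩ : K ⊆ Ω) {f : (Fin n → ℂ) → ℝ} (hf : ContDiffOn ℝ ∞ f Ω) :
    ∃ g : (Fin n → ℂ) → ℝ, ContDiff ℝ ∞ g ∧ ∀ z ∈ K, g =ᶠ[nhds z] f := by
  obtain ⟨t, ht, hKt, htΩ⟩ := exists_compact_between hK hΩ hKΩ
  obtain ⟨χ, h1, h0, -⟩ := exists_contMDiffMap_one_nhds_of_subset_interior (n := (⊤ : ℕ∞))
    𝓘(ℝ, Fin n → ℂ) hK.isClosed hKt
  have hχ : ContDiff ℝ ∞ χ := χ.contMDiff.contDiff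
  refine ⟨fun z => χ z * f z, contDiff_iff_contDiffAt.2 fun z => ?_, fun z hz => ?_⟩
  · by_cases hz : z ∈ Ω
    · exact hχ.contDiffAt.mul (hf.contDiffAt (hΩ.mem_nhds hz))
    · have : (fun z => χ z * f z) =ᶠ[nhds z] fun _ => 0 := by
        filter_upwards [ht.isClosed.isOpen_compl.mem_nhds fun h => hz (htΩ h)] with y hy
        rw [h0 y hy, zero_mul]
      exact contDiffAt_const.congr_of_eventuallyEq this
  · filter_upwards [eventually_nhdsSet_iff_forall.1 h1 z hz] with y hy
    rw [hy, one_mul]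

theorem hess_eq_zero_of_notMem_tsupport {z : Fin n → ℂ} (hz : z ∉ tsupport u) :
    hess u z = 0 := by
  rw [hess_congr (notMem_tsupport_iff_eventuallyEq.1 hz)]
  exact hess_const 0

theorem tsupport_ofReal (u : (Fin n → ℂ) → ℝ) :
    tsupport (fun z => (u z : ℂ)) = tsupport u := by
  unfold tsupport
  congr 1
  ext z
  simp

/-- The operator `u ↦ tr (adj (∂∂̄w) ∂∂̄u)` is formally self-adjoint. -/
theorem setIntegral_mul_trace_adjugate_hess_symm {Ω : Set (Fin n → ℂ)} (hΩ : IsOpen Ω)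
    {u v w : (Fin n → ℂ) → ℝ} (hu : ContDiff ℝ ∞ u) (hc : HasCompactSupport u)
    (huΩ : tsupport u ⊆ Ω) (hv : ContDiffOn ℝ ∞ v Ω) (hw : ContDiffOn ℝ ∞ w Ω) :
    ∫ z in Ω, u z *
      ((hess (fun z => (w z : ℂ)) z).adjugate * hess (fun z => (v z : ℂ)) z).trace.re =
    ∫ z in Ω, v z *
      ((hess (fun z => (w z : ℂ)) z).adjugate * hess (fun z => (u z : ℂ)) z).trace.re := by
  -- Both integrands vanish off the support of `u`, so `v` and `w` may be replaced by global smooth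
  -- functions agreeing with them near it.
  obtain ⟨v', hv', hvv⟩ := exists_contDiff_eventuallyEq hΩ hc huΩ hv
  obtain ⟨w', hw', hww⟩ := exists_contDiff_eventuallyEq hΩ hc huΩ hw
  have hcast : ∀ {f g : (Fin n → ℂ) → ℝ} {z}, f =ᶠ[nhds z] g →
      (fun z => (f z : ℂ)) =ᶠ[nhds z] fun z => (g z : ℂ) := fun h =>
    h.mono fun _ hy => congrArg _ hy
  have h0 : ∀ z ∉ tsupport u, hess (fun z => (u z : ℂ)) z = 0 := fun z hz =>
    hess_eq_zero_of_notMem_tsupport (by rwa [tsupport_ofReal])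
  rw [setIntegral_eq_integral_of_forall_compl_eq_zero
    (fun z hz => by rw [image_eq_zero_of_notMem_tsupport fun h => hz (huΩ h), zero_mul]),
    setIntegral_eq_integral_of_forall_compl_eq_zero
    (fun z hz => by rw [h0 z fun h => hz (huΩ h)]; simp)]
  convert integral_mul_trace_adjugate_hess_symm hu hv' hw' hc using 3 with z z
  · by_cases hz : z ∈ tsupport u
    · rw [hess_congr (hcast (hvv z hz)), hess_congr (hcast (hww z hz))]
    · simp [image_eq_zero_of_notMem_tsupport hz]
  · by_cases hz : z ∈ tsupport u
    · rw [hess_congr (hcast (hww z hz)), (hvv z hz).eq_of_nhds]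
    · simp [h0 z hz]

end IntegrationByParts

/-! ### The Hessian of `log ∑ |f_α|²` -/

section LogSum

variable {n : ℕ} {ι : Type*} [Fintype ι] {f : ι → (Fin n → ℂ) → ℂ} {z : Fin n → ℂ}

theorem contDiffAt_sum_mul_conj (hf : ∀ α, ContDiffAt ℂ ω (f α) z) :
    ContDiffAt ℝ ∞ (fun w => ∑ α, f α w * conj (f α w)) z :=
  ContDiffAt.sum fun α _ => (contDiffAt_real_of_complex (hf α)).mul
    (Complex.conjCLE.contDiff.contDiffAt.comp z (contDiffAt_real_of_complex (hf α)))

theorem dz_mul_conj {f g : (Fin n → ℂ) → ℂ} (hf : DifferentiableAt ℂ f z)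
    (hg : DifferentiableAt ℂ g z) (j : Fin n) :
    dz j (fun w => f w * conj (g w)) z = fderiv ℂ f z (Pi.single j 1) * conj (g z) := by
  have hf' := hf.restrictScalars ℝ
  have hg' := hg.restrictScalars ℝ
  rw [dz_eq_wirt, wirt_mul (v := fun w => conj (g w)) hf' (Complex.conjCLE.differentiableAt.comp z hg'), ← dz_eq_wirt,
    dz_of_holomorphic hf]
  change _ + f z * dz j (fun w => conj (g w)) z = _
  rw [dz_conj hg', dzbar_of_holomorphic hg]
  simp

theorem dzbar_mul_conj {f g : (Fin n → ℂ) → ℂ} (hf : DifferentiableAt ℂ f z)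
    (hg : DifferentiableAt ℂ g z) (j : Fin n) :
    dzbar j (fun w => f w * conj (g w)) z = f z * conj (fderiv ℂ g z (Pi.single j 1)) := by
  have hf' := hf.restrictScalars ℝ
  have hg' := hg.restrictScalars ℝ
  rw [dzbar_eq_wirt, wirt_mul (v := fun w => conj (g w)) hf' (Complex.conjCLE.differentiableAt.comp z hg'), ← dzbar_eq_wirt,
    dzbar_of_holomorphic hf]
  change _ + f z * dzbar j (fun w => conj (g w)) z = _
  rw [dzbar_conj hg', dz_of_holomorphic hg]
  simp

theorem hess_mul_conj {f : (Fin n → ℂ) → ℂ} (hf : ContDiffAt ℂ ω f z) (j k : Fin n) :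
    hess (fun w => f w * conj (f w)) z j k =
      fderiv ℂ f z (Pi.single j 1) * conj (fderiv ℂ f z (Pi.single k 1)) := by
  have hd : DifferentiableAt ℂ f z := hf.differentiableAt (by simp)
  have h : dzbar k (fun w => f w * conj (f w)) =ᶠ[nhds z]
      fun w => f w * conj (fderiv ℂ f w (Pi.single k 1)) := by
    filter_upwards [eventually_differentiable_of_analytic hf] with w hw
    exact dzbar_mul_conj hw hw k
  have h2 : ContDiffAt ℂ ω (fun w => fderiv ℂ f w (Pi.single k 1)) z :=
    (hf.fderiv_right (m := ω) (by simp)).clm_apply contDiffAt_const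
  rw [hess_apply, dz_eq_wirt, wirt_congr h, ← dz_eq_wirt,
    dz_mul_conj hd (h2.differentiableAt (by simp))]

theorem hess_log_sum_normSq (hf : ∀ α, ContDiffAt ℂ ω (f α) z) (h0 : 0 < ∑ α, ‖f α z‖ ^ 2)
    (j k : Fin n) :
    hess (fun w => (Real.log (∑ α, ‖f α w‖ ^ 2) : ℂ)) z j k =
      (∑ α, fderiv ℂ (f α) z (Pi.single j 1) * conj (fderiv ℂ (f α) z (Pi.single k 1))) /
        (∑ α, ‖f α z‖ ^ 2 : ℝ) -
      (∑ α, fderiv ℂ (f α) z (Pi.single j 1) * conj (f α z)) *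
        (∑ α, f α z * conj (fderiv ℂ (f α) z (Pi.single k 1))) /
        (∑ α, ‖f α z‖ ^ 2 : ℝ) ^ 2 := by
  have hS : ∀ w, ∑ α, f α w * conj (f α w) = ((∑ α, ‖f α w‖ ^ 2 : ℝ) : ℂ) := fun w => by
    push_cast
    exact Finset.sum_congr rfl fun α _ => Complex.mul_conj' _
  have hre : ∀ w, (∑ α, f α w * conj (f α w)).re = ∑ α, ‖f α w‖ ^ 2 := fun w => by
    rw [hS, Complex.ofReal_re]
  have hd : ∀ α, DifferentiableAt ℂ (f α) z := fun α => (hf α).differentiableAt (by simp)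
  have hsm : ∀ α, ContDiffAt ℝ ∞ (fun w => f α w * conj (f α w)) z := fun α =>
    (contDiffAt_real_of_complex (hf α)).mul
      (Complex.conjCLE.contDiff.contDiffAt.comp z (contDiffAt_real_of_complex (hf α)))
  have h := hess_log (j := j) (k := k) (contDiffAt_sum_mul_conj hf)
    (Filter.Eventually.of_forall fun w => by rw [hS, Complex.ofReal_re]) (by rwa [hre])
  simp only [hre] at h
  rw [h, hS, hess_sum fun α _ => hsm α, dz_eq_wirt, dzbar_eq_wirt,
    wirt_sum (f := fun α w => f α w * conj (f α w)) fun α _ => (hsm α).diff,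
    wirt_sum (f := fun α w => f α w * conj (f α w)) fun α _ => (hsm α).diff,
    ← dz_eq_wirt, ← dzbar_eq_wirt]
  simp only [Matrix.sum_apply, hess_mul_conj (hf _), dz_mul_conj (hd _) (hd _),
    dzbar_mul_conj (hd _) (hd _)]

/-- `log |f|²` is pluriharmonic: with one summand the two terms of `hess_log_sum_normSq` cancel.
This is why the curvature does not depend on the holomorphic frame. -/
theorem hess_log_normSq {f : (Fin n → ℂ) → ℂ} (hf : ContDiffAt ℂ ω f z) (h0 : f z ≠ 0) :
    hess (fun w => (Real.log (‖f w‖ ^ 2) : ℂ)) z = 0 := by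
  ext j k
  have h := hess_log_sum_normSq (ι := Unit) (f := fun _ => f) (fun _ => hf)
    (by simpa using pow_pos (norm_pos_iff.2 h0) 2) j k
  simp only [Finset.univ_unique, Finset.sum_singleton] at h
  have h1 : ((‖f z‖ ^ 2 : ℝ) : ℂ) = f z * conj (f z) := by
    rw [Complex.mul_conj']; push_cast; rfl
  have h2 : conj (f z) ≠ 0 := by simpa using h0
  rw [h, h1, Matrix.zero_apply]
  field_simp
  ring

end LogSum

/-! ### Changes of coordinates -/

section Manifold

open Filter Topology

variable {n : ℕ} {X : Type*} [TopologicalSpace X] [ChartedSpace (Fin n → ℂ) X]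

/-- The change of coordinates from the preferred chart around `x₀` to the one around `x₁`. -/
def trans (x₀ x₁ : X) (z : Fin n → ℂ) : Fin n → ℂ :=
  chartAt (Fin n → ℂ) x₁ ((chartAt (Fin n → ℂ) x₀).symm z)

/-- A function in the preferred coordinates around `x₀`. -/
def loc (φ : X → ℝ) (x₀ : X) (z : Fin n → ℂ) : ℝ := φ ((chartAt (Fin n → ℂ) x₀).symm z)

theorem chart_symm_chart {x₀ x : X} (hx : x ∈ (chartAt (Fin n → ℂ) x₀).source) :
    (chartAt (Fin n → ℂ) x₀).symm (chartAt (Fin n → ℂ) x₀ x) = x :=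
  (chartAt (Fin n → ℂ) x₀).left_inv hx

theorem continuousAt_chart_symm {x₀ x : X} (hx : x ∈ (chartAt (Fin n → ℂ) x₀).source) :
    ContinuousAt (chartAt (Fin n → ℂ) x₀).symm (chartAt (Fin n → ℂ) x₀ x) :=
  (chartAt (Fin n → ℂ) x₀).continuousAt_symm ((chartAt (Fin n → ℂ) x₀).map_source hx)

theorem trans_chart {x₀ x₁ x : X} (hx : x ∈ (chartAt (Fin n → ℂ) x₀).source) :
    trans x₀ x₁ (chartAt (Fin n → ℂ) x₀ x) = chartAt (Fin n → ℂ) x₁ x := by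
  rw [trans, chart_symm_chart hx]

theorem eventually_chart_symm {x₀ x : X} (hx : x ∈ (chartAt (Fin n → ℂ) x₀).source)
    {p : X → Prop} (hp : ∀ᶠ y in 𝓝 x, p y) :
    ∀ᶠ z in 𝓝 (chartAt (Fin n → ℂ) x₀ x), p ((chartAt (Fin n → ℂ) x₀).symm z) := by
  have h := continuousAt_chart_symm hx
  rw [ContinuousAt, chart_symm_chart hx] at h
  exact h.eventually hp

theorem eventually_symm_trans {x₀ x₁ x : X} (hx : x ∈ (chartAt (Fin n → ℂ) x₀).source)
    (hx' : x ∈ (chartAt (Fin n → ℂ) x₁).source) :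
    ∀ᶠ z in 𝓝 (chartAt (Fin n → ℂ) x₀ x),
      (chartAt (Fin n → ℂ) x₁).symm (trans x₀ x₁ z) = (chartAt (Fin n → ℂ) x₀).symm z :=
  (eventually_chart_symm hx ((chartAt (Fin n → ℂ) x₁).open_source.mem_nhds hx')).mono
    fun _ hz => chart_symm_chart hz

section

variable [IsManifold 𝓘(ℂ, Fin n → ℂ) ω X]

theorem contDiffAt_trans {x₀ x₁ x : X} (hx : x ∈ (chartAt (Fin n → ℂ) x₀).source)
    (hx' : x ∈ (chartAt (Fin n → ℂ) x₁).source) :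
    ContDiffAt ℂ ω (trans x₀ x₁) (chartAt (Fin n → ℂ) x₀ x) := by
  have h1 : ContMDiffAt 𝓘(ℂ, Fin n → ℂ) 𝓘(ℂ, Fin n → ℂ) ω (chartAt (Fin n → ℂ) x₀).symm
      (chartAt (Fin n → ℂ) x₀ x) :=
    contMDiffOn_chart_symm.contMDiffAt ((chartAt (Fin n → ℂ) x₀).open_target.mem_nhds
      ((chartAt (Fin n → ℂ) x₀).map_source hx))
  have h2 : ContMDiffAt 𝓘(ℂ, Fin n → ℂ) 𝓘(ℂ, Fin n → ℂ) ω (chartAt (Fin n → ℂ) x₁)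
      ((chartAt (Fin n → ℂ) x₀).symm (chartAt (Fin n → ℂ) x₀ x)) := by
    rw [chart_symm_chart hx]
    exact contMDiffOn_chart.contMDiffAt ((chartAt (Fin n → ℂ) x₁).open_source.mem_nhds hx')
  exact (h2.comp _ h1).contDiffAt

/-- The real manifold underlying a complex manifold. -/
instance isManifold_real : IsManifold 𝓘(ℝ, Fin n → ℂ) ∞ X := by
  refine isManifold_of_contDiffOn _ _ _ fun e e' he he' => ?_
  have h1 : ContMDiffOn 𝓘(ℂ, Fin n → ℂ) 𝓘(ℂ, Fin n → ℂ) ω e.symm e.target :=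
    contMDiffOn_symm_of_mem_maximalAtlas (IsManifold.subset_maximalAtlas he)
  have h2 : ContMDiffOn 𝓘(ℂ, Fin n → ℂ) 𝓘(ℂ, Fin n → ℂ) ω e' e'.source :=
    contMDiffOn_of_mem_maximalAtlas (IsManifold.subset_maximalAtlas he')
  have h3 := (h2.comp' h1).contDiffOn
  have h4 : ContDiffOn ℝ ∞ (e' ∘ e.symm) (e.target ∩ e.symm ⁻¹' e'.source) :=
    (h3.restrict_scalars ℝ).of_le le_top
  refine h4.congr_mono (fun z _ => rfl) fun z hz => ?_
  simpa using hz

theorem jacobian_eq_toMatrix' (T : (Fin n → ℂ) → (Fin n → ℂ)) (z : Fin n → ℂ) :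
    jacobian T z = LinearMap.toMatrix' (fderiv ℂ T z : (Fin n → ℂ) →ₗ[ℂ] (Fin n → ℂ)) := by
  ext i j
  rw [LinearMap.toMatrix'_apply]
  rfl

/-- The reverse transition map is a local inverse, so the product of the two Jacobians is the
identity. -/
theorem det_jacobian_trans_ne_zero {x₀ x₁ x : X} (hx : x ∈ (chartAt (Fin n → ℂ) x₀).source)
    (hx' : x ∈ (chartAt (Fin n → ℂ) x₁).source) :
    (jacobian (trans x₀ x₁) (chartAt (Fin n → ℂ) x₀ x)).det ≠ 0 := by
  have h1 := (contDiffAt_trans hx hx').differentiableAt (by simp)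
  have h2 := (contDiffAt_trans hx' hx).differentiableAt (by simp)
  rw [← trans_chart hx] at h2
  have h3 := (h2.hasFDerivAt.comp _ h1.hasFDerivAt)
  have h4 : trans x₁ x₀ ∘ trans x₀ x₁ =ᶠ[𝓝 (chartAt (Fin n → ℂ) x₀ x)] id := by
    filter_upwards [eventually_symm_trans hx hx', (chartAt (Fin n → ℂ) x₀).open_target.mem_nhds
      ((chartAt (Fin n → ℂ) x₀).map_source hx)] with z hz hz'
    rw [Function.comp_apply, trans, hz]
    exact (chartAt (Fin n → ℂ) x₀).right_inv hz'
  have h5 := h3.unique ((hasFDerivAt_id _).congr_of_eventuallyEq h4)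
  have h6 := congrArg (fun A : (Fin n → ℂ) →L[ℂ] (Fin n → ℂ) =>
    LinearMap.toMatrix' (A : (Fin n → ℂ) →ₗ[ℂ] (Fin n → ℂ))) h5
  simp only [ContinuousLinearMap.toLinearMap_comp, LinearMap.toMatrix'_comp,
    ← jacobian_eq_toMatrix'] at h6
  have h7 := congrArg Matrix.det (h6.trans LinearMap.toMatrix'_id)
  rw [Matrix.det_mul, Matrix.det_one] at h7
  exact right_ne_zero_of_mul (h7.trans_ne one_ne_zero)

theorem contDiffOn_loc {φ : X → ℝ} (hφ : ContMDiff 𝓘(ℝ, Fin n → ℂ) 𝓘(ℝ, ℝ) ∞ φ) (x₀ : X) :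
    ContDiffOn ℝ ∞ (loc φ x₀) (chartAt (Fin n → ℂ) x₀).target :=
  (hφ.comp_contMDiffOn contMDiffOn_chart_symm).contDiffOn

theorem contDiffAt_ofReal {W : Type*} [NormedAddCommGroup W] [NormedSpace ℝ W] {f : W → ℝ}
    {p : W} (hf : ContDiffAt ℝ ∞ f p) : ContDiffAt ℝ ∞ (fun q => (f q : ℂ)) p :=
  Complex.ofRealCLM.contDiff.contDiffAt.comp p hf

theorem contDiffAt_loc {φ : X → ℝ} (hφ : ContMDiff 𝓘(ℝ, Fin n → ℂ) 𝓘(ℝ, ℝ) ∞ φ) {x₀ x : X}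
    (hx : x ∈ (chartAt (Fin n → ℂ) x₀).source) :
    ContDiffAt ℝ ∞ (fun z => (loc φ x₀ z : ℂ)) (chartAt (Fin n → ℂ) x₀ x) :=
  contDiffAt_ofReal ((contDiffOn_loc hφ x₀).contDiffAt
    ((chartAt (Fin n → ℂ) x₀).open_target.mem_nhds ((chartAt (Fin n → ℂ) x₀).map_source hx)))

theorem hess_loc_trans {φ : X → ℝ} (hφ : ContMDiff 𝓘(ℝ, Fin n → ℂ) 𝓘(ℝ, ℝ) ∞ φ) {x₀ x₁ x : X}
    (hx : x ∈ (chartAt (Fin n → ℂ) x₀).source) (hx' : x ∈ (chartAt (Fin n → ℂ) x₁).source) :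
    hess (fun z => (loc φ x₀ z : ℂ)) (chartAt (Fin n → ℂ) x₀ x) =
      (jacobian (trans x₀ x₁) (chartAt (Fin n → ℂ) x₀ x)).transpose *
        hess (fun z => (loc φ x₁ z : ℂ)) (chartAt (Fin n → ℂ) x₁ x) *
        (jacobian (trans x₀ x₁) (chartAt (Fin n → ℂ) x₀ x)).map conj := by
  have h := hess_comp (contDiffAt_trans hx hx') (u := fun z => (loc φ x₁ z : ℂ))
    (by rw [trans_chart hx]; exact contDiffAt_loc hφ hx')
  rw [trans_chart hx] at h
  rw [← h]
  refine hess_congr ((eventually_symm_trans hx hx').mono fun z hz => ?_)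
  simp only [loc, hz]

end

section Bundle

variable {L : X → Type*} [TopologicalSpace (Bundle.TotalSpace ℂ L)]
  [∀ x, AddCommGroup (L x)] [∀ x, Module ℂ (L x)] [∀ x, TopologicalSpace (L x)]
  [FiberBundle ℂ L] [VectorBundle ℂ ℂ L]

variable (n L) in
/-- The open set on which the preferred chart and trivialization around `x₀` are defined. -/
def chartDomain (x₀ : X) : Set X :=
  (chartAt (Fin n → ℂ) x₀).source ∩ (trivializationAt ℂ L x₀).baseSet

theorem isOpen_chartDomain (x₀ : X) : IsOpen (chartDomain n L x₀) :=
  (chartAt (Fin n → ℂ) x₀).open_source.inter (trivializationAt ℂ L x₀).open_baseSet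

theorem mem_chartDomain (x₀ : X) : x₀ ∈ chartDomain n L x₀ :=
  ⟨mem_chart_source _ x₀, FiberBundle.mem_baseSet_trivializationAt' x₀⟩

theorem isOpen_coordDomain (x₀ : X) : IsOpen (coordDomain L x₀ : Set (Fin n → ℂ)) :=
  (chartAt (Fin n → ℂ) x₀).isOpen_inter_preimage_symm (trivializationAt ℂ L x₀).open_baseSet

theorem chart_mem_coordDomain {x₀ x : X} (hx : x ∈ chartDomain n L x₀) :
    chartAt (Fin n → ℂ) x₀ x ∈ coordDomain L x₀ :=
  ⟨(chartAt (Fin n → ℂ) x₀).map_source hx.1, by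
    rw [Set.mem_preimage, chart_symm_chart hx.1]; exact hx.2⟩

theorem symm_mem_chartDomain {x₀ : X} {z : Fin n → ℂ} (hz : z ∈ coordDomain L x₀) :
    (chartAt (Fin n → ℂ) x₀).symm z ∈ chartDomain n L x₀ :=
  ⟨(chartAt (Fin n → ℂ) x₀).map_target hz.1, hz.2⟩

theorem chart_symm {x₀ : X} {z : Fin n → ℂ} (hz : z ∈ coordDomain L x₀) :
    chartAt (Fin n → ℂ) x₀ ((chartAt (Fin n → ℂ) x₀).symm z) = z :=
  (chartAt (Fin n → ℂ) x₀).right_inv hz.1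

theorem trivializationAt_frame {x₀ x : X} (hx : x ∈ (trivializationAt ℂ L x₀).baseSet) :
    (trivializationAt ℂ L x₀ ⟨x, frame L x₀ x⟩).2 = 1 := by
  rw [frame, Bundle.Trivialization.apply_mk_symm _ hx]

theorem frame_ne_zero {x₀ x : X} (hx : x ∈ (trivializationAt ℂ L x₀).baseSet) :
    frame L x₀ x ≠ 0 := by
  intro h
  have h1 := trivializationAt_frame hx
  have h2 := ((trivializationAt ℂ L x₀).linear ℂ hx).map_smul (0 : ℂ) (frame L x₀ x)
  rw [zero_smul, zero_smul] at h2
  rw [h] at h1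
  exact one_ne_zero (h1.symm.trans h2)

theorem HermMetric.normSq_frame_pos (h : HermMetric n L) {x₀ x : X}
    (hx : x ∈ (trivializationAt ℂ L x₀).baseSet) : 0 < h.normSq x (frame L x₀ x) :=
  h.normSq_pos x _ (frame_ne_zero hx)

/-- The transition function between the preferred frames. -/
def cocycle (L : X → Type*) [TopologicalSpace (Bundle.TotalSpace ℂ L)]
    [∀ x, AddCommGroup (L x)] [∀ x, Module ℂ (L x)] [∀ x, TopologicalSpace (L x)]
    [FiberBundle ℂ L] [VectorBundle ℂ ℂ L] (x₀ x₁ x : X) : ℂ :=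
  (trivializationAt ℂ L x₀ ⟨x, frame L x₁ x⟩).2

theorem frame_eq_cocycle_smul {x₀ : X} (x₁ : X) {x : X}
    (hx : x ∈ (trivializationAt ℂ L x₀).baseSet) :
    frame L x₁ x = cocycle L x₀ x₁ x • frame L x₀ x :=
  localCoord_smul_frame x₀ x hx _

theorem cocycle_ne_zero {x₀ x₁ x : X} (hx : x ∈ (trivializationAt ℂ L x₀).baseSet)
    (hx' : x ∈ (trivializationAt ℂ L x₁).baseSet) : cocycle L x₀ x₁ x ≠ 0 := by
  intro h
  have := frame_eq_cocycle_smul x₁ hx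
  rw [h, zero_smul] at this
  exact frame_ne_zero hx' this

theorem HermMetric.curvMatrix_eq (h : HermMetric n L) (x₀ : X) (z : Fin n → ℂ) :
    h.curvMatrix x₀ z = - hess (h.logWeight x₀) z := rfl

variable [IsManifold 𝓘(ℂ, Fin n → ℂ) ω X]

section

variable [ContMDiffVectorBundle ω ℂ L 𝓘(ℂ, Fin n → ℂ)]

theorem contDiffAt_cocycle {x₀ x₁ y x : X} (hy : x ∈ (chartAt (Fin n → ℂ) y).source)
    (hx : x ∈ (trivializationAt ℂ L x₀).baseSet)
    (hx' : x ∈ (trivializationAt ℂ L x₁).baseSet) :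
    ContDiffAt ℂ ω (fun z => cocycle L x₀ x₁ ((chartAt (Fin n → ℂ) y).symm z))
      (chartAt (Fin n → ℂ) y x) := by
  have h1 : ContMDiffAt 𝓘(ℂ, Fin n → ℂ) 𝓘(ℂ, Fin n → ℂ) ω (chartAt (Fin n → ℂ) y).symm
      (chartAt (Fin n → ℂ) y x) :=
    contMDiffOn_chart_symm.contMDiffAt ((chartAt (Fin n → ℂ) y).open_target.mem_nhds
      ((chartAt (Fin n → ℂ) y).map_source hy))
  have h2 : ContMDiffAt 𝓘(ℂ, Fin n → ℂ) 𝓘(ℂ, ℂ →L[ℂ] ℂ) ω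
      (fun b : X => ((trivializationAt ℂ L x₁).coordChangeL ℂ (trivializationAt ℂ L x₀) b :
        ℂ →L[ℂ] ℂ)) ((chartAt (Fin n → ℂ) y).symm (chartAt (Fin n → ℂ) y x)) := by
    rw [chart_symm_chart hy]
    exact contMDiffAt_coordChangeL hx' hx
  have h3 := ((h2.comp _ h1).contDiffAt).clm_apply (contDiffAt_const (c := (1 : ℂ)))
  refine h3.congr_of_eventuallyEq ?_
  filter_upwards [eventually_chart_symm hy
    (((trivializationAt ℂ L x₁).open_baseSet.inter
      (trivializationAt ℂ L x₀).open_baseSet).mem_nhds ⟨hx', hx⟩)] with z hz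
  simp only [Function.comp_apply, ContinuousLinearEquiv.coe_coe]
  rw [Bundle.Trivialization.coordChangeL_apply _ _ hz]
  rfl

end

/-- The real function underlying `HermMetric.logWeight`. -/
def HermMetric.realLogWeight (h : HermMetric n L) (x₀ : X) (z : Fin n → ℂ) : ℝ :=
  Real.log (h.normSq ((chartAt (Fin n → ℂ) x₀).symm z)
    (frame L x₀ ((chartAt (Fin n → ℂ) x₀).symm z)))

theorem HermMetric.contDiffOn_realLogWeight (h : HermMetric n L) (x₀ : X) :
    ContDiffOn ℝ ∞ (h.realLogWeight x₀) (coordDomain L x₀) := by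
  have h1 : ContMDiffOn 𝓘(ℝ, Fin n → ℂ) 𝓘(ℝ, Fin n → ℂ) ∞ (chartAt (Fin n → ℂ) x₀).symm
      (coordDomain L x₀) := contMDiffOn_chart_symm.mono Set.inter_subset_left
  have h2 := ((h.smooth x₀).comp h1 fun z hz => hz.2).contDiffOn
  exact h2.log fun z hz => (h.normSq_frame_pos hz.2).ne'

theorem HermMetric.contDiffAt_logWeight (h : HermMetric n L) {x₀ x : X}
    (hx : x ∈ chartDomain n L x₀) :
    ContDiffAt ℝ ∞ (h.logWeight x₀) (chartAt (Fin n → ℂ) x₀ x) :=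
  contDiffAt_ofReal ((h.contDiffOn_realLogWeight x₀).contDiffAt
    ((isOpen_coordDomain x₀).mem_nhds (chart_mem_coordDomain hx)))

variable [ContMDiffVectorBundle ω ℂ L 𝓘(ℂ, Fin n → ℂ)]

/-- The two weights differ by the change of variables and by `log |cocycle|²`. The latter is
pluriharmonic, so only the congruence by the Jacobian remains. -/
theorem HermMetric.curvMatrix_trans (h : HermMetric n L) {x₀ x₁ x : X}
    (hx : x ∈ chartDomain n L x₀) (hx' : x ∈ chartDomain n L x₁) :
    h.curvMatrix x₀ (chartAt (Fin n → ℂ) x₀ x) =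
      (jacobian (trans x₀ x₁) (chartAt (Fin n → ℂ) x₀ x)).transpose *
        h.curvMatrix x₁ (chartAt (Fin n → ℂ) x₁ x) *
        (jacobian (trans x₀ x₁) (chartAt (Fin n → ℂ) x₀ x)).map conj := by
  have hw1 : ContDiffAt ℝ ∞ (h.logWeight x₁) (trans x₀ x₁ (chartAt (Fin n → ℂ) x₀ x)) := by
    rw [trans_chart hx.1]
    exact h.contDiffAt_logWeight hx'
  have hT := contDiffAt_trans hx.1 hx'.1
  have h1 := hess_comp hT hw1
  rw [trans_chart hx.1] at h1
  have hc := contDiffAt_cocycle (x₀ := x₁) (x₁ := x₀) hx.1 hx'.2 hx.2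
  have hc0 : cocycle L x₁ x₀ ((chartAt (Fin n → ℂ) x₀).symm (chartAt (Fin n → ℂ) x₀ x)) ≠ 0 := by
    rw [chart_symm_chart hx.1]
    exact cocycle_ne_zero hx'.2 hx.2
  have h2 := hess_log_normSq hc hc0
  have h3 : h.logWeight x₀ =ᶠ[𝓝 (chartAt (Fin n → ℂ) x₀ x)] fun z =>
      h.logWeight x₁ (trans x₀ x₁ z) +
        (Real.log (‖cocycle L x₁ x₀ ((chartAt (Fin n → ℂ) x₀).symm z)‖ ^ 2) : ℂ) := by
    filter_upwards [eventually_symm_trans hx.1 hx'.1, eventually_chart_symm hx.1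
      (((isOpen_chartDomain x₀).inter (isOpen_chartDomain x₁)).mem_nhds ⟨hx, hx'⟩)] with z hz hz'
    rw [HermMetric.logWeight, HermMetric.logWeight, hz,
      frame_eq_cocycle_smul x₀ hz'.2.2, h.normSq_smul, ← Complex.ofReal_add, add_comm,
      ← Real.log_mul (pow_ne_zero 2 (norm_ne_zero_iff.2 (cocycle_ne_zero hz'.2.2 hz'.1.2)))
        (h.normSq_frame_pos hz'.2.2).ne']
  have hlog : ContDiffAt ℝ ∞ (fun z => (Real.log
      (‖cocycle L x₁ x₀ ((chartAt (Fin n → ℂ) x₀).symm z)‖ ^ 2) : ℂ))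
      (chartAt (Fin n → ℂ) x₀ x) :=
    contDiffAt_ofReal (((contDiffAt_real_of_complex hc).norm_sq ℝ).log
      (pow_ne_zero 2 (norm_ne_zero_iff.2 hc0)))
  rw [h.curvMatrix_eq, h.curvMatrix_eq, hess_congr h3, hess_add
    (u := fun z => h.logWeight x₁ (trans x₀ x₁ z)) (hw1.comp _
    (contDiffAt_real_of_complex hT)) hlog, h1, h2, add_zero, Matrix.mul_neg, Matrix.neg_mul]

end Bundle

end Manifold

/-! ### The measure `dμ_h` -/

section Gluing

open MeasureTheory

/-- The supremum of a compatible family of measures restricts to the members of the family. -/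
theorem iSup_measure_apply {X ι : Type*} [MeasurableSpace X] {μ : ι → Measure X} {U : ι → Set X}
    (hU : ∀ i, MeasurableSet (U i)) (h0 : ∀ i, μ i (U i)ᶜ = 0)
    (hov : ∀ i j B, MeasurableSet B → B ⊆ U i → B ⊆ U j → μ i B = μ j B) (i : ι) {B : Set X}
    (hB : MeasurableSet B) (hBi : B ⊆ U i) : (⨆ j, μ j) B = μ i B := by
  refine le_antisymm ?_ (le_iSup μ i B)
  -- The right side bounds every `μ j`: inside `U i` by compatibility on overlaps, outside because
  -- nothing exceeds `⊤`. On subsets of `U i` the second summand vanishes.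
  have hle : (⨆ j, μ j) ≤ μ i + (⊤ : Measure X).restrict (U i)ᶜ := by
    refine iSup_le fun j => Measure.le_iff.2 fun C hC => ?_
    rw [← measure_inter_add_sdiff C (hU i), Measure.add_apply]
    refine add_le_add ?_ ?_
    · have h1 : μ j (C ∩ U i) = μ j (C ∩ U i ∩ U j) := by
        refine le_antisymm ?_ (measure_mono Set.inter_subset_left)
        rw [← measure_inter_add_sdiff (C ∩ U i) (hU j)]
        have : μ j ((C ∩ U i) \ U j) = 0 := measure_mono_null (fun x hx => hx.2) (h0 j)
        rw [this, add_zero]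
      rw [h1, hov j i _ ((hC.inter (hU i)).inter (hU j)) Set.inter_subset_right
        (fun x hx => hx.1.2)]
      exact measure_mono fun x hx => hx.1.1
    · have h2 : (μ j).restrict (U i)ᶜ ≤ (⊤ : Measure X).restrict (U i)ᶜ :=
        Measure.restrict_mono_measure le_top _
      calc μ j (C \ U i) = (μ j).restrict (U i)ᶜ C := by
            rw [Measure.restrict_apply hC]; rfl
        _ ≤ _ := h2 C
  refine (hle B).trans ?_
  have : B ∩ (U i)ᶜ = ∅ := by
    ext x
    simpa using fun hx => hBi hx
  rw [Measure.add_apply, Measure.restrict_apply hB, this, measure_empty, add_zero]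

end Gluing

/-! ### The volume density in coordinates and integration over a coordinate neighbourhood. -/

section Density

open MeasureTheory Filter Topology

variable {n : ℕ} {X : Type*} [TopologicalSpace X] [ChartedSpace (Fin n → ℂ) X]
  {L : X → Type*} [TopologicalSpace (Bundle.TotalSpace ℂ L)]
  [∀ x, AddCommGroup (L x)] [∀ x, Module ℂ (L x)] [∀ x, TopologicalSpace (L x)]
  [FiberBundle ℂ L] [VectorBundle ℂ ℂ L]
  [IsManifold 𝓘(ℂ, Fin n → ℂ) ω X] [ContMDiffVectorBundle ω ℂ L 𝓘(ℂ, Fin n → ℂ)]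

/-- The density of `dμ_h` in the preferred coordinates around `x₀`. -/
def HermMetric.density (h : HermMetric n L) (x₀ : X) (z : Fin n → ℂ) : ℝ :=
  2 ^ n * (h.curvMatrix x₀ z).det.re

theorem HermMetric.contDiffAt_curvMatrix (h : HermMetric n L) {x₀ x : X}
    (hx : x ∈ chartDomain n L x₀) (j k : Fin n) :
    ContDiffAt ℝ ∞ (fun z => h.curvMatrix x₀ z j k) (chartAt (Fin n → ℂ) x₀ x) :=
  (contDiffAt_dz (contDiffAt_dzbar (h.contDiffAt_logWeight hx))).neg

theorem HermMetric.continuousOn_density (h : HermMetric n L) (x₀ : X) :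
    ContinuousOn (h.density x₀) (coordDomain L x₀) := by
  intro z hz
  refine ContinuousAt.continuousWithinAt ?_
  have h1 := contDiffAt_det fun j k => h.contDiffAt_curvMatrix (symm_mem_chartDomain hz) j k
  rw [chart_symm hz] at h1
  exact continuousAt_const.mul (Complex.continuous_re.continuousAt.comp h1.continuousAt)

-- `IsPositive` only looks at the preferred chart of each point; congruence by the invertible
-- Jacobian carries positivity to every chart containing the point.
open scoped ComplexOrder in
theorem HermMetric.IsPositive.posDef {h : HermMetric n L} (hp : h.IsPositive) {x₀ x : X}
    (hx : x ∈ chartDomain n L x₀) :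
    (h.curvMatrix x₀ (chartAt (Fin n → ℂ) x₀ x)).PosDef := by
  have h1 := h.curvMatrix_trans hx (mem_chartDomain x)
  have hJ := det_jacobian_trans_ne_zero hx.1 (mem_chart_source _ x)
  set J := jacobian (trans x₀ x) (chartAt (Fin n → ℂ) x₀ x)
  have h2 : J.transpose = (J.map conj).conjTranspose := by
    ext i j
    simp
  have hJ' : IsUnit (J.map conj) := by
    rw [Matrix.isUnit_iff_isUnit_det, isUnit_iff_ne_zero]
    have := (starRingEnd ℂ).map_det J
    change _ = (J.map conj).det at this
    rw [← this]
    simpa using hJ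
  rw [h1, h2]
  exact (hp x).conjTranspose_mul_mul_same (Matrix.mulVec_injective_of_isUnit hJ')

theorem HermMetric.IsPositive.det_pos {h : HermMetric n L} (hp : h.IsPositive) {x₀ x : X}
    (hx : x ∈ chartDomain n L x₀) :
    0 < (h.curvMatrix x₀ (chartAt (Fin n → ℂ) x₀ x)).det.re := by
  open scoped ComplexOrder in
  exact (Complex.pos_iff.1 (hp.posDef hx).det_pos).1

theorem HermMetric.IsPositive.density_pos {h : HermMetric n L} (hp : h.IsPositive) {x₀ : X}
    {z : Fin n → ℂ} (hz : z ∈ coordDomain L x₀) : 0 < h.density x₀ z := by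
  have := hp.det_pos (symm_mem_chartDomain hz)
  rw [chart_symm hz] at this
  unfold HermMetric.density
  positivity

theorem det_conj_mul {A J : Matrix (Fin n) (Fin n) ℂ} :
    (J.transpose * A * J.map conj).det.re = ‖J.det‖ ^ 2 * A.det.re := by
  have h1 : (J.map conj).det = conj J.det := ((starRingEnd ℂ).map_det J).symm
  rw [Matrix.det_mul, Matrix.det_mul, Matrix.det_transpose, h1,
    show J.det * A.det * conj J.det = (J.det * conj J.det) * A.det by ring, Complex.mul_conj',
    ← Complex.ofReal_pow, Complex.re_ofReal_mul]

theorem HermMetric.density_trans (h : HermMetric n L) {x₀ x₁ x : X}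
    (hx : x ∈ chartDomain n L x₀) (hx' : x ∈ chartDomain n L x₁) :
    h.density x₀ (chartAt (Fin n → ℂ) x₀ x) =
      ‖(jacobian (trans x₀ x₁) (chartAt (Fin n → ℂ) x₀ x)).det‖ ^ 2 *
        h.density x₁ (chartAt (Fin n → ℂ) x₁ x) := by
  rw [HermMetric.density, HermMetric.density, h.curvMatrix_trans hx hx', det_conj_mul]
  ring

variable [MeasurableSpace X] [BorelSpace X]

theorem aemeasurable_chart_symm (x₀ : X) : AEMeasurable (chartAt (Fin n → ℂ) x₀).symm
    ((volume : Measure (Fin n → ℂ)).restrict (coordDomain L x₀)) :=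
  ((chartAt (Fin n → ℂ) x₀).continuousOn_symm.mono Set.inter_subset_left).aemeasurable
    (isOpen_coordDomain x₀).measurableSet

theorem HermMetric.localMeasure_apply (h : HermMetric n L) (x₀ : X) {B : Set X}
    (hB : MeasurableSet B) : h.localMeasure x₀ B =
      ∫⁻ z in (chartAt (Fin n → ℂ) x₀).symm ⁻¹' B ∩ coordDomain L x₀,
        ENNReal.ofReal (h.density x₀ z) := by
  rw [HermMetric.localMeasure, Measure.map_apply_of_aemeasurable
    ((aemeasurable_chart_symm x₀).mono_ac (withDensity_absolutelyContinuous _ _)) hB,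
    withDensity_apply', Measure.restrict_restrict' (isOpen_coordDomain x₀).measurableSet]
  rfl

theorem preimage_symm_eq_image {x₀ : X} {B : Set X} (hB : B ⊆ chartDomain n L x₀) :
    (chartAt (Fin n → ℂ) x₀).symm ⁻¹' B ∩ coordDomain L x₀ = chartAt (Fin n → ℂ) x₀ '' B := by
  ext z
  constructor
  · rintro ⟨h1, h2⟩
    exact ⟨_, h1, chart_symm h2⟩
  · rintro ⟨x, hx, rfl⟩
    refine ⟨?_, chart_mem_coordDomain (hB hx)⟩
    rw [Set.mem_preimage, chart_symm_chart (hB hx).1]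
    exact hx

theorem measurableSet_preimage_symm (x₀ : X) {B : Set X} (hB : MeasurableSet B) :
    MeasurableSet ((chartAt (Fin n → ℂ) x₀).symm ⁻¹' B ∩ coordDomain L x₀) := by
  have hD := (isOpen_coordDomain (n := n) (L := L) x₀).measurableSet
  have hc : Measurable ((coordDomain L x₀ : Set (Fin n → ℂ)).domRestrict
      (chartAt (Fin n → ℂ) x₀).symm) :=
    (continuousOn_iff_continuous_domRestrict.1 ((chartAt (Fin n → ℂ) x₀).continuousOn_symm.mono
      Set.inter_subset_left)).measurable
  have := (MeasurableEmbedding.subtype_coe hD).measurableSet_image.2 (hc hB)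
  convert this using 1
  ext z
  constructor
  · rintro ⟨h1, h2⟩; exact ⟨⟨z, h2⟩, h1, rfl⟩
  · rintro ⟨⟨y, hy⟩, h1, rfl⟩; exact ⟨h1, hy⟩

/-- Change of variables under the transition map. Its real Jacobian is the squared modulus of its
complex one, the factor by which the densities differ. -/
theorem HermMetric.localMeasure_eq_of_subset (h : HermMetric n L) {x₀ x₁ : X} {B : Set X}
    (hB : MeasurableSet B) (h0 : B ⊆ chartDomain n L x₀) (h1 : B ⊆ chartDomain n L x₁) :
    h.localMeasure x₀ B = h.localMeasure x₁ B := by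
  have hm := measurableSet_preimage_symm (n := n) (L := L) x₀ hB
  rw [h.localMeasure_apply x₀ hB, h.localMeasure_apply x₁ hB, preimage_symm_eq_image h1]
  rw [preimage_symm_eq_image h0] at hm ⊢
  have himg : chartAt (Fin n → ℂ) x₁ '' B = trans x₀ x₁ '' (chartAt (Fin n → ℂ) x₀ '' B) := by
    rw [Set.image_image]
    exact Set.image_congr fun x hx => (trans_chart (h0 hx).1).symm
  have hd : ∀ z ∈ chartAt (Fin n → ℂ) x₀ '' B, HasFDerivWithinAt (trans x₀ x₁)
      ((fderiv ℂ (trans x₀ x₁) z).restrictScalars ℝ) (chartAt (Fin n → ℂ) x₀ '' B) z := by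
    rintro _ ⟨x, hx, rfl⟩
    exact (((contDiffAt_trans (h0 hx).1 (h1 hx).1).differentiableAt
      (by simp)).hasFDerivAt.restrictScalars ℝ).hasFDerivWithinAt
  have hinj : Set.InjOn (trans x₀ x₁) (chartAt (Fin n → ℂ) x₀ '' B) := by
    rintro _ ⟨x, hx, rfl⟩ _ ⟨y, hy, rfl⟩ hxy
    rw [trans_chart (h0 hx).1, trans_chart (h0 hy).1] at hxy
    rw [(chartAt (Fin n → ℂ) x₁).injOn (h1 hx).1 (h1 hy).1 hxy]
  rw [himg, lintegral_image_eq_lintegral_abs_det_fderiv_mul volume hm hd hinj]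
  refine setLIntegral_congr_fun hm ?_
  rintro _ ⟨x, hx, rfl⟩
  have hdet : ((fderiv ℂ (trans x₀ x₁) (chartAt (Fin n → ℂ) x₀ x)).restrictScalars ℝ).det =
      ‖(jacobian (trans x₀ x₁) (chartAt (Fin n → ℂ) x₀ x)).det‖ ^ 2 := by
    rw [jacobian_eq_toMatrix', LinearMap.det_toMatrix', ContinuousLinearMap.det]
    change (LinearMap.restrictScalars ℝ _).det = _
    rw [LinearMap.det_restrictScalars, Algebra.norm_complex_apply, Complex.normSq_eq_norm_sq]
  beta_reduce
  rw [hdet, abs_of_nonneg (by positivity), trans_chart (h0 hx).1, h.density_trans (h0 hx) (h1 hx), ENNReal.ofReal_mul (sq_nonneg _)]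

/-- The local measures live on their own domains and agree on overlaps, so their supremum glues
them. Every chart integral is reduced to Lebesgue measure through this identity. -/
theorem HermMetric.measure_restrict (h : HermMetric n L) (x₀ : X) :
    h.measure.restrict (chartDomain n L x₀) = h.localMeasure x₀ := by
  have h0 : ∀ x₀ : X, h.localMeasure x₀ (chartDomain n L x₀)ᶜ = 0 := fun x₀ => by
    rw [h.localMeasure_apply x₀ (isOpen_chartDomain x₀).measurableSet.compl]
    have : (chartAt (Fin n → ℂ) x₀).symm ⁻¹' (chartDomain n L x₀)ᶜ ∩ coordDomain L x₀ = ∅ := by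
      ext z
      simpa using fun h1 h2 => h1 (symm_mem_chartDomain h2)
    rw [this]
    simp
  ext B hB
  have hm := (isOpen_chartDomain (n := n) (L := L) x₀).measurableSet
  rw [Measure.restrict_apply hB]
  refine (iSup_measure_apply (U := chartDomain n L) (fun x => (isOpen_chartDomain x).measurableSet)
    h0 (fun i j B hB h1 h2 => h.localMeasure_eq_of_subset hB h1 h2) x₀ (hB.inter hm)
    Set.inter_subset_right).trans ?_
  refine le_antisymm (measure_mono Set.inter_subset_left) ?_
  rw [← measure_inter_add_sdiff B hm]
  have : h.localMeasure x₀ (B \ chartDomain n L x₀) = 0 :=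
    measure_mono_null (fun x hx => hx.2) (h0 x₀)
  rw [this, add_zero]

/-- The density is continuous, hence integrable over a closed coordinate ball. On compact `X` this
makes continuous functions integrable. -/
instance HermMetric.isLocallyFiniteMeasure (h : HermMetric n L) :
    IsLocallyFiniteMeasure h.measure := by
  refine ⟨fun x => ?_⟩
  obtain ⟨r, hr, hball⟩ := Metric.nhds_basis_closedBall.mem_iff.1
    ((isOpen_coordDomain (L := L) x).mem_nhds (chart_mem_coordDomain (mem_chartDomain (n := n) x)))
  have hU := (isOpen_chartDomain (n := n) (L := L) x)
  set s := chartDomain n L x ∩ ((chartAt (Fin n → ℂ) x).source ∩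
    chartAt (Fin n → ℂ) x ⁻¹' Metric.ball (chartAt (Fin n → ℂ) x x) r) with hs
  have hso : IsOpen s := hU.inter
    ((chartAt (Fin n → ℂ) x).isOpen_inter_preimage Metric.isOpen_ball)
  refine ⟨s, hso.mem_nhds ⟨mem_chartDomain x, mem_chart_source _ x, ?_⟩, ?_⟩
  · exact Metric.mem_ball_self hr
  · have h1 : h.measure s = h.localMeasure x s := by
      rw [← h.measure_restrict x, Measure.restrict_apply hso.measurableSet,
        Set.inter_eq_left.2 Set.inter_subset_left]
    rw [h1, h.localMeasure_apply x hso.measurableSet]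
    have hint : IntegrableOn (h.density x) (Metric.closedBall (chartAt (Fin n → ℂ) x x) r) :=
      ((h.continuousOn_density x).mono hball).integrableOn_compact (isCompact_closedBall _ _)
    refine lt_of_le_of_lt (lintegral_mono_set ?_) hint.lintegral_lt_top
    rintro z ⟨hz1, hz2⟩
    have := hz1.2.2
    rw [Set.mem_preimage, chart_symm hz2] at this
    exact Metric.ball_subset_closedBall this

theorem HermMetric.setIntegral_measure {h : HermMetric n L} (hp : h.IsPositive) (x₀ : X)
    {f : X → ℝ} (hf : Continuous f) :
    ∫ x in chartDomain n L x₀, f x ∂h.measure =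
      ∫ z in coordDomain L x₀, f ((chartAt (Fin n → ℂ) x₀).symm z) * h.density x₀ z := by
  have hD := (isOpen_coordDomain (n := n) (L := L) x₀).measurableSet
  rw [h.measure_restrict, HermMetric.localMeasure, integral_map
    ((aemeasurable_chart_symm x₀).mono_ac (withDensity_absolutelyContinuous _ _))
    hf.aestronglyMeasurable]
  change ∫ z, f ((chartAt (Fin n → ℂ) x₀).symm z) ∂((volume.restrict
    (coordDomain L x₀)).withDensity fun z => ENNReal.ofReal (h.density x₀ z)) = _
  rw [integral_withDensity_eq_integral_toReal_smul₀
    (((h.continuousOn_density x₀).aemeasurable hD).ennreal_ofReal)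
    (Eventually.of_forall fun _ => ENNReal.ofReal_lt_top)]
  refine setIntegral_congr_fun hD fun z hz => ?_
  -- Positivity is what removes the truncation of the density by `ENNReal.ofReal`.
  rw [ENNReal.toReal_ofReal (hp.density_pos hz).le, smul_eq_mul, mul_comm]

theorem HermMetric.integral_measure_of_support {h : HermMetric n L} (hp : h.IsPositive) (x₀ : X)
    {f : X → ℝ} (hf : Continuous f) (hs : ∀ x ∉ chartDomain n L x₀, f x = 0) :
    ∫ x, f x ∂h.measure =
      ∫ z in coordDomain L x₀, f ((chartAt (Fin n → ℂ) x₀).symm z) * h.density x₀ z := by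
  rw [← h.setIntegral_measure hp x₀ hf, setIntegral_eq_integral_of_forall_compl_eq_zero hs]

end Density

/-! ### Partitions of unity subordinate to coordinate neighbourhoods. -/

section Partition

open Topology

variable {n : ℕ} {X : Type*} [TopologicalSpace X] [ChartedSpace (Fin n → ℂ) X]
  {L : X → Type*} [TopologicalSpace (Bundle.TotalSpace ℂ L)]
  [∀ x, AddCommGroup (L x)] [∀ x, Module ℂ (L x)] [∀ x, TopologicalSpace (L x)]
  [FiberBundle ℂ L] [VectorBundle ℂ ℂ L]
  [IsManifold 𝓘(ℂ, Fin n → ℂ) ω X] [ContMDiffVectorBundle ω ℂ L 𝓘(ℂ, Fin n → ℂ)]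

variable (n L) in
/-- A finite smooth partition of unity subordinate to the coordinate neighbourhoods. -/
theorem exists_partition [CompactSpace X] [T2Space X] :
    ∃ (t : Finset X) (χ : t → X → ℝ),
      (∀ i, ContMDiff 𝓘(ℝ, Fin n → ℂ) 𝓘(ℝ, ℝ) ∞ (χ i)) ∧
      (∀ i, tsupport (χ i) ⊆ chartDomain n L i) ∧ ∀ x, ∑ i, χ i x = 1 := by
  obtain ⟨t, ht⟩ := isCompact_univ.elim_finite_subcover (fun x : X => chartDomain n L x)
    (fun x => isOpen_chartDomain x) fun x _ => Set.mem_iUnion.2 ⟨x, mem_chartDomain x⟩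
  obtain ⟨χ, hχ⟩ := SmoothPartitionOfUnity.exists_isSubordinate 𝓘(ℝ, Fin n → ℂ)
    (isClosed_univ (X := X)) (fun i : t => chartDomain n L (i : X))
    (fun i => isOpen_chartDomain _) fun x hx => by
      obtain ⟨i, hi, hxi⟩ := Set.mem_iUnion₂.1 (ht hx)
      exact Set.mem_iUnion.2 ⟨⟨i, hi⟩, hxi⟩
  refine ⟨t, fun i => χ i, fun i => (χ i).contMDiff, hχ, fun x => ?_⟩
  rw [← χ.sum_eq_one (Set.mem_univ x), finsum_eq_sum_of_fintype]

end Partition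

/-! ### Smooth families of functions -/

section Slices

open Filter Topology

variable {V : Type*} [NormedAddCommGroup V] [NormedSpace ℝ V] {Φ : ℝ × V → ℂ} {t : ℝ} {z : V}

theorem wirt_slice {a b : V} {c : ℂ} (h : DifferentiableAt ℝ Φ (t, z)) :
    wirt a b c (fun w => Φ (t, w)) z = wirt (0, a) (0, b) c Φ (t, z) := by
  have h1 : HasFDerivAt (fun w : V => (t, w)) (ContinuousLinearMap.inr ℝ ℝ V) z :=
    hasFDerivAt_prodMk_right t z
  have h2 := (h.hasFDerivAt.comp z h1).fderiv
  simp only [wirt, show (fun w => Φ (t, w)) = Φ ∘ fun w => (t, w) from rfl, h2]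
  simp

theorem hasDerivAt_slice (h : DifferentiableAt ℝ Φ (t, z)) :
    HasDerivAt (fun r => Φ (r, z)) (wirt (1, 0) (1, 0) 1 Φ (t, z)) t := by
  have h1 : HasDerivAt (fun r : ℝ => (r, z)) ((1 : ℝ), (0 : V)) t :=
    (hasDerivAt_id t).prodMk (hasDerivAt_const t z)
  rw [wirt_self]
  exact h.hasFDerivAt.comp_hasDerivAt t h1

variable {n : ℕ} {Φ Ψ : ℝ × (Fin n → ℂ) → ℂ} {Ω : Set (Fin n → ℂ)} {z : Fin n → ℂ}

/-- The complex Hessian in the space variables of a function of time and space. -/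
def sliceHess (Φ : ℝ × (Fin n → ℂ) → ℂ) (j k : Fin n) : ℝ × (Fin n → ℂ) → ℂ :=
  wirt (0, Pi.single j 1) (0, Pi.single j Complex.I) (-Complex.I)
    (wirt (0, Pi.single k 1) (0, Pi.single k Complex.I) Complex.I Φ)

theorem hess_slice (hΩ : IsOpen Ω) (hΦ : ∀ t, ∀ z ∈ Ω, ContDiffAt ℝ ∞ Φ (t, z)) (hz : z ∈ Ω)
    (t : ℝ) (j k : Fin n) : hess (fun w => Φ (t, w)) z j k = sliceHess Φ j k (t, z) := by
  have h1 : dzbar k (fun w => Φ (t, w)) =ᶠ[𝓝 z] fun w =>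
      wirt (0, Pi.single k 1) (0, Pi.single k Complex.I) Complex.I Φ (t, w) := by
    filter_upwards [hΩ.mem_nhds hz] with w hw
    rw [dzbar_eq_wirt, wirt_slice (hΦ t w hw).diff]
  rw [hess_apply, dz_eq_wirt, wirt_congr h1, wirt_slice (hΦ t z hz).wirt.diff]
  rfl

theorem contDiffAt_sliceHess {p : ℝ × (Fin n → ℂ)} (h : ContDiffAt ℝ ∞ Φ p) (j k : Fin n) :
    ContDiffAt ℝ ∞ (sliceHess Φ j k) p := h.wirt.wirt

/-- On `ℝ × ℂⁿ` the time derivative and the space derivatives are all operators `wirt`, so two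
applications of `wirt_comm` move `∂_t` past the Hessian. -/
theorem hasDerivAt_hess_slice (hΩ : IsOpen Ω) (hΦ : ∀ t, ∀ z ∈ Ω, ContDiffAt ℝ ∞ Φ (t, z))
    (hΨ : ∀ t, ∀ z ∈ Ω, HasDerivAt (fun r => Φ (r, z)) (Ψ (t, z)) t) (hz : z ∈ Ω)
    (t : ℝ) (j k : Fin n) :
    HasDerivAt (fun r => hess (fun w => Φ (r, w)) z j k) (hess (fun w => Ψ (t, w)) z j k) t := by
  have hmem : ∀ t : ℝ, ∀ᶠ p in 𝓝 (t, z), p.2 ∈ Ω := fun t =>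
    (continuous_snd.tendsto (t, z)).eventually_mem (hΩ.mem_nhds hz)
  have hΨ' : ∀ t, Ψ =ᶠ[𝓝 (t, z)] wirt (1, 0) (1, 0) 1 Φ := fun t => by
    filter_upwards [hmem t] with p hp
    exact (hΨ p.1 p.2 hp).unique (hasDerivAt_slice (hΦ p.1 p.2 hp).diff)
  have hΨs : ∀ t, ∀ z ∈ Ω, ContDiffAt ℝ ∞ Ψ (t, z) := fun t z hz => by
    refine ((hΦ t z hz).wirt (a := (1, 0)) (b := (1, 0)) (c := 1)).congr_of_eventuallyEq ?_
    filter_upwards [(continuous_snd.tendsto (t, z)).eventually_mem (hΩ.mem_nhds hz)] with p hp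
    exact (hΨ p.1 p.2 hp).unique (hasDerivAt_slice (hΦ p.1 p.2 hp).diff)
  simp only [hess_slice hΩ hΦ hz, hess_slice hΩ hΨs hz]
  have h1 := hasDerivAt_slice (contDiffAt_sliceHess (hΦ t z hz) j k).diff
  convert h1 using 1
  have h2 : ∀ {a b : ℝ × (Fin n → ℂ)} {c : ℂ}, wirt a b c Ψ =ᶠ[𝓝 (t, z)]
      wirt (1, 0) (1, 0) 1 (wirt a b c Φ) := fun {a b c} => by
    refine (wirt_eventuallyEq (hΨ' t)).trans ?_
    filter_upwards [hmem t] with p hp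
    exact wirt_comm (hΦ p.1 p.2 hp)
  rw [sliceHess, wirt_congr h2, wirt_comm (hΦ t z hz).wirt]
  rfl

end Slices

/-! ### Coordinate-independent ratios of determinants and traces. -/

section Invariants

variable {n : ℕ}

/-- The density of the volume form of `N` relative to that of `A`. -/
def maRatio (A N : Matrix (Fin n) (Fin n) ℂ) : ℝ := N.det.re / A.det.re

/-- The derivative of the relative density of `N` in the direction `C`. -/
def trRatio (A N C : Matrix (Fin n) (Fin n) ℂ) : ℝ := (N.adjugate * C).trace.re / A.det.re

variable {A N C J : Matrix (Fin n) (Fin n) ℂ}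

/-- Numerator and denominator both acquire the factor `|det J|²`, so the ratio is a well-defined
function on the manifold. -/
theorem maRatio_conj_mul (hJ : J.det ≠ 0) :
    maRatio (J.transpose * A * J.map conj) (J.transpose * N * J.map conj) = maRatio A N := by
  rw [maRatio, det_conj_mul, det_conj_mul,
    mul_div_mul_left _ _ (pow_ne_zero 2 (norm_ne_zero_iff.2 hJ)), maRatio]

/-- The adjugate reverses products, so each outer factor meets its own adjugate, once directly and
once after cycling the trace. The two determinants give `|det J|²`, as in the denominator. -/
theorem trRatio_conj_mul (hJ : J.det ≠ 0) :
    trRatio (J.transpose * A * J.map conj) (J.transpose * N * J.map conj)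
      (J.transpose * C * J.map conj) = trRatio A N C := by
  have h1 : (J.map conj).det = conj J.det := ((starRingEnd ℂ).map_det J).symm
  have h2 : ((J.transpose * N * J.map conj).adjugate * (J.transpose * C * J.map conj)).trace =
      ((‖J.det‖ ^ 2 : ℝ) : ℂ) * (N.adjugate * C).trace := by
    rw [Matrix.adjugate_mul_distrib, Matrix.adjugate_mul_distrib]
    have h3 : (J.map conj).adjugate * (N.adjugate * J.transpose.adjugate) *
        (J.transpose * C * J.map conj) = (J.map conj).adjugate * (N.adjugate *
          (J.transpose.adjugate * J.transpose) * C) * J.map conj := by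
      simp only [Matrix.mul_assoc]
    rw [h3, Matrix.adjugate_mul, Matrix.trace_mul_comm, ← Matrix.mul_assoc,
      Matrix.mul_adjugate, Matrix.det_transpose, h1]
    simp only [Matrix.smul_mul, Matrix.mul_smul, Matrix.one_mul, Matrix.mul_one,
      Matrix.trace_smul, smul_eq_mul]
    rw [← mul_assoc, Complex.mul_conj']
    push_cast
    ring
  rw [trRatio, det_conj_mul, h2, Complex.re_ofReal_mul,
    mul_div_mul_left _ _ (pow_ne_zero 2 (norm_ne_zero_iff.2 hJ)), trRatio]

theorem trRatio_zero : trRatio A N 0 = 0 := by simp [trRatio]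

theorem trRatio_sum {ι : Type*} (s : Finset ι) (C : ι → Matrix (Fin n) (Fin n) ℂ) :
    trRatio A N (∑ i ∈ s, C i) = ∑ i ∈ s, trRatio A N (C i) := by
  simp only [trRatio, Matrix.mul_sum, Matrix.trace_sum, Complex.re_sum, Finset.sum_div]

theorem trRatio_smul (r : ℝ) : trRatio A N ((r : ℂ) • C) = r * trRatio A N C := by
  simp only [trRatio, Matrix.mul_smul, Matrix.trace_smul, smul_eq_mul, Complex.re_ofReal_mul]
  ring

theorem hasDerivAt_maRatio {N : ℝ → Matrix (Fin n) (Fin n) ℂ} {t : ℝ}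
    (h : ∀ i j, HasDerivAt (fun r => N r i j) (C i j) t) :
    HasDerivAt (fun r => maRatio A (N r)) (trRatio A (N t) C) t := by
  have h1 := hasDerivAt_det h
  have h2 : HasDerivAt (fun r => (N r).det.re) ((N t).adjugate * C).trace.re t :=
    (Complex.reCLM.hasFDerivAt.comp_hasDerivAt t h1)
  exact h2.div_const _

theorem continuousAt_maRatio {Y : Type*} [TopologicalSpace Y] {y : Y}
    {A N : Y → Matrix (Fin n) (Fin n) ℂ} (hA : ContinuousAt A y) (hN : ContinuousAt N y)
    (h0 : (A y).det.re ≠ 0) : ContinuousAt (fun y => maRatio (A y) (N y)) y := by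
  have hdet : Continuous fun M : Matrix (Fin n) (Fin n) ℂ => M.det.re :=
    Complex.continuous_re.comp continuous_id.matrix_det
  exact (hdet.continuousAt.comp hN).div (hdet.continuousAt.comp hA) h0

theorem continuousAt_trRatio {Y : Type*} [TopologicalSpace Y] {y : Y}
    {A N C : Y → Matrix (Fin n) (Fin n) ℂ} (hA : ContinuousAt A y) (hN : ContinuousAt N y)
    (hC : ContinuousAt C y) (h0 : (A y).det.re ≠ 0) :
    ContinuousAt (fun y => trRatio (A y) (N y) (C y)) y := by
  have hdet : Continuous fun M : Matrix (Fin n) (Fin n) ℂ => M.det.re :=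
    Complex.continuous_re.comp continuous_id.matrix_det
  have htr : Continuous fun M : Matrix (Fin n) (Fin n) ℂ × Matrix (Fin n) (Fin n) ℂ =>
      (M.1.adjugate * M.2).trace.re :=
    Complex.continuous_re.comp (continuous_fst.matrix_adjugate.matrix_mul
      continuous_snd).matrix_trace
  exact (htr.continuousAt.comp (hN.prodMk hC)).div (hdet.continuousAt.comp hA) h0

end Invariants

/-! ### Smooth families of functions and continuity of the ratios along them. -/

section Families

open Filter Topology

variable {n : ℕ} {X : Type*} [TopologicalSpace X] [ChartedSpace (Fin n → ℂ) X]
  {L : X → Type*} [TopologicalSpace (Bundle.TotalSpace ℂ L)]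
  [∀ x, AddCommGroup (L x)] [∀ x, Module ℂ (L x)] [∀ x, TopologicalSpace (L x)]
  [FiberBundle ℂ L] [VectorBundle ℂ ℂ L]
  [IsManifold 𝓘(ℂ, Fin n → ℂ) ω X] [ContMDiffVectorBundle ω ℂ L 𝓘(ℂ, Fin n → ℂ)]

/-- A smooth family of functions on `X`, parametrized by time. -/
def SmoothFamily (φ : ℝ → X → ℝ) : Prop :=
  ContMDiff (𝓘(ℝ, ℝ).prod 𝓘(ℝ, Fin n → ℂ)) 𝓘(ℝ, ℝ) ∞ fun p : ℝ × X => φ p.1 p.2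

/-- The time derivative of a family of functions. -/
def timeDeriv (φ : ℝ → X → ℝ) (t : ℝ) (x : X) : ℝ := deriv (fun r => φ r x) t

variable {φ ψ : ℝ → X → ℝ}

theorem SmoothFamily.contMDiff (hφ : SmoothFamily (n := n) φ) (t : ℝ) :
    ContMDiff 𝓘(ℝ, Fin n → ℂ) 𝓘(ℝ, ℝ) ∞ (φ t) :=
  hφ.comp (contMDiff_const.prodMk contMDiff_id)

theorem smoothFamily_const {f : X → ℝ} (hf : ContMDiff 𝓘(ℝ, Fin n → ℂ) 𝓘(ℝ, ℝ) ∞ f) :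
    SmoothFamily (n := n) fun _ => f :=
  hf.comp contMDiff_snd

theorem SmoothFamily.continuous (hφ : SmoothFamily (n := n) φ) :
    Continuous fun p : ℝ × X => φ p.1 p.2 := ContMDiff.continuous hφ

theorem SmoothFamily.contDiffAt (hφ : SmoothFamily (n := n) φ) {x₀ : X} (t : ℝ) {z : Fin n → ℂ}
    (hz : z ∈ (chartAt (Fin n → ℂ) x₀).target) :
    ContDiffAt ℝ ∞ (fun p : ℝ × (Fin n → ℂ) => loc (φ p.1) x₀ p.2) (t, z) := by
  have h1 : ContMDiffAt 𝓘(ℝ, Fin n → ℂ) 𝓘(ℝ, Fin n → ℂ) ∞ (chartAt (Fin n → ℂ) x₀).symm z :=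
    contMDiffOn_chart_symm.contMDiffAt ((chartAt (Fin n → ℂ) x₀).open_target.mem_nhds hz)
  have h2 : ContMDiffAt 𝓘(ℝ, ℝ × (Fin n → ℂ)) (𝓘(ℝ, ℝ).prod 𝓘(ℝ, Fin n → ℂ)) ∞
      (fun p : ℝ × (Fin n → ℂ) => (p.1, (chartAt (Fin n → ℂ) x₀).symm p.2)) (t, z) :=
    (contDiff_fst.contMDiff.contMDiffAt).prodMk
      (h1.comp (t, z) (contDiff_snd.contMDiff.contMDiffAt))
  exact ((ContMDiff.contMDiffAt hφ).comp (t, z) h2).contDiffAt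

theorem SmoothFamily.hasDerivAt (hφ : SmoothFamily (n := n) φ) (t : ℝ) (x : X) :
    HasDerivAt (fun r => φ r x) (timeDeriv φ t x) t := by
  have h1 : ContMDiff 𝓘(ℝ, ℝ) 𝓘(ℝ, ℝ) ∞ fun r => φ r x :=
    ContMDiff.comp hφ (contMDiff_id.prodMk contMDiff_const)
  exact (h1.contDiff.contDiffAt.differentiableAt (by simp)).hasDerivAt

/-- In a fixed chart the time derivative is the derivative of a smooth function on `ℝ × ℂⁿ` in the
direction `(1, 0)`. -/
theorem SmoothFamily.timeDeriv (hφ : SmoothFamily (n := n) φ) :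
    SmoothFamily (n := n) (timeDeriv φ) := by
  rintro ⟨t, x⟩
  have hx := mem_chart_source (Fin n → ℂ) x
  have h1 := hφ.contDiffAt t ((chartAt (Fin n → ℂ) x).map_source hx)
  have h2 : ContDiffAt ℝ ∞ (fun p => fderiv ℝ (fun p : ℝ × (Fin n → ℂ) => loc (φ p.1) x p.2) p
      (1, 0)) (t, chartAt (Fin n → ℂ) x x) :=
    (h1.fderiv_right (m := ∞) (by simp)).clm_apply contDiffAt_const
  have h3 : ContMDiffAt (𝓘(ℝ, ℝ).prod 𝓘(ℝ, Fin n → ℂ)) 𝓘(ℝ, ℝ × (Fin n → ℂ)) ∞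
      (fun p : ℝ × X => (p.1, chartAt (Fin n → ℂ) x p.2)) (t, x) := by
    have hc : ContMDiffAt 𝓘(ℝ, Fin n → ℂ) 𝓘(ℝ, Fin n → ℂ) ∞ (chartAt (Fin n → ℂ) x) x :=
      contMDiffOn_chart.contMDiffAt ((chartAt (Fin n → ℂ) x).open_source.mem_nhds hx)
    exact contMDiffAt_fst.prodMk_space (hc.comp (t, x) contMDiffAt_snd)
  refine (h2.contMDiffAt.comp (t, x) h3).congr_of_eventuallyEq ?_
  filter_upwards [continuousAt_snd.eventually ((chartAt (Fin n → ℂ) x).open_source.mem_nhds hx)]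
    with p hp
  have h4 := (hφ.contDiffAt p.1 ((chartAt (Fin n → ℂ) x).map_source hp)).differentiableAt
    (by simp)
  have h5 : HasDerivAt (fun r : ℝ => (r, chartAt (Fin n → ℂ) x p.2)) ((1 : ℝ), 0) p.1 :=
    (hasDerivAt_id p.1).prodMk (hasDerivAt_const p.1 _)
  have h6 := h4.hasFDerivAt.comp_hasDerivAt p.1 h5
  have h7 : (fun r => φ r p.2) = (fun p : ℝ × (Fin n → ℂ) => loc (φ p.1) x p.2) ∘
      fun r => (r, chartAt (Fin n → ℂ) x p.2) := by
    ext r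
    simp only [Function.comp_apply, loc, chart_symm_chart hp]
  rw [KahlerQuantization.timeDeriv, h7, h6.deriv]
  rfl

theorem SmoothFamily.add (hφ : SmoothFamily (n := n) φ) (hψ : SmoothFamily (n := n) ψ) :
    SmoothFamily (n := n) fun t x => φ t x + ψ t x :=
  ContMDiff.add hφ hψ

/-- The complex Hessian of a function at `x`, in the preferred coordinates around `x`. -/
def hessAt (n : ℕ) {X : Type*} [TopologicalSpace X] [ChartedSpace (Fin n → ℂ) X] (φ : X → ℝ)
    (x : X) : Matrix (Fin n) (Fin n) ℂ :=
  hess (fun z => (loc φ x z : ℂ)) (chartAt (Fin n → ℂ) x x)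

/-- The curvature of `h` at `x`, in the preferred coordinates around `x`. -/
def HermMetric.curvAt (h : HermMetric n L) (x : X) : Matrix (Fin n) (Fin n) ℂ :=
  h.curvMatrix x (chartAt (Fin n → ℂ) x x)

/-- `curvAt` and `hessAt` use a chart that changes with the point, so their entries need not be
continuous in `x`. Invariance allows the ratio to be computed in one fixed chart near a given point.
-/
theorem HermMetric.maRatio_chart (h : HermMetric n L) {f : X → ℝ}
    (hf : ContMDiff 𝓘(ℝ, Fin n → ℂ) 𝓘(ℝ, ℝ) ∞ f) (s : ℝ) {x₀ x : X}
    (hx : x ∈ chartDomain n L x₀) :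
    maRatio (h.curvAt x) (h.curvAt x - (s : ℂ) • hessAt n f x) =
      maRatio (h.curvMatrix x₀ (chartAt (Fin n → ℂ) x₀ x))
        (h.curvMatrix x₀ (chartAt (Fin n → ℂ) x₀ x) -
          (s : ℂ) • hess (fun z => (loc f x₀ z : ℂ)) (chartAt (Fin n → ℂ) x₀ x)) := by
  rw [h.curvMatrix_trans hx (mem_chartDomain x), hess_loc_trans hf hx.1 (mem_chart_source _ x),
    ← maRatio_conj_mul (det_jacobian_trans_ne_zero hx.1 (mem_chart_source _ x))]
  simp only [Matrix.mul_sub, Matrix.sub_mul, Matrix.mul_smul, Matrix.smul_mul]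
  rfl

theorem HermMetric.trRatio_chart (h : HermMetric n L) {f g : X → ℝ}
    (hf : ContMDiff 𝓘(ℝ, Fin n → ℂ) 𝓘(ℝ, ℝ) ∞ f) (hg : ContMDiff 𝓘(ℝ, Fin n → ℂ) 𝓘(ℝ, ℝ) ∞ g)
    (s : ℝ) {x₀ x : X} (hx : x ∈ chartDomain n L x₀) :
    trRatio (h.curvAt x) (h.curvAt x - (s : ℂ) • hessAt n f x) (hessAt n g x) =
      trRatio (h.curvMatrix x₀ (chartAt (Fin n → ℂ) x₀ x))
        (h.curvMatrix x₀ (chartAt (Fin n → ℂ) x₀ x) -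
          (s : ℂ) • hess (fun z => (loc f x₀ z : ℂ)) (chartAt (Fin n → ℂ) x₀ x))
        (hess (fun z => (loc g x₀ z : ℂ)) (chartAt (Fin n → ℂ) x₀ x)) := by
  rw [h.curvMatrix_trans hx (mem_chartDomain x), hess_loc_trans hf hx.1 (mem_chart_source _ x),
    hess_loc_trans hg hx.1 (mem_chart_source _ x),
    ← trRatio_conj_mul (det_jacobian_trans_ne_zero hx.1 (mem_chart_source _ x))]
  simp only [Matrix.mul_sub, Matrix.sub_mul, Matrix.mul_smul, Matrix.smul_mul]
  rfl

theorem HermMetric.continuousAt_curvMatrix_chart (h : HermMetric n L) (x₀ : X) :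
    ContinuousAt (fun x => h.curvMatrix x₀ (chartAt (Fin n → ℂ) x₀ x)) x₀ := by
  refine continuousAt_pi.2 fun j => continuousAt_pi.2 fun k => ?_
  exact ContinuousAt.comp (f := chartAt (Fin n → ℂ) x₀)
    (h.contDiffAt_curvMatrix (mem_chartDomain x₀) j k).continuousAt
    ((chartAt (Fin n → ℂ) x₀).continuousAt (mem_chart_source _ x₀))

theorem SmoothFamily.hess_loc (hφ : SmoothFamily (n := n) φ) (x₀ : X) {z : Fin n → ℂ}
    (hz : z ∈ (chartAt (Fin n → ℂ) x₀).target) (t : ℝ) (j k : Fin n) :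
    hess (fun w => (loc (φ t) x₀ w : ℂ)) z j k =
      sliceHess (fun p : ℝ × (Fin n → ℂ) => (loc (φ p.1) x₀ p.2 : ℂ)) j k (t, z) :=
  hess_slice (Φ := fun p : ℝ × (Fin n → ℂ) => (loc (φ p.1) x₀ p.2 : ℂ))
    (chartAt (Fin n → ℂ) x₀).open_target
    (fun t _ hz => contDiffAt_ofReal (hφ.contDiffAt t hz)) hz t j k

theorem SmoothFamily.continuousAt_hess_chart (hφ : SmoothFamily (n := n) φ) (t : ℝ) (x₀ : X) :
    ContinuousAt (fun p : ℝ × X =>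
      hess (fun z => (loc (φ p.1) x₀ z : ℂ)) (chartAt (Fin n → ℂ) x₀ p.2)) (t, x₀) := by
  refine continuousAt_pi.2 fun j => continuousAt_pi.2 fun k => ?_
  have hx := mem_chart_source (Fin n → ℂ) x₀
  have h1 : (fun p : ℝ × X =>
      hess (fun z => (loc (φ p.1) x₀ z : ℂ)) (chartAt (Fin n → ℂ) x₀ p.2) j k) =ᶠ[𝓝 (t, x₀)]
      fun p => sliceHess (fun p : ℝ × (Fin n → ℂ) => (loc (φ p.1) x₀ p.2 : ℂ)) j k
        (p.1, chartAt (Fin n → ℂ) x₀ p.2) := by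
    filter_upwards [continuousAt_snd.eventually
      ((chartAt (Fin n → ℂ) x₀).open_source.mem_nhds hx)] with p hp
    exact hφ.hess_loc x₀ ((chartAt (Fin n → ℂ) x₀).map_source hp) _ _ _
  refine ContinuousAt.congr ?_ h1.symm
  have h2 := (contDiffAt_sliceHess (contDiffAt_ofReal
    (hφ.contDiffAt t ((chartAt (Fin n → ℂ) x₀).map_source hx))) j k).continuousAt
  exact ContinuousAt.comp (f := fun p : ℝ × X => (p.1, chartAt (Fin n → ℂ) x₀ p.2)) h2
    (continuousAt_fst.prodMk (((chartAt (Fin n → ℂ) x₀).continuousAt hx).comp continuousAt_snd))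

theorem HermMetric.continuousAt_path (h : HermMetric n L) (hφ : SmoothFamily (n := n) φ)
    (s t : ℝ) (x₀ : X) :
    ContinuousAt (fun q : ℝ × ℝ × X => h.curvMatrix x₀ (chartAt (Fin n → ℂ) x₀ q.2.2) -
      (q.1 : ℂ) • hess (fun z => (loc (φ q.2.1) x₀ z : ℂ)) (chartAt (Fin n → ℂ) x₀ q.2.2))
      (s, t, x₀) := by
  have h1 : ContinuousAt (fun q : ℝ × ℝ × X =>
      h.curvMatrix x₀ (chartAt (Fin n → ℂ) x₀ q.2.2)) (s, t, x₀) := by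
    have h0 : ContinuousAt (fun q : ℝ × ℝ × X => q.2.2) (s, t, x₀) := by fun_prop
    exact ContinuousAt.comp (x := (s, t, x₀))
      (g := fun x => h.curvMatrix x₀ (chartAt (Fin n → ℂ) x₀ x))
      (h.continuousAt_curvMatrix_chart x₀) h0
  have h2 : ContinuousAt (fun q : ℝ × ℝ × X =>
      hess (fun z => (loc (φ q.2.1) x₀ z : ℂ)) (chartAt (Fin n → ℂ) x₀ q.2.2)) (s, t, x₀) :=
    ContinuousAt.comp (x := (s, t, x₀)) (f := fun q : ℝ × ℝ × X => q.2)
      (g := fun p : ℝ × X =>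
        hess (fun z => (loc (φ p.1) x₀ z : ℂ)) (chartAt (Fin n → ℂ) x₀ p.2))
      (hφ.continuousAt_hess_chart t x₀) continuousAt_snd
  have h3 : ContinuousAt (fun q : ℝ × ℝ × X => (q.1 : ℂ)) (s, t, x₀) :=
    Complex.continuous_ofReal.continuousAt.comp continuousAt_fst
  exact h1.sub (h3.smul h2)

/-- Joint continuity in the scale, the time and the point is local and is read off in one chart.
Positivity is needed only for the denominator `det A`; the matrix in the numerator may be arbitrary.
-/
theorem HermMetric.IsPositive.continuous_maRatio {h : HermMetric n L} (hp : h.IsPositive)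
    (hφ : SmoothFamily (n := n) φ) :
    Continuous fun q : ℝ × ℝ × X =>
      maRatio (h.curvAt q.2.2) (h.curvAt q.2.2 - (q.1 : ℂ) • hessAt n (φ q.2.1) q.2.2) := by
  refine continuous_iff_continuousAt.2 fun ⟨s, t, x₀⟩ => ?_
  have h1 := continuousAt_maRatio (y := (s, t, x₀))
    (ContinuousAt.comp (f := fun q : ℝ × ℝ × X => q.2.2) (h.continuousAt_curvMatrix_chart x₀)
      (by fun_prop)) (h.continuousAt_path hφ s t x₀) (hp.det_pos (mem_chartDomain x₀)).ne'
  refine h1.congr ?_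
  have h2 : ContinuousAt (fun q : ℝ × ℝ × X => q.2.2) (s, t, x₀) := by fun_prop
  filter_upwards [h2.eventually ((isOpen_chartDomain (L := L) x₀).mem_nhds
    (mem_chartDomain (n := n) x₀))] with q hq
  exact (h.maRatio_chart (hφ.contMDiff _) _ hq).symm

theorem HermMetric.IsPositive.continuous_trRatio {h : HermMetric n L} (hp : h.IsPositive)
    (hφ : SmoothFamily (n := n) φ) (hψ : SmoothFamily (n := n) ψ) :
    Continuous fun q : ℝ × ℝ × X =>
      trRatio (h.curvAt q.2.2) (h.curvAt q.2.2 - (q.1 : ℂ) • hessAt n (φ q.2.1) q.2.2)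
        (hessAt n (ψ q.2.1) q.2.2) := by
  refine continuous_iff_continuousAt.2 fun ⟨s, t, x₀⟩ => ?_
  have h1 := continuousAt_trRatio (y := (s, t, x₀))
    (ContinuousAt.comp (f := fun q : ℝ × ℝ × X => q.2.2) (h.continuousAt_curvMatrix_chart x₀)
      (by fun_prop)) (h.continuousAt_path hφ s t x₀)
    (ContinuousAt.comp (f := fun q : ℝ × ℝ × X => q.2) (hψ.continuousAt_hess_chart t x₀)
        continuousAt_snd) (hp.det_pos (mem_chartDomain x₀)).ne'
  refine h1.congr ?_
  have h2 : ContinuousAt (fun q : ℝ × ℝ × X => q.2.2) (s, t, x₀) := by fun_prop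
  filter_upwards [h2.eventually ((isOpen_chartDomain (L := L) x₀).mem_nhds
    (mem_chartDomain (n := n) x₀))] with q hq
  exact (h.trRatio_chart (hφ.contMDiff _) (hψ.contMDiff _) _ hq).symm

theorem SmoothFamily.hasDerivAt_hessAt (hφ : SmoothFamily (n := n) φ) (t : ℝ) (x : X)
    (j k : Fin n) :
    HasDerivAt (fun r => hessAt n (φ r) x j k) (hessAt n (KahlerQuantization.timeDeriv φ t) x j k)
      t := by
  refine hasDerivAt_hess_slice (Φ := fun p : ℝ × (Fin n → ℂ) => (loc (φ p.1) x p.2 : ℂ))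
    (Ψ := fun p : ℝ × (Fin n → ℂ) => (loc (KahlerQuantization.timeDeriv φ p.1) x p.2 : ℂ))
    (chartAt (Fin n → ℂ) x).open_target (fun t _ hz => contDiffAt_ofReal (hφ.contDiffAt t hz))
    (fun t z _ => ?_) ((chartAt (Fin n → ℂ) x).map_source (mem_chart_source _ x)) t j k
  exact (hφ.hasDerivAt t ((chartAt (Fin n → ℂ) x).symm z)).ofReal_comp

end Families

/-! ### The derivative of the volume form and its symmetry -/

section ParametricIntegral

open MeasureTheory Topology

/-- The dominating function is constant: a bound for `F'` on the compact set `[t - 1, t + 1] × K`.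
-/
theorem hasDerivAt_setIntegral_of_continuous {Y : Type*} [TopologicalSpace Y] [MeasurableSpace Y]
    [OpensMeasurableSpace Y] {ν : Measure Y} [IsFiniteMeasureOnCompacts ν] {K : Set Y}
    (hK : IsCompact K) (hKm : MeasurableSet K) {F F' : ℝ → Y → ℝ} (hF : ∀ t, Continuous (F t))
    (hF' : Continuous fun p : ℝ × Y => F' p.1 p.2)
    (hd : ∀ t y, HasDerivAt (fun r => F r y) (F' t y) t) (t : ℝ) :
    HasDerivAt (fun r => ∫ y in K, F r y ∂ν) (∫ y in K, F' t y ∂ν) t := by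
  obtain ⟨C, hC⟩ := ((isCompact_Icc (a := t - 1) (b := t + 1)).prod hK).exists_bound_of_continuousOn
    hF'.continuousOn
  have hfin : IsFiniteMeasure (ν.restrict K) := ⟨by simpa using hK.measure_lt_top⟩
  have hint : ∀ f : Y → ℝ, Continuous f → Integrable f (ν.restrict K) := fun f hf => by
    obtain ⟨B, hB⟩ := hK.exists_bound_of_continuousOn hf.continuousOn
    refine Integrable.of_bound hf.aestronglyMeasurable B ?_
    exact (ae_restrict_iff' hKm).2 (Filter.Eventually.of_forall hB)
  refine (hasDerivAt_integral_of_dominated_loc_of_deriv_le (s := Set.Icc (t - 1) (t + 1))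
    (bound := fun _ => C) (Icc_mem_nhds (by linarith) (by linarith))
    (Filter.Eventually.of_forall fun r => (hF r).aestronglyMeasurable) (hint _ (hF t))
    (hF'.comp (continuous_const.prodMk continuous_id)).aestronglyMeasurable ?_
    (integrable_const C) (Filter.Eventually.of_forall fun y r _ => hd r y)).2
  exact (ae_restrict_iff' hKm).2 (Filter.Eventually.of_forall fun y hy r hr => hC (r, y) ⟨hr, hy⟩)

theorem hasDerivAt_integral_of_continuous {Y : Type*} [TopologicalSpace Y] [CompactSpace Y]
    [MeasurableSpace Y] [OpensMeasurableSpace Y] {ν : Measure Y} [IsFiniteMeasureOnCompacts ν]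
    {F F' : ℝ → Y → ℝ} (hF : ∀ t, Continuous (F t))
    (hF' : Continuous fun p : ℝ × Y => F' p.1 p.2)
    (hd : ∀ t y, HasDerivAt (fun r => F r y) (F' t y) t) (t : ℝ) :
    HasDerivAt (fun r => ∫ y, F r y ∂ν) (∫ y, F' t y ∂ν) t := by
  simpa using hasDerivAt_setIntegral_of_continuous (ν := ν) isCompact_univ MeasurableSet.univ
    hF hF' hd t

end ParametricIntegral

/-! ### Self-adjointness on the manifold, and change of metric in integrals. -/

section Symmetry

open MeasureTheory Topology

variable {n : ℕ} {X : Type*} [TopologicalSpace X] [ChartedSpace (Fin n → ℂ) X]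
  {L : X → Type*} [TopologicalSpace (Bundle.TotalSpace ℂ L)]
  [∀ x, AddCommGroup (L x)] [∀ x, Module ℂ (L x)] [∀ x, TopologicalSpace (L x)]
  [FiberBundle ℂ L] [VectorBundle ℂ ℂ L]
  [IsManifold 𝓘(ℂ, Fin n → ℂ) ω X] [ContMDiffVectorBundle ω ℂ L 𝓘(ℂ, Fin n → ℂ)]

variable {h h' : HermMetric n L} {φ u v : X → ℝ}

/-- This exhibits the perturbed curvature locally as the Hessian of one real function, the form
required for integration by parts on `ℂⁿ`. -/
theorem hess_weight (h : HermMetric n L) (hφ : ContMDiff 𝓘(ℝ, Fin n → ℂ) 𝓘(ℝ, ℝ) ∞ φ) (s : ℝ)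
    {x₀ x : X} (hx : x ∈ chartDomain n L x₀) :
    hess (fun z => ((-(h.realLogWeight x₀ z + s * loc φ x₀ z) : ℝ) : ℂ))
      (chartAt (Fin n → ℂ) x₀ x) = h.curvMatrix x₀ (chartAt (Fin n → ℂ) x₀ x) -
        (s : ℂ) • hess (fun z => (loc φ x₀ z : ℂ)) (chartAt (Fin n → ℂ) x₀ x) := by
  have h1 : (fun z => ((-(h.realLogWeight x₀ z + s * loc φ x₀ z) : ℝ) : ℂ)) =
      fun z => (-1 : ℂ) * h.logWeight x₀ z + (-s : ℂ) * (loc φ x₀ z : ℂ) := by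
    ext z
    push_cast
    change -((h.logWeight x₀ z) + s * loc φ x₀ z) = _
    ring
  have hw := h.contDiffAt_logWeight hx
  have hl := contDiffAt_loc hφ hx.1
  rw [h1, hess_add (contDiffAt_const.mul hw) (contDiffAt_const.mul hl), hess_const_mul _ hw,
    hess_const_mul _ hl, h.curvMatrix_eq]
  simp only [neg_smul, one_smul, sub_eq_add_neg]

/-- The log weights add. The coefficient `1` is kept so that the result is the member `s = 1` of the
segment of curvatures. -/
theorem curvMatrix_of_eq_exp (hφ : ContMDiff 𝓘(ℝ, Fin n → ℂ) 𝓘(ℝ, ℝ) ∞ φ)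
    (hh : ∀ x v, h'.normSq x v = Real.exp (φ x) * h.normSq x v) {x₀ x : X}
    (hx : x ∈ chartDomain n L x₀) :
    h'.curvMatrix x₀ (chartAt (Fin n → ℂ) x₀ x) = h.curvMatrix x₀ (chartAt (Fin n → ℂ) x₀ x) -
      ((1 : ℝ) : ℂ) • hess (fun z => (loc φ x₀ z : ℂ)) (chartAt (Fin n → ℂ) x₀ x) := by
  have h1 : h'.logWeight x₀ =ᶠ[𝓝 (chartAt (Fin n → ℂ) x₀ x)] fun z =>
      h.logWeight x₀ z + (loc φ x₀ z : ℂ) := by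
    filter_upwards [(isOpen_coordDomain x₀).mem_nhds (chart_mem_coordDomain hx)] with z hz
    rw [HermMetric.logWeight, hh, Real.log_mul (Real.exp_ne_zero _) (h.normSq_frame_pos hz.2).ne',
      Real.log_exp, add_comm, Complex.ofReal_add]
    rfl
  rw [h'.curvMatrix_eq, h.curvMatrix_eq, hess_congr h1,
    hess_add (h.contDiffAt_logWeight hx) (contDiffAt_loc hφ hx.1)]
  simp [sub_eq_add_neg, add_comm]

theorem hessAt_sum {ι : Type*} (t : Finset ι) {f : ι → X → ℝ}
    (hf : ∀ i ∈ t, ContMDiff 𝓘(ℝ, Fin n → ℂ) 𝓘(ℝ, ℝ) ∞ (f i)) (x : X) :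
    hessAt n (fun x => ∑ i ∈ t, f i x) x = ∑ i ∈ t, hessAt n (f i) x := by
  rw [hessAt]
  simp only [loc, Complex.ofReal_sum]
  exact hess_sum fun i hi => contDiffAt_loc (hf i hi) (mem_chart_source _ x)

theorem hessAt_const (c : ℝ) (x : X) : hessAt n (fun _ : X => c) x = 0 := hess_const (c : ℂ)

theorem HermMetric.IsPositive.continuous_trRatio_const (hp : h.IsPositive)
    (hφ : ContMDiff 𝓘(ℝ, Fin n → ℂ) 𝓘(ℝ, ℝ) ∞ φ) (hv : ContMDiff 𝓘(ℝ, Fin n → ℂ) 𝓘(ℝ, ℝ) ∞ v)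
    (s : ℝ) : Continuous fun x =>
      trRatio (h.curvAt x) (h.curvAt x - (s : ℂ) • hessAt n φ x) (hessAt n v x) :=
  (hp.continuous_trRatio (smoothFamily_const hφ) (smoothFamily_const hv)).comp
    (f := fun x : X => (s, (0 : ℝ), x)) (by fun_prop)

theorem HermMetric.IsPositive.continuous_maRatio_const (hp : h.IsPositive)
    (hφ : ContMDiff 𝓘(ℝ, Fin n → ℂ) 𝓘(ℝ, ℝ) ∞ φ) (s : ℝ) : Continuous fun x =>
      maRatio (h.curvAt x) (h.curvAt x - (s : ℂ) • hessAt n φ x) :=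
  (hp.continuous_maRatio (smoothFamily_const hφ)).comp
    (f := fun x : X => (s, (0 : ℝ), x)) (by fun_prop)

/-- A function supported in a coordinate neighbourhood, transported to `ℂⁿ`. -/
theorem exists_contDiff_loc [CompactSpace X] (hu : ContMDiff 𝓘(ℝ, Fin n → ℂ) 𝓘(ℝ, ℝ) ∞ u)
    {x₀ : X} (hs : tsupport u ⊆ chartDomain n L x₀) :
    ∃ g : (Fin n → ℂ) → ℝ, ContDiff ℝ ∞ g ∧ HasCompactSupport g ∧
      tsupport g ⊆ coordDomain L x₀ ∧ ∀ z ∈ coordDomain L x₀, g z = loc u x₀ z := by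
  classical
  have hD := isOpen_coordDomain (n := n) (L := L) x₀
  set K := chartAt (Fin n → ℂ) x₀ '' tsupport u with hKdef
  have hK : IsCompact K := (isClosed_tsupport u).isCompact.image_of_continuousOn
    ((chartAt (Fin n → ℂ) x₀).continuousOn.mono fun x hx => (hs hx).1)
  have hKD : K ⊆ coordDomain L x₀ := by
    rintro _ ⟨x, hx, rfl⟩
    exact chart_mem_coordDomain (hs hx)
  set g := (coordDomain L x₀ : Set (Fin n → ℂ)).indicator (loc u x₀) with hg
  have h0 : ∀ z ∉ K, g z = 0 := fun z hz => by
    by_cases hzD : z ∈ coordDomain L x₀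
    · rw [hg, Set.indicator_of_mem hzD]
      exact image_eq_zero_of_notMem_tsupport (f := u) fun hmem => hz ⟨_, hmem, chart_symm hzD⟩
    · rw [hg, Set.indicator_of_notMem hzD]
  have hsupp : tsupport g ⊆ K :=
    closure_minimal (fun z hz => by_contra fun hzK => hz (h0 z hzK)) hK.isClosed
  refine ⟨g, contDiff_iff_contDiffAt.2 fun z => ?_, HasCompactSupport.intro hK h0,
    hsupp.trans hKD, fun z hz => Set.indicator_of_mem hz _⟩
  by_cases hzD : z ∈ coordDomain L x₀
  · refine ((contDiffOn_loc hu x₀).contDiffAt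
      ((chartAt (Fin n → ℂ) x₀).open_target.mem_nhds hzD.1)).congr_of_eventuallyEq ?_
    filter_upwards [hD.mem_nhds hzD] with y hy
    exact Set.indicator_of_mem hy _
  · have : g =ᶠ[𝓝 z] fun _ => 0 := by
      filter_upwards [hK.isClosed.isOpen_compl.mem_nhds fun hz => hzD (hKD hz)] with y hy
      exact h0 y hy
    exact contDiffAt_const.congr_of_eventuallyEq this

variable [CompactSpace X] [T2Space X] [MeasurableSpace X] [BorelSpace X]

theorem integrable_of_continuous (h : HermMetric n L) {f : X → ℝ} (hf : Continuous f) :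
    Integrable f h.measure := by
  have := hf.continuousOn.integrableOn_compact (μ := h.measure) isCompact_univ
  rwa [integrableOn_univ] at this

/-- The denominator of `trRatio` cancels against the density, which leaves the integrand of the
symmetry on `ℂⁿ`. -/
theorem trRatio_mul_density (hp : h.IsPositive) (hφ : ContMDiff 𝓘(ℝ, Fin n → ℂ) 𝓘(ℝ, ℝ) ∞ φ)
    (hv : ContMDiff 𝓘(ℝ, Fin n → ℂ) 𝓘(ℝ, ℝ) ∞ v) (s : ℝ) {x₀ : X} {z : Fin n → ℂ}
    (hz : z ∈ coordDomain L x₀) :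
    trRatio (h.curvAt ((chartAt (Fin n → ℂ) x₀).symm z))
      (h.curvAt ((chartAt (Fin n → ℂ) x₀).symm z) -
        (s : ℂ) • hessAt n φ ((chartAt (Fin n → ℂ) x₀).symm z))
      (hessAt n v ((chartAt (Fin n → ℂ) x₀).symm z)) * h.density x₀ z =
    2 ^ n * ((hess (fun z => ((-(h.realLogWeight x₀ z + s * loc φ x₀ z) : ℝ) : ℂ)) z).adjugate *
      hess (fun z => (loc v x₀ z : ℂ)) z).trace.re := by
  have hx := symm_mem_chartDomain hz
  have h1 := h.trRatio_chart hφ hv s hx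
  have h2 := hess_weight h hφ s hx
  have h3 := hp.det_pos hx
  rw [chart_symm hz] at h1 h2 h3
  rw [h1, h2, trRatio, HermMetric.density]
  field_simp

/-- Both integrands vanish outside the chart domain, one through `u` and the other through its
Hessian, so the identity is one on `ℂⁿ` with the compactly supported transport of `u`. -/
theorem integral_mul_trRatio_symm_of_support (hp : h.IsPositive)
    (hφ : ContMDiff 𝓘(ℝ, Fin n → ℂ) 𝓘(ℝ, ℝ) ∞ φ) (hu : ContMDiff 𝓘(ℝ, Fin n → ℂ) 𝓘(ℝ, ℝ) ∞ u)
    (hv : ContMDiff 𝓘(ℝ, Fin n → ℂ) 𝓘(ℝ, ℝ) ∞ v) (s : ℝ) {x₀ : X}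
    (hs : tsupport u ⊆ chartDomain n L x₀) :
    ∫ x, u x * trRatio (h.curvAt x) (h.curvAt x - (s : ℂ) • hessAt n φ x) (hessAt n v x)
      ∂h.measure =
    ∫ x, v x * trRatio (h.curvAt x) (h.curvAt x - (s : ℂ) • hessAt n φ x) (hessAt n u x)
      ∂h.measure := by
  obtain ⟨g, hg, hgc, hgD, hgu⟩ := exists_contDiff_loc hu hs
  have hD := isOpen_coordDomain (n := n) (L := L) x₀
  have hu0 : ∀ x ∉ chartDomain n L x₀, u x = 0 := fun x hx =>
    image_eq_zero_of_notMem_tsupport fun hmem => hx (hs hmem)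
  have hK0 : ∀ x ∉ chartDomain n L x₀, hessAt n u x = 0 := fun x hx => by
    have h1 : ∀ᶠ y in 𝓝 x, u y = 0 :=
      notMem_tsupport_iff_eventuallyEq.1 fun hmem => hx (hs hmem)
    have h2 : (fun z => (loc u x z : ℂ)) =ᶠ[𝓝 (chartAt (Fin n → ℂ) x x)] fun _ => 0 := by
      filter_upwards [eventually_chart_symm (mem_chart_source _ x) h1] with z hz
      rw [loc, hz, Complex.ofReal_zero]
    rw [hessAt, hess_congr h2, hess_const]
  rw [h.integral_measure_of_support hp x₀
    (hu.continuous.fun_mul (hp.continuous_trRatio_const hφ hv s)) fun x hx => by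
      rw [hu0 x hx, zero_mul],
    h.integral_measure_of_support hp x₀
    (hv.continuous.fun_mul (hp.continuous_trRatio_const hφ hu s)) fun x hx => by
      rw [hK0 x hx, trRatio_zero, mul_zero]]
  have hw : ContDiffOn ℝ ∞ (fun z => -(h.realLogWeight x₀ z + s * loc φ x₀ z))
      (coordDomain L x₀) :=
    ((h.contDiffOn_realLogWeight x₀).add (contDiffOn_const.mul
      ((contDiffOn_loc hφ x₀).mono Set.inter_subset_left))).neg
  have key := setIntegral_mul_trace_adjugate_hess_symm hD hg hgc hgD
    ((contDiffOn_loc hv x₀).mono Set.inter_subset_left) hw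
  have e1 : ∫ z in coordDomain L x₀, (u ((chartAt (Fin n → ℂ) x₀).symm z) *
      trRatio (h.curvAt ((chartAt (Fin n → ℂ) x₀).symm z))
      (h.curvAt ((chartAt (Fin n → ℂ) x₀).symm z) -
        (s : ℂ) • hessAt n φ ((chartAt (Fin n → ℂ) x₀).symm z))
      (hessAt n v ((chartAt (Fin n → ℂ) x₀).symm z))) * h.density x₀ z =
      2 ^ n * ∫ z in coordDomain L x₀, g z *
        ((hess (fun z => ((-(h.realLogWeight x₀ z + s * loc φ x₀ z) : ℝ) : ℂ)) z).adjugate *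
        hess (fun z => (loc v x₀ z : ℂ)) z).trace.re := by
    rw [← integral_const_mul]
    refine setIntegral_congr_fun hD.measurableSet fun z hz => ?_
    rw [mul_assoc, trRatio_mul_density hp hφ hv s hz, hgu z hz, loc]
    ring
  have e2 : ∫ z in coordDomain L x₀, (v ((chartAt (Fin n → ℂ) x₀).symm z) *
      trRatio (h.curvAt ((chartAt (Fin n → ℂ) x₀).symm z))
      (h.curvAt ((chartAt (Fin n → ℂ) x₀).symm z) -
        (s : ℂ) • hessAt n φ ((chartAt (Fin n → ℂ) x₀).symm z))
      (hessAt n u ((chartAt (Fin n → ℂ) x₀).symm z))) * h.density x₀ z =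
      2 ^ n * ∫ z in coordDomain L x₀, loc v x₀ z *
        ((hess (fun z => ((-(h.realLogWeight x₀ z + s * loc φ x₀ z) : ℝ) : ℂ)) z).adjugate *
        hess (fun z => (g z : ℂ)) z).trace.re := by
    rw [← integral_const_mul]
    refine setIntegral_congr_fun hD.measurableSet fun z hz => ?_
    have hgu' : (fun z => (g z : ℂ)) =ᶠ[𝓝 z] fun z => (loc u x₀ z : ℂ) := by
      filter_upwards [hD.mem_nhds hz] with y hy
      rw [hgu y hy]
    rw [mul_assoc, trRatio_mul_density hp hφ hu s hz, hess_congr hgu', loc]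
    ring
  rw [e1, e2, key]

/-- The operator `u ↦ tr (adj (ω_{e^{sφ}h}) ∂∂̄u)` is self-adjoint. -/
theorem integral_mul_trRatio_symm (hp : h.IsPositive)
    (hφ : ContMDiff 𝓘(ℝ, Fin n → ℂ) 𝓘(ℝ, ℝ) ∞ φ) (hu : ContMDiff 𝓘(ℝ, Fin n → ℂ) 𝓘(ℝ, ℝ) ∞ u)
    (hv : ContMDiff 𝓘(ℝ, Fin n → ℂ) 𝓘(ℝ, ℝ) ∞ v) (s : ℝ) :
    ∫ x, u x * trRatio (h.curvAt x) (h.curvAt x - (s : ℂ) • hessAt n φ x) (hessAt n v x)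
      ∂h.measure =
    ∫ x, v x * trRatio (h.curvAt x) (h.curvAt x - (s : ℂ) • hessAt n φ x) (hessAt n u x)
      ∂h.measure := by
  -- Both sides are linear in `u`, so only `u` needs to be cut into pieces; `v` and `φ` stay global.
  obtain ⟨t, χ, hχ, hχs, hχ1⟩ := exists_partition n L (X := X)
  have hχu : ∀ i, ContMDiff 𝓘(ℝ, Fin n → ℂ) 𝓘(ℝ, ℝ) ∞ fun x => χ i x * u x := fun i =>
    (hχ i).mul hu
  have hsum : u = fun x => ∑ i, χ i x * u x := by
    ext x
    rw [← Finset.sum_mul, hχ1, one_mul]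
  have hi : ∀ i, tsupport (fun x => χ i x * u x) ⊆ chartDomain n L (i : X) := fun i =>
    (tsupport_mul_subset_left).trans (hχs i)
  have hK : ∀ x, hessAt n u x = ∑ i, hessAt n (fun x => χ i x * u x) x := fun x => by
    conv_lhs => rw [hsum]
    exact hessAt_sum _ (fun i _ => hχu i) x
  have e1 : ∀ x, u x * trRatio (h.curvAt x) (h.curvAt x - (s : ℂ) • hessAt n φ x)
      (hessAt n v x) = ∑ i, (χ i x * u x) * trRatio (h.curvAt x)
        (h.curvAt x - (s : ℂ) • hessAt n φ x) (hessAt n v x) := fun x => by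
    rw [← Finset.sum_mul, ← Finset.sum_mul, hχ1, one_mul]
  simp only [e1, hK, trRatio_sum, Finset.mul_sum]
  rw [integral_finsetSum _ fun i _ => integrable_of_continuous h
      ((hχu i).continuous.fun_mul (hp.continuous_trRatio_const hφ hv s)),
    integral_finsetSum _ fun i _ => integrable_of_continuous h
      (hv.continuous.fun_mul (hp.continuous_trRatio_const hφ (hχu i) s))]
  exact Finset.sum_congr rfl fun i _ =>
    integral_mul_trRatio_symm_of_support hp hφ (hχu i) hv s (hi i)

/-- The measure of `e^φ h` in terms of that of `h`. -/
theorem integral_measure_of_eq_exp (hp : h.IsPositive) (hp' : h'.IsPositive)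
    (hφ : ContMDiff 𝓘(ℝ, Fin n → ℂ) 𝓘(ℝ, ℝ) ∞ φ)
    (hh : ∀ x v, h'.normSq x v = Real.exp (φ x) * h.normSq x v) {f : X → ℝ} (hf : Continuous f) :
    ∫ x, f x ∂h'.measure =
      ∫ x, f x * maRatio (h.curvAt x) (h.curvAt x - ((1 : ℝ) : ℂ) • hessAt n φ x) ∂h.measure := by
  obtain ⟨t, χ, hχ, hχs, hχ1⟩ := exists_partition n L (X := X)
  have hma := hp.continuous_maRatio_const hφ 1
  have hc : ∀ i, Continuous fun x => χ i x * f x := fun i => (hχ i).continuous.mul hf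
  have hs : ∀ i : t, ∀ x ∉ chartDomain n L (i : X), χ i x * f x = 0 := fun i x hx => by
    rw [image_eq_zero_of_notMem_tsupport fun hmem => hx (hχs i hmem), zero_mul]
  have e1 : ∀ x, f x = ∑ i, χ i x * f x := fun x => by rw [← Finset.sum_mul, hχ1, one_mul]
  have e2 : ∀ x, f x * maRatio (h.curvAt x) (h.curvAt x - ((1 : ℝ) : ℂ) • hessAt n φ x) =
      ∑ i, (χ i x * f x) *
        maRatio (h.curvAt x) (h.curvAt x - ((1 : ℝ) : ℂ) • hessAt n φ x) := fun x => by
    rw [← Finset.sum_mul, ← e1]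
  rw [integral_congr_ae (Filter.Eventually.of_forall e1),
    integral_congr_ae (Filter.Eventually.of_forall e2),
    integral_finsetSum _ fun i _ => integrable_of_continuous h' (hc i),
    integral_finsetSum _ fun i _ => integrable_of_continuous h ((hc i).fun_mul hma)]
  refine Finset.sum_congr rfl fun i _ => ?_
  rw [h'.integral_measure_of_support hp' i (hc i) (hs i),
    h.integral_measure_of_support hp i ((hc i).fun_mul hma) fun x hx => by rw [hs i x hx, zero_mul]]
  refine setIntegral_congr_fun (isOpen_coordDomain (i : X)).measurableSet fun z hz => ?_
  have hx := symm_mem_chartDomain hz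
  have h1 := h.maRatio_chart hφ 1 hx
  have h3 := hp.det_pos hx
  rw [← curvMatrix_of_eq_exp hφ hh hx] at h1
  rw [chart_symm hz] at h1 h3
  rw [h1, maRatio, HermMetric.density, HermMetric.density]
  field_simp

end Symmetry

/-! ### Derivatives of weighted volumes along paths of potentials. -/

section Variation

open MeasureTheory Topology

variable {n : ℕ} {X : Type*} [TopologicalSpace X] [ChartedSpace (Fin n → ℂ) X]
  {L : X → Type*} [TopologicalSpace (Bundle.TotalSpace ℂ L)]
  [∀ x, AddCommGroup (L x)] [∀ x, Module ℂ (L x)] [∀ x, TopologicalSpace (L x)]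
  [FiberBundle ℂ L] [VectorBundle ℂ ℂ L]
  [IsManifold 𝓘(ℂ, Fin n → ℂ) ω X] [ContMDiffVectorBundle ω ℂ L 𝓘(ℂ, Fin n → ℂ)]

variable [CompactSpace X] [MeasurableSpace X] [BorelSpace X] {h : HermMetric n L}
  {φ f : ℝ → X → ℝ}

theorem hasDerivAt_maRatio_family (h : HermMetric n L) (hφ : SmoothFamily (n := n) φ) (s t : ℝ)
    (x : X) :
    HasDerivAt (fun r => maRatio (h.curvAt x) (h.curvAt x - (s : ℂ) • hessAt n (φ r) x))
      (- (s * trRatio (h.curvAt x) (h.curvAt x - (s : ℂ) • hessAt n (φ t) x)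
        (hessAt n (timeDeriv φ t) x))) t := by
  have h1 := hasDerivAt_maRatio (A := h.curvAt x)
    (N := fun r => h.curvAt x - (s : ℂ) • hessAt n (φ r) x) (t := t)
    (C := (((-s : ℝ) : ℂ)) • hessAt n (timeDeriv φ t) x) fun j k => by
      have h2 := ((hφ.hasDerivAt_hessAt t x j k).const_mul (s : ℂ)).const_sub (h.curvAt x j k)
      exact h2.congr_deriv (by simp)
  rw [trRatio_smul, neg_mul] at h1
  exact h1

theorem hasDerivAt_maRatio_scale (h : HermMetric n L) (φ : X → ℝ) (s : ℝ) (x : X) :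
    HasDerivAt (fun r : ℝ => maRatio (h.curvAt x) (h.curvAt x - (r : ℂ) • hessAt n φ x))
      (- trRatio (h.curvAt x) (h.curvAt x - (s : ℂ) • hessAt n φ x) (hessAt n φ x)) s := by
  have h1 := hasDerivAt_maRatio (A := h.curvAt x)
    (N := fun r : ℝ => h.curvAt x - (r : ℂ) • hessAt n φ x) (t := s)
    (C := (((-1 : ℝ) : ℂ)) • hessAt n φ x) fun j k => by
      have h2 := ((Complex.ofRealCLM.hasDerivAt (x := s)).mul_const
        (hessAt n φ x j k)).const_sub (h.curvAt x j k)
      exact h2.congr_deriv (by simp)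
  rw [trRatio_smul, neg_one_mul] at h1
  exact h1

theorem continuous_maRatio_time (hp : h.IsPositive) (hφ : SmoothFamily (n := n) φ) (s : ℝ) :
    Continuous fun p : ℝ × X =>
      maRatio (h.curvAt p.2) (h.curvAt p.2 - (s : ℂ) • hessAt n (φ p.1) p.2) :=
  (hp.continuous_maRatio hφ).comp (f := fun p : ℝ × X => (s, p)) (by fun_prop)

/-- The derivative of `∫ f_t dμ` along a path of metrics. -/
theorem hasDerivAt_integral_mul_maRatio (hp : h.IsPositive) (hφ : SmoothFamily (n := n) φ)
    (hf : SmoothFamily (n := n) f) (s t : ℝ) :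
    HasDerivAt (fun r => ∫ x, f r x *
        maRatio (h.curvAt x) (h.curvAt x - (s : ℂ) • hessAt n (φ r) x) ∂h.measure)
      (∫ x, (timeDeriv f t x *
          maRatio (h.curvAt x) (h.curvAt x - (s : ℂ) • hessAt n (φ t) x) -
        s * (f t x * trRatio (h.curvAt x) (h.curvAt x - (s : ℂ) • hessAt n (φ t) x)
        (hessAt n (timeDeriv φ t) x))) ∂h.measure) t := by
  have htr : Continuous fun p : ℝ × X => trRatio (h.curvAt p.2)
      (h.curvAt p.2 - (s : ℂ) • hessAt n (φ p.1) p.2) (hessAt n (timeDeriv φ p.1) p.2) :=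
    (hp.continuous_trRatio hφ hφ.timeDeriv).comp (f := fun p : ℝ × X => (s, p)) (by fun_prop)
  refine hasDerivAt_integral_of_continuous (F' := fun t x => timeDeriv f t x *
          maRatio (h.curvAt x) (h.curvAt x - (s : ℂ) • hessAt n (φ t) x) -
        s * (f t x * trRatio (h.curvAt x) (h.curvAt x - (s : ℂ) • hessAt n (φ t) x)
        (hessAt n (timeDeriv φ t) x))) (fun t => ?_) ?_ (fun t x => ?_) t
  · exact (hf.contMDiff t).continuous.mul (hp.continuous_maRatio_const (hφ.contMDiff t) s)
  · exact (hf.timeDeriv.continuous.mul (continuous_maRatio_time hp hφ s)).sub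
      (continuous_const.mul (hf.continuous.mul htr))
  · exact ((hf.hasDerivAt t x).fun_mul (hasDerivAt_maRatio_family h hφ s t x)).congr_deriv
      (by ring)

end Variation

/-! ### The energy functional -/

section Energy

open MeasureTheory Topology

variable {n : ℕ} {X : Type*} [TopologicalSpace X] [ChartedSpace (Fin n → ℂ) X]
  {L : X → Type*} [TopologicalSpace (Bundle.TotalSpace ℂ L)]
  [∀ x, AddCommGroup (L x)] [∀ x, Module ℂ (L x)] [∀ x, TopologicalSpace (L x)]
  [FiberBundle ℂ L] [VectorBundle ℂ ℂ L]
  [IsManifold 𝓘(ℂ, Fin n → ℂ) ω X] [ContMDiffVectorBundle ω ℂ L 𝓘(ℂ, Fin n → ℂ)]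

variable {h h₀ : HermMetric n L}

/-- The logarithm of the ratio of two metrics. -/
def relLog (h h₀ : HermMetric n L) (x : X) : ℝ :=
  Real.log (h.normSq x (frame L x x) / h₀.normSq x (frame L x x))

theorem exp_relLog (h h₀ : HermMetric n L) (x : X) (v : L x) :
    h.normSq x v = Real.exp (relLog h h₀ x) * h₀.normSq x v := by
  have hx := FiberBundle.mem_baseSet_trivializationAt' (F := ℂ) (E := L) x
  have h1 := h.normSq_frame_pos hx
  have h2 := h₀.normSq_frame_pos hx
  rw [localCoord_smul_frame x x hx v, h.normSq_smul, h₀.normSq_smul, relLog,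
    Real.exp_log (div_pos h1 h2)]
  field_simp

theorem relLog_eq_of_exp {x : X} {r : ℝ}
    (hr : ∀ v, h.normSq x v = Real.exp r * h₀.normSq x v) : relLog h h₀ x = r := by
  have h2 := h₀.normSq_frame_pos (FiberBundle.mem_baseSet_trivializationAt' (F := ℂ) (E := L) x)
  rw [relLog, hr, mul_div_cancel_right₀ _ h2.ne', Real.log_exp]

/-- The quotient of two metrics does not depend on the vector, so near `y` the frame at `y` may
replace the frame varying with `x`. -/
theorem contMDiff_relLog (h h₀ : HermMetric n L) :
    ContMDiff 𝓘(ℝ, Fin n → ℂ) 𝓘(ℝ, ℝ) ∞ (relLog h h₀) := by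
  intro y
  have hB := (trivializationAt ℂ L y).open_baseSet
  have hy := FiberBundle.mem_baseSet_trivializationAt' (F := ℂ) (E := L) y
  have h1 := (h.smooth y).contMDiffAt (hB.mem_nhds hy)
  have h2 := (h₀.smooth y).contMDiffAt (hB.mem_nhds hy)
  have hpos := h.normSq_frame_pos hy
  have hpos' := h₀.normSq_frame_pos hy
  have h3 : ContMDiffAt 𝓘(ℝ, Fin n → ℂ) 𝓘(ℝ, ℝ) ∞ (fun x =>
      Real.log (h.normSq x (frame L y x)) - Real.log (h₀.normSq x (frame L y x))) y :=
    ((Real.contDiffAt_log.2 hpos.ne').contMDiffAt.comp y h1).sub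
      ((Real.contDiffAt_log.2 hpos'.ne').contMDiffAt.comp y h2)
  refine h3.congr_of_eventuallyEq ?_
  filter_upwards [hB.mem_nhds hy] with x hx
  rw [← Real.log_div (h.normSq_frame_pos hx).ne' (h₀.normSq_frame_pos hx).ne']
  refine relLog_eq_of_exp fun v => ?_
  rw [Real.exp_log (div_pos (h.normSq_frame_pos hx) (h₀.normSq_frame_pos hx)),
    localCoord_smul_frame y x hx v, h.normSq_smul, h₀.normSq_smul]
  have := (h₀.normSq_frame_pos hx).ne'
  field_simp

variable [MeasurableSpace X]

/-- The energy of `h`, obtained by integrating along the segment from `h₀`. -/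
def energy (h₀ h : HermMetric n L) : ℝ :=
  ∫ s in Set.Icc (0 : ℝ) 1, ∫ x, relLog h h₀ x *
    maRatio (h₀.curvAt x) (h₀.curvAt x - (s : ℂ) • hessAt n (relLog h h₀) x) ∂h₀.measure

variable [CompactSpace X] [T2Space X] [BorelSpace X]

/-- The product rule gives the term `-s ∫ ψ tr(∂∂̄φ)`, which self-adjointness turns into `-s ∫ φ
tr(∂∂̄ψ)`. With `ψ = φ̇` the result is the integrand of the first variation of `energy`, now seen to
be an exact derivative in `s`. -/
theorem hasDerivAt_mul_integral_maRatio {φ ψ : X → ℝ} (hp : h.IsPositive)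
    (hφ : ContMDiff 𝓘(ℝ, Fin n → ℂ) 𝓘(ℝ, ℝ) ∞ φ) (hψ : ContMDiff 𝓘(ℝ, Fin n → ℂ) 𝓘(ℝ, ℝ) ∞ ψ)
    (s : ℝ) :
    HasDerivAt (fun r : ℝ => r * ∫ x, ψ x *
        maRatio (h.curvAt x) (h.curvAt x - (r : ℂ) • hessAt n φ x) ∂h.measure)
      (∫ x, (ψ x * maRatio (h.curvAt x) (h.curvAt x - (s : ℂ) • hessAt n φ x) -
        s * (φ x * trRatio (h.curvAt x) (h.curvAt x - (s : ℂ) • hessAt n φ x)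
          (hessAt n ψ x))) ∂h.measure) s := by
  have hma := fun s => hp.continuous_maRatio_const hφ s
  have htr := fun s => hp.continuous_trRatio_const hφ hφ s
  have htr' := fun s => hp.continuous_trRatio_const hφ hψ s
  have htrc : Continuous fun p : ℝ × X => trRatio (h.curvAt p.2)
      (h.curvAt p.2 - (p.1 : ℂ) • hessAt n φ p.2) (hessAt n φ p.2) :=
    (hp.continuous_trRatio (smoothFamily_const hφ) (smoothFamily_const hφ)).comp
      (f := fun p : ℝ × X => (p.1, (0 : ℝ), p.2)) (by fun_prop)
  have h1 := hasDerivAt_integral_of_continuous (ν := h.measure)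
    (F := fun r x => ψ x * maRatio (h.curvAt x) (h.curvAt x - (r : ℂ) • hessAt n φ x))
    (F' := fun r x => ψ x *
      -trRatio (h.curvAt x) (h.curvAt x - (r : ℂ) • hessAt n φ x) (hessAt n φ x))
    (fun r => hψ.continuous.mul (hma r))
    ((hψ.continuous.comp continuous_snd).mul htrc.neg)
    (fun r x => (hasDerivAt_maRatio_scale h φ r x).const_mul (ψ x)) s
  refine ((hasDerivAt_id s).mul h1).congr_deriv ?_
  rw [integral_sub (integrable_of_continuous h (hψ.continuous.fun_mul (hma s)))
    ((integrable_of_continuous h (hφ.continuous.fun_mul (htr' s))).const_mul s),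
    integral_const_mul, integral_mul_trRatio_symm hp hφ hφ hψ s]
  simp only [mul_neg, integral_neg, id, one_mul]
  ring

theorem continuous_integral_measure {P : Type*} [TopologicalSpace P]
    [FirstCountableTopology P] [LocallyCompactSpace P] (h : HermMetric n L)
    {G : P → X → ℝ} (hG : Continuous fun p : P × X => G p.1 p.2) :
    Continuous fun p => ∫ x, G p x ∂h.measure := by
  have := continuous_parametric_integral_of_continuous (μ := h.measure) (s := Set.univ)
    (f := G) hG isCompact_univ
  simpa using this

theorem continuous_integral_variation {ψ : ℝ → X → ℝ} (hp : h₀.IsPositive)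
    (hψ : SmoothFamily (n := n) ψ) :
    Continuous fun p : ℝ × ℝ => ∫ x, (timeDeriv ψ p.1 x *
      maRatio (h₀.curvAt x) (h₀.curvAt x - (p.2 : ℂ) • hessAt n (ψ p.1) x) -
      p.2 * (ψ p.1 x * trRatio (h₀.curvAt x) (h₀.curvAt x - (p.2 : ℂ) • hessAt n (ψ p.1) x)
        (hessAt n (timeDeriv ψ p.1) x))) ∂h₀.measure := by
  have hma : Continuous fun q : ℝ × ℝ × X =>
      maRatio (h₀.curvAt q.2.2) (h₀.curvAt q.2.2 - (q.1 : ℂ) • hessAt n (ψ q.2.1) q.2.2) :=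
    hp.continuous_maRatio hψ
  have htr : Continuous fun q : ℝ × ℝ × X =>
      trRatio (h₀.curvAt q.2.2) (h₀.curvAt q.2.2 - (q.1 : ℂ) • hessAt n (ψ q.2.1) q.2.2)
        (hessAt n (timeDeriv ψ q.2.1) q.2.2) := hp.continuous_trRatio hψ hψ.timeDeriv
  have hc : Continuous fun q : (ℝ × ℝ) × X => (q.1.2, q.1.1, q.2) := by fun_prop
  have hc1 : Continuous fun q : (ℝ × ℝ) × X => (q.1.1, q.2) := by fun_prop
  have h1 : Continuous fun q : (ℝ × ℝ) × X => timeDeriv ψ q.1.1 q.2 :=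
    hψ.timeDeriv.continuous.comp hc1
  have h2 : Continuous fun q : (ℝ × ℝ) × X => ψ q.1.1 q.2 := hψ.continuous.comp hc1
  have h3 := hma.comp hc
  have h4 := htr.comp hc
  have h5 : Continuous fun q : (ℝ × ℝ) × X => q.1.2 := by fun_prop
  exact continuous_integral_measure h₀ ((h1.fun_mul h3).fun_sub (h5.fun_mul (h2.fun_mul h4)))

/-- Differentiating under both integrals gives a total derivative in `s`, by
`hasDerivAt_mul_integral_maRatio`. The fundamental theorem of calculus leaves the boundary value at
`s = 1`, which is the integral against the measure of `h t`; the one at `s = 0` carries the factor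
`0`. -/
theorem hasDerivAt_energy {h : ℝ → HermMetric n L} {ψ : ℝ → X → ℝ} (hp : h₀.IsPositive)
    (hψ : SmoothFamily (n := n) ψ)
    (hexp : ∀ t x v, (h t).normSq x v = Real.exp (ψ t x) * h₀.normSq x v)
    (hpos : ∀ t, (h t).IsPositive) (t : ℝ) :
    HasDerivAt (fun r => energy h₀ (h r)) (∫ x, timeDeriv ψ t x ∂(h t).measure) t := by
  have hψrel : ∀ t, relLog (h t) h₀ = ψ t := fun t => by
    ext x
    exact relLog_eq_of_exp fun v => hexp t x v
  have hma : Continuous fun q : ℝ × ℝ × X =>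
      maRatio (h₀.curvAt q.2.2) (h₀.curvAt q.2.2 - (q.1 : ℂ) • hessAt n (ψ q.2.1) q.2.2) :=
    hp.continuous_maRatio hψ
  have hF : ∀ t, Continuous fun s : ℝ => ∫ x, ψ t x *
      maRatio (h₀.curvAt x) (h₀.curvAt x - (s : ℂ) • hessAt n (ψ t) x) ∂h₀.measure := fun t => by
    refine continuous_integral_measure h₀ (G := fun (s : ℝ) (x : X) => ψ t x *
        maRatio (h₀.curvAt x) (h₀.curvAt x - (s : ℂ) • hessAt n (ψ t) x)) ?_
    have h1 : Continuous fun p : ℝ × X => ψ t p.2 := (hψ.contMDiff t).continuous.comp continuous_snd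
    have h2 : Continuous fun p : ℝ × X => (p.1, t, p.2) := by fun_prop
    have h3 := hma.comp h2
    exact h1.fun_mul h3
  have hF' := continuous_integral_variation hp hψ
  have key := hasDerivAt_setIntegral_of_continuous (ν := volume) (K := Set.Icc (0 : ℝ) 1)
    isCompact_Icc measurableSet_Icc hF hF'
    (fun t s => hasDerivAt_integral_mul_maRatio hp hψ hψ s t) t
  simp only [energy, hψrel]
  refine key.congr_deriv ?_
  have hcont : Continuous fun s : ℝ => ∫ x, (timeDeriv ψ t x *
      maRatio (h₀.curvAt x) (h₀.curvAt x - (s : ℂ) • hessAt n (ψ t) x) -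
      s * (ψ t x * trRatio (h₀.curvAt x) (h₀.curvAt x - (s : ℂ) • hessAt n (ψ t) x)
        (hessAt n (timeDeriv ψ t) x))) ∂h₀.measure :=
    hF'.comp (f := fun s : ℝ => (t, s)) (by fun_prop)
  rw [integral_Icc_eq_integral_Ioc, ← intervalIntegral.integral_of_le zero_le_one,
    intervalIntegral.integral_eq_sub_of_hasDerivAt (fun s _ => hasDerivAt_mul_integral_maRatio hp
      (hψ.contMDiff t) (hψ.timeDeriv.contMDiff t) s) (hcont.intervalIntegrable _ _)]
  rw [one_mul, zero_mul, sub_zero, ← integral_measure_of_eq_exp hp (hpos t) (hψ.contMDiff t)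
    (hexp t) (hψ.timeDeriv.contMDiff t).continuous]

theorem isEnergyFunctional_energy (hp : h₀.IsPositive) :
    IsEnergyFunctional fun h : HermMetric n L => energy h₀ h := by
  intro h₁ h φ _ hφ hh hpos t
  have hφ' : SmoothFamily (n := n) φ := hφ
  -- The path is given relative to `h₁` but the energy is based at `h₀`. The correction is
  -- independent of time, so the velocity is unchanged.
  have hψ : SmoothFamily (n := n) fun t x => φ t x + relLog h₁ h₀ x :=
    hφ'.add (smoothFamily_const (contMDiff_relLog h₁ h₀))
  refine (hasDerivAt_energy hp hψ (fun t x v => ?_) hpos t).congr_deriv ?_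
  · rw [hh, exp_relLog h₁ h₀ x v, Real.exp_add]
    ring
  · simp only [timeDeriv, deriv_add_const]

end Energy

/-! ### The sign of the second variation. -/

section SecondVariation

open MeasureTheory Topology

variable {n : ℕ} {X : Type*} [TopologicalSpace X] [ChartedSpace (Fin n → ℂ) X]
  {L : X → Type*} [TopologicalSpace (Bundle.TotalSpace ℂ L)]
  [∀ x, AddCommGroup (L x)] [∀ x, Module ℂ (L x)] [∀ x, TopologicalSpace (L x)]
  [FiberBundle ℂ L] [VectorBundle ℂ ℂ L]
  [IsManifold 𝓘(ℂ, Fin n → ℂ) ω X] [ContMDiffVectorBundle ω ℂ L 𝓘(ℂ, Fin n → ℂ)]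

variable [MeasurableSpace X] [CompactSpace X] [T2Space X] [BorelSpace X]

/-- The squared norm of `∂u` with respect to `N`, times `det N / det A`. -/
def gradRatio (A N : Matrix (Fin n) (Fin n) ℂ) (u : X → ℝ) (x : X) : ℝ :=
  (∑ k, ∑ j, N.adjugate k j *
    dz j (fun z : Fin n → ℂ => (loc u x z : ℂ)) (chartAt (Fin n → ℂ) x x) *
    dzbar k (fun z : Fin n → ℂ => (loc u x z : ℂ)) (chartAt (Fin n → ℂ) x x)).re / A.det.re

/-- Leibniz rule for `∂∂̄(u²)`. Once the left side is known to integrate to zero, it yields `-∫ u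
tr(∂∂̄u) = ∫ |∂u|²` without further local integration by parts. -/
theorem trRatio_hessAt_sq {u : X → ℝ} (hu : ContMDiff 𝓘(ℝ, Fin n → ℂ) 𝓘(ℝ, ℝ) ∞ u)
    (A N : Matrix (Fin n) (Fin n) ℂ) (x : X) :
    trRatio A N (hessAt n (fun x => u x * u x) x) =
      2 * (u x * trRatio A N (hessAt n u x)) + 2 * gradRatio A N u x := by
  have hl := contDiffAt_loc hu (mem_chart_source (Fin n → ℂ) x)
  have h1 : ((loc u x (chartAt (Fin n → ℂ) x x) : ℝ) : ℂ) = u x := by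
    rw [loc, chart_symm_chart (mem_chart_source _ x)]
  have h2 : ∀ j k, hessAt n (fun x => u x * u x) x j k = 2 * (u x * hessAt n u x j k) +
      2 * (dz j (fun z : Fin n → ℂ => (loc u x z : ℂ)) (chartAt (Fin n → ℂ) x x) *
        dzbar k (fun z : Fin n → ℂ => (loc u x z : ℂ)) (chartAt (Fin n → ℂ) x x)) := fun j k => by
    have := hess_mul (j := j) (k := k) hl hl
    rw [h1] at this
    have e : (fun z : Fin n → ℂ => (loc (fun x => u x * u x) x z : ℂ)) =
        fun z : Fin n → ℂ => (loc u x z : ℂ) * (loc u x z : ℂ) := by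
      ext z
      simp only [loc, Complex.ofReal_mul]
    rw [hessAt, e, this]
    simp only [hessAt]
    ring
  have h3 : (N.adjugate * hessAt n (fun x => u x * u x) x).trace =
      ((2 * u x : ℝ) : ℂ) * (N.adjugate * hessAt n u x).trace + ((2 : ℝ) : ℂ) *
      ∑ k, ∑ j, N.adjugate k j * dz j (fun z : Fin n → ℂ => (loc u x z : ℂ)) (chartAt (Fin n → ℂ) x x) *
        dzbar k (fun z : Fin n → ℂ => (loc u x z : ℂ)) (chartAt (Fin n → ℂ) x x) := by
    simp only [Matrix.trace, Matrix.diag, Matrix.mul_apply, h2, Finset.mul_sum,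
      ← Finset.sum_add_distrib]
    refine Finset.sum_congr rfl fun k _ => Finset.sum_congr rfl fun j _ => ?_
    push_cast
    ring
  rw [trRatio, h3, Complex.add_re, Complex.re_ofReal_mul, Complex.re_ofReal_mul, trRatio,
    gradRatio]
  ring

/-- The first variation of the energy is antitone along a path as soon as the path satisfies
the pointwise inequality expressing that it is a subgeodesic. -/
theorem antitone_integral_timeDeriv {h : HermMetric n L} (hp : h.IsPositive) {φ : ℝ → X → ℝ}
    (hφ : SmoothFamily (n := n) φ)
    (hle : ∀ t x, timeDeriv (timeDeriv φ) t x *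
        maRatio (h.curvAt x) (h.curvAt x - ((1 : ℝ) : ℂ) • hessAt n (φ t) x) +
      gradRatio (h.curvAt x) (h.curvAt x - ((1 : ℝ) : ℂ) • hessAt n (φ t) x)
        (timeDeriv φ t) x ≤ 0) :
    Antitone fun t => ∫ x, timeDeriv φ t x *
      maRatio (h.curvAt x) (h.curvAt x - ((1 : ℝ) : ℂ) • hessAt n (φ t) x) ∂h.measure := by
  have hd := fun t => hasDerivAt_integral_mul_maRatio hp hφ hφ.timeDeriv 1 t
  refine antitone_of_deriv_nonpos (fun t => (hd t).differentiableAt) fun t => ?_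
  rw [(hd t).deriv]
  have hu := hφ.timeDeriv.contMDiff t
  have hc1 := (hφ.timeDeriv.timeDeriv.contMDiff t).continuous.fun_mul
    (hp.continuous_maRatio_const (hφ.contMDiff t) 1)
  have hc2 := hu.continuous.fun_mul (hp.continuous_trRatio_const (hφ.contMDiff t) hu 1)
  have hsq : ContMDiff 𝓘(ℝ, Fin n → ℂ) 𝓘(ℝ, ℝ) ∞
      fun x => timeDeriv φ t x * timeDeriv φ t x := hu.mul hu
  have hc3 := hp.continuous_trRatio_const (hφ.contMDiff t) hsq 1
  -- Self-adjointness tested on the constant `1`, whose Hessian vanishes. Half of this zero integral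
  -- is then added to the derivative in order to replace `-u tr(∂∂̄u)` by the gradient term.
  have h0 : ∫ x, trRatio (h.curvAt x) (h.curvAt x - ((1 : ℝ) : ℂ) • hessAt n (φ t) x)
      (hessAt n (fun x => timeDeriv φ t x * timeDeriv φ t x) x) ∂h.measure = 0 := by
    have := integral_mul_trRatio_symm hp (hφ.contMDiff t) (contMDiff_const (c := (1 : ℝ))) hsq 1
    simpa only [one_mul, hessAt_const, trRatio_zero, mul_zero, integral_zero] using this
  have hi1 := integrable_of_continuous h (hc1.fun_sub (continuous_const (y := (1 : ℝ)) |>.fun_mul hc2))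
  have hi3 := (integrable_of_continuous h hc3).const_mul (1 / 2 : ℝ)
  have h1 := integral_add hi1 hi3
  rw [integral_const_mul, h0, mul_zero, add_zero] at h1
  refine h1.symm.trans_le (integral_nonpos fun x => ?_)
  have := hle t x
  simp only [Pi.zero_apply, trRatio_hessAt_sq hu]
  linarith

end SecondVariation

/-! ### Linear algebra of the Fubini-Study form -/

section FubiniStudyMatrix

variable {n : ℕ} {ι : Type*} [Fintype ι]

/-- A bound for the dual norm of `c`, multiplied by `det N` so that no inverse occurs. Testing the
hypothesis on `ξ = adj(N) c`, with `p = ⟨ξ, c⟩`, gives `|p|² ≤ det N · Re p · d`; one factor `Re p`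
cancels. -/
theorem re_star_dotProduct_adjugate_le {N : Matrix (Fin n) (Fin n) ℂ} (hdet : 0 < N.det.re)
    (him : N.det.im = 0) {c : Fin n → ℂ} {d : ℝ} (hd : 0 ≤ d)
    (h : ∀ ξ : Fin n → ℂ, ‖star ξ ⬝ᵥ c‖ ^ 2 ≤ (star ξ ⬝ᵥ N.mulVec ξ).re * d) :
    (star c ⬝ᵥ N.adjugate.mulVec c).re ≤ d * N.det.re := by
  have h1 := h (N.adjugate.mulVec c)
  rw [Matrix.mulVec_mulVec, Matrix.mul_adjugate, Matrix.smul_mulVec, Matrix.one_mulVec,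
    dotProduct_smul] at h1
  have hN : N.det = (N.det.re : ℂ) := Complex.ext rfl (by simpa using him)
  rw [hN, smul_eq_mul, Complex.re_ofReal_mul] at h1
  have h2 : (star c ⬝ᵥ N.adjugate.mulVec c).re = (star (N.adjugate.mulVec c) ⬝ᵥ c).re := by
    rw [Matrix.star_dotProduct, dotProduct_comm]
    exact Complex.conj_re _
  rw [h2]
  generalize star (N.adjugate.mulVec c) ⬝ᵥ c = p at h1
  have h3 : p.re ^ 2 ≤ ‖p‖ ^ 2 := by
    rw [← sq_abs]
    exact pow_le_pow_left₀ (abs_nonneg _) (Complex.abs_re_le_norm p) 2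
  by_contra! hlt
  have h4 : 0 < p.re := (mul_nonneg hd hdet.le).trans_lt hlt
  nlinarith [mul_lt_mul_of_pos_right hlt h4]

/-- The Hermitian matrix `∂∂̄ log ∑ |f_α|²` in terms of the values `a_α` of the `f_α` and
of their gradients `b_α`. -/
def fsMatrix (a : ι → ℂ) (b : ι → Fin n → ℂ) : Matrix (Fin n) (Fin n) ℂ :=
  Matrix.of fun j k => (∑ α, b α j * conj (b α k)) / (∑ α, ‖a α‖ ^ 2 : ℝ) -
    (∑ α, b α j * conj (a α)) * (∑ α, a α * conj (b α k)) / (∑ α, ‖a α‖ ^ 2 : ℝ) ^ 2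

/-- The component orthogonal to `a` of the derivative in the direction `star ξ`. -/
def normalPart (a : ι → ℂ) (b : ι → Fin n → ℂ) (ξ : Fin n → ℂ) (α : ι) : ℂ :=
  star ξ ⬝ᵥ b α - (∑ β, (star ξ ⬝ᵥ b β) * conj (a β)) / (∑ β, ‖a β‖ ^ 2 : ℝ) * a α

variable {a : ι → ℂ} {b : ι → Fin n → ℂ}

theorem isHermitian_fsMatrix : (fsMatrix a b).IsHermitian := by
  ext j k
  simp only [Matrix.conjTranspose_apply, fsMatrix, Matrix.of_apply, star_sub, star_div₀, star_sum,
    star_mul', star_pow, Complex.star_def, Complex.conj_conj, Complex.conj_ofReal]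
  congr 2
  · exact Finset.sum_congr rfl fun α _ => mul_comm _ _
  · rw [mul_comm]
    congr 1 <;> exact Finset.sum_congr rfl fun α _ => mul_comm _ _

/-- Pythagoras: subtracting the projection onto `a` from the derivative removes exactly the second
term of `fsMatrix`. Both the positivity of the curvature and the gradient bound rest on this
identity. -/
theorem fsMatrix_form (h0 : 0 < ∑ α, ‖a α‖ ^ 2) (ξ : Fin n → ℂ) :
    star ξ ⬝ᵥ (fsMatrix a b).mulVec ξ =
      (((∑ α, ‖normalPart a b ξ α‖ ^ 2) / ∑ α, ‖a α‖ ^ 2 : ℝ) : ℂ) := by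
  have hB : ∀ α, star (star ξ ⬝ᵥ b α) = ∑ k, conj (b α k) * ξ k := fun α => by
    simp only [dotProduct, star_sum, star_mul', Pi.star_apply, star_star]
    exact Finset.sum_congr rfl fun k _ => mul_comm _ _
  have hB' : ∀ α, star ξ ⬝ᵥ b α = ∑ j, conj (ξ j) * b α j := fun α => rfl
  have hS : ((∑ α, ‖a α‖ ^ 2 : ℝ) : ℂ) = ∑ α, a α * conj (a α) := by
    push_cast
    exact Finset.sum_congr rfl fun α _ => (Complex.mul_conj' _).symm
  have h1 : star ξ ⬝ᵥ (fsMatrix a b).mulVec ξ =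
      (∑ α, (star ξ ⬝ᵥ b α) * conj (star ξ ⬝ᵥ b α)) / (∑ α, ‖a α‖ ^ 2 : ℝ) -
        (∑ α, (star ξ ⬝ᵥ b α) * conj (a α)) * (∑ α, a α * conj (star ξ ⬝ᵥ b α)) /
          (∑ α, ‖a α‖ ^ 2 : ℝ) ^ 2 := by
    have e1 : ∑ α, (star ξ ⬝ᵥ b α) * conj (star ξ ⬝ᵥ b α) =
        ∑ j, ∑ k, conj (ξ j) * (∑ α, b α j * conj (b α k)) * ξ k := by
      simp only [starRingEnd_apply, hB]
      simp only [hB', Finset.mul_sum, Finset.sum_mul]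
      conv_rhs => rw [Finset.sum_comm]
      rw [Finset.sum_comm]
      refine Finset.sum_congr rfl fun j _ => ?_
      rw [Finset.sum_comm]
      refine Finset.sum_congr rfl fun k _ => Finset.sum_congr rfl fun α _ => ?_
      simp only [starRingEnd_apply]
      ring
    have e2 : (∑ α, (star ξ ⬝ᵥ b α) * conj (a α)) * (∑ α, a α * conj (star ξ ⬝ᵥ b α)) =
        ∑ j, ∑ k, conj (ξ j) * ((∑ α, b α j * conj (a α)) * (∑ α, a α * conj (b α k))) * ξ k := by
      have e3 : ∑ α, (star ξ ⬝ᵥ b α) * conj (a α) =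
          ∑ j, conj (ξ j) * ∑ α, b α j * conj (a α) := by
        simp only [hB', Finset.mul_sum, Finset.sum_mul]
        rw [Finset.sum_comm]
        exact Finset.sum_congr rfl fun j _ => Finset.sum_congr rfl fun α _ => mul_assoc _ _ _
      have e4 : ∑ α, a α * conj (star ξ ⬝ᵥ b α) = ∑ k, (∑ α, a α * conj (b α k)) * ξ k := by
        simp only [starRingEnd_apply, hB]
        simp only [Finset.mul_sum, Finset.sum_mul]
        rw [Finset.sum_comm]
        exact Finset.sum_congr rfl fun j _ => Finset.sum_congr rfl fun α _ =>
          (mul_assoc _ _ _).symm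
      rw [e3, e4, Finset.sum_mul_sum]
      refine Finset.sum_congr rfl fun j _ => Finset.sum_congr rfl fun k _ => ?_
      ring
    rw [e1, e2, Finset.sum_div, Finset.sum_div, ← Finset.sum_sub_distrib]
    refine Finset.sum_congr rfl fun j _ => ?_
    rw [Matrix.mulVec, dotProduct, Finset.mul_sum, Finset.sum_div, Finset.sum_div,
      ← Finset.sum_sub_distrib]
    refine Finset.sum_congr rfl fun k _ => ?_
    simp only [fsMatrix, Matrix.of_apply, Pi.star_apply, starRingEnd_apply]
    ring
  have hS0 : ((∑ α, ‖a α‖ ^ 2 : ℝ) : ℂ) ≠ 0 := Complex.ofReal_ne_zero.2 h0.ne'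
  rw [h1]
  push_cast
  simp only [← Complex.mul_conj', normalPart]
  set S : ℂ := ∑ α, a α * conj (a α) with hSdef
  rw [hS] at hS0 ⊢
  have hSc : conj S = S := by rw [← hS, Complex.conj_ofReal]
  set p := ∑ β, (star ξ ⬝ᵥ b β) * conj (a β) with hp
  have hpc : conj p = ∑ α, a α * conj (star ξ ⬝ᵥ b α) := by
    rw [hp, map_sum]
    exact Finset.sum_congr rfl fun α _ => by rw [map_mul, Complex.conj_conj, mul_comm]
  rw [← hpc]
  -- Expanded with free coefficients; the projection corresponds to `c = p / S` and `c' = conj p /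
  -- S`.
  have e : ∀ c c', ∑ α, (star ξ ⬝ᵥ b α - c * a α) * (conj (star ξ ⬝ᵥ b α) - c' * conj (a α)) =
      (∑ α, (star ξ ⬝ᵥ b α) * conj (star ξ ⬝ᵥ b α)) - c' * p - c * conj p + c * c' * S :=
    fun c c' => by
    rw [hpc, hp, hSdef]
    simp only [Finset.mul_sum, ← Finset.sum_sub_distrib, ← Finset.sum_add_distrib]
    refine Finset.sum_congr rfl fun α _ => ?_
    ring
  simp only [map_sub, map_mul, map_div₀, hSc]
  rw [e]
  field_simp
  ring

/-- The Cauchy-Schwarz inequality for a vector `e` orthogonal to `a`. -/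
theorem norm_sum_sq_le {e : ι → ℂ} (he : ∑ α, a α * conj (e α) = 0)
    (ξ : Fin n → ℂ) :
    ‖∑ α, (star ξ ⬝ᵥ b α) * conj (e α)‖ ^ 2 ≤
      (∑ α, ‖normalPart a b ξ α‖ ^ 2) * ∑ α, ‖e α‖ ^ 2 := by
  have h1 : ∑ α, (star ξ ⬝ᵥ b α) * conj (e α) = ∑ α, normalPart a b ξ α * conj (e α) := by
    simp only [normalPart, sub_mul, Finset.sum_sub_distrib, mul_assoc, ← Finset.mul_sum, he,
      mul_zero, sub_zero]
  rw [h1]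
  have h2 : ‖∑ α, normalPart a b ξ α * conj (e α)‖ ≤ ∑ α, ‖normalPart a b ξ α‖ * ‖e α‖ := by
    refine (norm_sum_le _ _).trans (Finset.sum_le_sum fun α _ => ?_)
    rw [norm_mul, Complex.norm_conj]
  exact (pow_le_pow_left₀ (norm_nonneg _) h2 2).trans
    (Finset.sum_mul_sq_le_sq_mul_sq _ _ _)

open scoped ComplexOrder in
/-- The inequality `|∂v|² ≤ Var` for the weighted mean `v = (∑ l_α |f_α|²) / ∑ |f_α|²`. -/
theorem re_adjugate_fsMatrix_le (h0 : 0 < ∑ α, ‖a α‖ ^ 2) (hN : (fsMatrix a b).PosDef)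
    {e : ι → ℂ} (he : ∑ α, a α * conj (e α) = 0) {c : Fin n → ℂ}
    (hc : ∀ j, c j = (∑ α, b α j * conj (e α)) / (∑ α, ‖a α‖ ^ 2 : ℝ)) :
    (∑ k, ∑ j, (fsMatrix a b).adjugate k j * c j * conj (c k)).re ≤
      ((∑ α, ‖e α‖ ^ 2) / ∑ α, ‖a α‖ ^ 2) * (fsMatrix a b).det.re := by
  have hdet := Complex.pos_iff.1 hN.det_pos
  have h1 : ∑ k, ∑ j, (fsMatrix a b).adjugate k j * c j * conj (c k) =
      star c ⬝ᵥ (fsMatrix a b).adjugate.mulVec c := by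
    simp only [dotProduct, Matrix.mulVec, Finset.mul_sum, Pi.star_apply, starRingEnd_apply]
    exact Finset.sum_congr rfl fun k _ => Finset.sum_congr rfl fun j _ => mul_comm _ _
  rw [h1]
  refine re_star_dotProduct_adjugate_le hdet.1 hdet.2.symm (by positivity) fun ξ => ?_
  have h2 : star ξ ⬝ᵥ c = (∑ α, (star ξ ⬝ᵥ b α) * conj (e α)) / (∑ α, ‖a α‖ ^ 2 : ℝ) := by
    simp only [dotProduct, hc, Finset.sum_mul, Finset.sum_div, Finset.mul_sum]
    rw [Finset.sum_comm]
    exact Finset.sum_congr rfl fun j _ => Finset.sum_congr rfl fun α _ => by ring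
  rw [h2, fsMatrix_form h0, Complex.ofReal_re, norm_div, div_pow, Complex.norm_real,
    Real.norm_of_nonneg h0.le, div_mul_div_comm, ← pow_two]
  exact div_le_div_of_nonneg_right (norm_sum_sq_le he ξ) (by positivity)

end FubiniStudyMatrix

/-! ### The Fubini-Study metrics -/

section FubiniStudyMetric

open Filter Topology

variable {n : ℕ} {X : Type*} [TopologicalSpace X] [ChartedSpace (Fin n → ℂ) X]
  {L : X → Type*} [TopologicalSpace (Bundle.TotalSpace ℂ L)]
  [∀ x, AddCommGroup (L x)] [∀ x, Module ℂ (L x)] [∀ x, TopologicalSpace (L x)]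
  [FiberBundle ℂ L] [VectorBundle ℂ ℂ L]
  [IsManifold 𝓘(ℂ, Fin n → ℂ) ω X] [ContMDiffVectorBundle ω ℂ L 𝓘(ℂ, Fin n → ℂ)]
  {E : Submodule ℂ (Cₛ^ω⟮𝓘(ℂ, Fin n → ℂ); ℂ, L⟯)}

theorem contDiffAt_localCoord (s : Cₛ^ω⟮𝓘(ℂ, Fin n → ℂ); ℂ, L⟯) {x₀ x : X}
    (hx : x ∈ chartDomain n L x₀) :
    ContDiffAt ℂ ω (fun z => localCoord x₀ ((chartAt (Fin n → ℂ) x₀).symm z) s)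
      (chartAt (Fin n → ℂ) x₀ x) := by
  have h1 : ContMDiffAt 𝓘(ℂ, Fin n → ℂ) 𝓘(ℂ, Fin n → ℂ) ω (chartAt (Fin n → ℂ) x₀).symm
      (chartAt (Fin n → ℂ) x₀ x) :=
    contMDiffOn_chart_symm.contMDiffAt ((chartAt (Fin n → ℂ) x₀).open_target.mem_nhds
      ((chartAt (Fin n → ℂ) x₀).map_source hx.1))
  have h2 := ((trivializationAt ℂ L x₀).contMDiffOn_section_baseSet_iff).1
    (s.contMDiff.contMDiffOn)
  have h3 : ContMDiffAt 𝓘(ℂ, Fin n → ℂ) 𝓘(ℂ, ℂ) ω (fun x => localCoord x₀ x s)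
      ((chartAt (Fin n → ℂ) x₀).symm (chartAt (Fin n → ℂ) x₀ x)) := by
    rw [chart_symm_chart hx.1]
    exact h2.contMDiffAt ((trivializationAt ℂ L x₀).open_baseSet.mem_nhds hx.2)
  exact (h3.comp _ h1).contDiffAt

theorem HermMetric.normSq_section (h : HermMetric n L) (s : Cₛ^ω⟮𝓘(ℂ, Fin n → ℂ); ℂ, L⟯)
    {x₀ x : X} (hx : x ∈ (trivializationAt ℂ L x₀).baseSet) :
    h.normSq x (s x) = ‖localCoord x₀ x s‖ ^ 2 * h.normSq x (frame L x₀ x) := by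
  conv_lhs => rw [localCoord_smul_frame x₀ x hx (s x), h.normSq_smul]
  rfl

theorem HermMetric.contMDiff_normSq_section (h : HermMetric n L)
    (s : Cₛ^ω⟮𝓘(ℂ, Fin n → ℂ); ℂ, L⟯) :
    ContMDiff 𝓘(ℝ, Fin n → ℂ) 𝓘(ℝ, ℝ) ∞ fun x => h.normSq x (s x) := by
  intro y
  have hB := (trivializationAt ℂ L y).open_baseSet
  have hy := FiberBundle.mem_baseSet_trivializationAt' (F := ℂ) (E := L) y
  have h1 := contMDiffOn_real (((trivializationAt ℂ L y).contMDiffOn_section_baseSet_iff).1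
    (s.contMDiff.contMDiffOn))
  have h2 := ((contDiff_norm_sq ℝ (E := ℂ)).contMDiff.comp_contMDiffOn h1).mul (h.smooth y)
  exact (h2.congr fun x hx => h.normSq_section s hx).contMDiffAt (hB.mem_nhds hy)

variable [FiniteDimensional ℂ E] (hE : GivesProjectiveEmbedding E)
  {H : InnerProductSpace.Core ℂ E} {ι : Type*} [Fintype ι] [DecidableEq ι]
  {u : Module.Basis ι ℂ E}

theorem FS_normSq_frame (hu : IsONB H u) {x₀ x : X}
    (hx : x ∈ (trivializationAt ℂ L x₀).baseSet) :
    (FS hE H).normSq x (frame L x₀ x) =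
      (∑ α, ‖localCoord x₀ x (u α : Cₛ^ω⟮𝓘(ℂ, Fin n → ℂ); ℂ, L⟯)‖ ^ 2)⁻¹ := by
  have h1 := sum_FS_normSq hE H u hu x
  simp only [(FS hE H).normSq_section _ hx, ← Finset.sum_mul] at h1
  exact eq_inv_of_mul_eq_one_right h1

theorem sum_localCoord_pos (hE : GivesProjectiveEmbedding E) (hu : IsONB H u) {x₀ x : X}
    (hx : x ∈ (trivializationAt ℂ L x₀).baseSet) :
    0 < ∑ α, ‖localCoord x₀ x (u α : Cₛ^ω⟮𝓘(ℂ, Fin n → ℂ); ℂ, L⟯)‖ ^ 2 := by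
  have h := (FS hE H).normSq_frame_pos hx
  rwa [FS_normSq_frame hE hu hx, inv_pos] at h

/-- The gradient at `x` of a section, in the preferred coordinates around `x`. -/
def coordGrad (x : X) (s : Cₛ^ω⟮𝓘(ℂ, Fin n → ℂ); ℂ, L⟯) (j : Fin n) : ℂ :=
  fderiv ℂ (fun z => localCoord x ((chartAt (Fin n → ℂ) x).symm z) s) (chartAt (Fin n → ℂ) x x)
    (Pi.single j 1)

theorem curvAt_FS (hu : IsONB H u) (x : X) :
    (FS hE H).curvAt x = fsMatrix (fun α => evalForm E x (u α)) (fun α => coordGrad x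
      (u α : Cₛ^ω⟮𝓘(ℂ, Fin n → ℂ); ℂ, L⟯)) := by
  have hx := mem_chartDomain (n := n) (L := L) x
  have h1 : (FS hE H).logWeight x =ᶠ[𝓝 (chartAt (Fin n → ℂ) x x)] fun z =>
      ((-1 : ℝ) : ℂ) * (Real.log (∑ α, ‖localCoord x ((chartAt (Fin n → ℂ) x).symm z)
        (u α : Cₛ^ω⟮𝓘(ℂ, Fin n → ℂ); ℂ, L⟯)‖ ^ 2) : ℂ) := by
    filter_upwards [(isOpen_coordDomain x).mem_nhds (chart_mem_coordDomain hx)] with z hz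
    rw [HermMetric.logWeight, FS_normSq_frame hE hu hz.2, Real.log_inv, ← Complex.ofReal_mul,
      neg_one_mul]
  have hf := fun α => contDiffAt_localCoord (u α : Cₛ^ω⟮𝓘(ℂ, Fin n → ℂ); ℂ, L⟯) hx
  have h0 : 0 < ∑ α, ‖localCoord x ((chartAt (Fin n → ℂ) x).symm (chartAt (Fin n → ℂ) x x))
      (u α : Cₛ^ω⟮𝓘(ℂ, Fin n → ℂ); ℂ, L⟯)‖ ^ 2 := by
    rw [chart_symm_chart hx.1]
    exact sum_localCoord_pos hE hu hx.2
  have hsm : ContDiffAt ℝ ∞ (fun z => (Real.log (∑ α, ‖localCoord x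
      ((chartAt (Fin n → ℂ) x).symm z) (u α : Cₛ^ω⟮𝓘(ℂ, Fin n → ℂ); ℂ, L⟯)‖ ^ 2) : ℂ))
      (chartAt (Fin n → ℂ) x x) :=
    contDiffAt_ofReal ((ContDiffAt.sum fun α _ =>
      (contDiffAt_real_of_complex (hf α)).norm_sq ℝ).log h0.ne')
  rw [HermMetric.curvAt, HermMetric.curvMatrix_eq, hess_congr h1, hess_const_mul _ hsm]
  ext j k
  have h2 := hess_log_sum_normSq hf h0 j k
  rw [chart_symm_chart hx.1] at h2
  rw [Matrix.neg_apply, Matrix.smul_apply, h2]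
  simp only [Complex.ofReal_neg, Complex.ofReal_one, neg_smul, one_smul, neg_neg]
  rfl

theorem localCoord_add {x₀ x : X} (hx : x ∈ (trivializationAt ℂ L x₀).baseSet)
    (s s' : Cₛ^ω⟮𝓘(ℂ, Fin n → ℂ); ℂ, L⟯) :
    localCoord x₀ x (s + s') = localCoord x₀ x s + localCoord x₀ x s' :=
  ((trivializationAt ℂ L x₀).linear ℂ hx).map_add _ _

theorem localCoord_smul {x₀ x : X} (hx : x ∈ (trivializationAt ℂ L x₀).baseSet) (c : ℂ)
    (s : Cₛ^ω⟮𝓘(ℂ, Fin n → ℂ); ℂ, L⟯) : localCoord x₀ x (c • s) = c * localCoord x₀ x s :=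
  ((trivializationAt ℂ L x₀).linear ℂ hx).map_smul _ _

theorem fderiv_localCoord_apply (s : Cₛ^ω⟮𝓘(ℂ, Fin n → ℂ); ℂ, L⟯) (x : X) (v : Fin n → ℂ) :
    fderiv ℂ (fun z => localCoord x ((chartAt (Fin n → ℂ) x).symm z) s)
      (chartAt (Fin n → ℂ) x x) v = v ⬝ᵥ coordGrad x s := by
  conv_lhs => rw [pi_eq_sum_univ' v, map_sum]
  simp only [map_smul, smul_eq_mul, dotProduct]
  refine Finset.sum_congr rfl fun j _ => ?_
  rw [coordGrad]

/-- Immersivity is a condition on all sections of `E`, whereas the vanishing of normal parts speaks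
only of a basis. The passage is by linearity, which `localCoord` has near `x`, over the base set of
the trivialization. -/
theorem fderiv_localCoord_eq {ι : Type*} (u : Module.Basis ι ℂ E) {x : X} {v : Fin n → ℂ} {c : ℂ}
    (h : ∀ α, fderiv ℂ (fun z => localCoord x ((chartAt (Fin n → ℂ) x).symm z)
      (u α : Cₛ^ω⟮𝓘(ℂ, Fin n → ℂ); ℂ, L⟯)) (chartAt (Fin n → ℂ) x x) v =
        c * evalForm E x (u α)) (s : E) :
    fderiv ℂ (fun z => localCoord x ((chartAt (Fin n → ℂ) x).symm z)
      (s : Cₛ^ω⟮𝓘(ℂ, Fin n → ℂ); ℂ, L⟯)) (chartAt (Fin n → ℂ) x x) v = c * evalForm E x s := by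
  have hx := mem_chartDomain (n := n) (L := L) x
  have hn := (isOpen_coordDomain x).mem_nhds (chart_mem_coordDomain hx)
  have hd := fun s : E => (contDiffAt_localCoord (s : Cₛ^ω⟮𝓘(ℂ, Fin n → ℂ); ℂ, L⟯)
    hx).differentiableAt (by simp)
  have hs : s ∈ Submodule.span ℂ (Set.range u) := u.mem_span s
  induction hs using Submodule.span_induction with
  | mem s hs =>
    obtain ⟨α, rfl⟩ := hs
    exact h α
  | zero =>
    have e : (fun z => localCoord x ((chartAt (Fin n → ℂ) x).symm z)
        ((0 : E) : Cₛ^ω⟮𝓘(ℂ, Fin n → ℂ); ℂ, L⟯)) =ᶠ[𝓝 (chartAt (Fin n → ℂ) x x)]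
          fun _ => 0 := by
      filter_upwards [hn] with z hz
      have := localCoord_smul hz.2 0 (0 : Cₛ^ω⟮𝓘(ℂ, Fin n → ℂ); ℂ, L⟯)
      rwa [zero_smul, zero_mul] at this
    rw [e.fderiv_eq, map_zero, mul_zero]
    simp
  | add s s' _ _ h1 h2 =>
    have e : (fun z => localCoord x ((chartAt (Fin n → ℂ) x).symm z)
        ((s + s' : E) : Cₛ^ω⟮𝓘(ℂ, Fin n → ℂ); ℂ, L⟯)) =ᶠ[𝓝 (chartAt (Fin n → ℂ) x x)]
        fun z => localCoord x ((chartAt (Fin n → ℂ) x).symm z)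
          (s : Cₛ^ω⟮𝓘(ℂ, Fin n → ℂ); ℂ, L⟯) + localCoord x ((chartAt (Fin n → ℂ) x).symm z)
          (s' : Cₛ^ω⟮𝓘(ℂ, Fin n → ℂ); ℂ, L⟯) := by
      filter_upwards [hn] with z hz
      exact localCoord_add hz.2 _ _
    rw [e.fderiv_eq, fderiv_fun_add (hd s) (hd s'), _root_.add_apply, h1, h2, map_add, mul_add]
  | smul k s _ h1 =>
    have e : (fun z => localCoord x ((chartAt (Fin n → ℂ) x).symm z)
        ((k • s : E) : Cₛ^ω⟮𝓘(ℂ, Fin n → ℂ); ℂ, L⟯)) =ᶠ[𝓝 (chartAt (Fin n → ℂ) x x)]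
        fun z => k * localCoord x ((chartAt (Fin n → ℂ) x).symm z)
          (s : Cₛ^ω⟮𝓘(ℂ, Fin n → ℂ); ℂ, L⟯) := by
      filter_upwards [hn] with z hz
      exact localCoord_smul hz.2 _ _
    rw [e.fderiv_eq, fderiv_const_mul (hd s), _root_.smul_apply, h1, map_smul]
    simp only [smul_eq_mul]
    ring

open scoped ComplexOrder in
/-- The metric `FS(H)` has positive curvature. -/
theorem isPositive_FS (H : InnerProductSpace.Core ℂ E) : (FS hE H).IsPositive := by
  obtain ⟨u, hu⟩ := exists_isONB H
  intro x
  have h0 := evalForm_sum_pos (hE.evalForm_ne_zero x) u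
  rw [← HermMetric.curvAt, curvAt_FS hE hu]
  refine Matrix.PosDef.of_dotProduct_mulVec_pos isHermitian_fsMatrix fun ξ hξ => ?_
  rw [fsMatrix_form h0]
  rw [Complex.zero_lt_real]
  refine div_pos (lt_of_le_of_ne (Finset.sum_nonneg fun _ _ => by positivity) fun h => hξ ?_) h0
  have h1 := fun α => (Finset.sum_eq_zero_iff_of_nonneg fun _ _ => by positivity).1 h.symm α
    (Finset.mem_univ α)
  have h2 : ∀ α, normalPart (fun α => evalForm E x (u α)) (fun α => coordGrad x
      (u α : Cₛ^ω⟮𝓘(ℂ, Fin n → ℂ); ℂ, L⟯)) ξ α = 0 := fun α => by simpa using h1 α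
  -- If all normal parts vanish, the derivative of the lift in the direction `star ξ` is a multiple
  -- of the lift, which immersivity excludes for `ξ ≠ 0`.
  simp only [normalPart, sub_eq_zero, ← fderiv_localCoord_apply] at h2
  rw [← star_eq_zero]
  exact hE.immersive x (star ξ) _ fun s => fderiv_localCoord_eq u h2 s

/-- The mean of the `l_α` with the weights `|u_α|²_{FS(H)}`. -/
def meanFS (u : Module.Basis ι ℂ E) (H : InnerProductSpace.Core ℂ E) (l : ι → ℝ) (x : X) : ℝ :=
  ∑ α, l α * (FS hE H).normSq x ((u α : Cₛ^ω⟮𝓘(ℂ, Fin n → ℂ); ℂ, L⟯) x)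

theorem contMDiff_meanFS (l : ι → ℝ) :
    ContMDiff 𝓘(ℝ, Fin n → ℂ) 𝓘(ℝ, ℝ) ∞ (meanFS hE u H l) :=
  contMDiff_finsetSum fun _ _ => contMDiff_const.mul ((FS hE H).contMDiff_normSq_section _)

theorem meanFS_mul_sum (hu : IsONB H u) (l : ι → ℝ) {x₀ x : X}
    (hx : x ∈ (trivializationAt ℂ L x₀).baseSet) :
    meanFS hE u H l x * ∑ α, ‖localCoord x₀ x (u α : Cₛ^ω⟮𝓘(ℂ, Fin n → ℂ); ℂ, L⟯)‖ ^ 2 =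
      ∑ α, l α * ‖localCoord x₀ x (u α : Cₛ^ω⟮𝓘(ℂ, Fin n → ℂ); ℂ, L⟯)‖ ^ 2 := by
  have h0 := sum_localCoord_pos hE hu hx
  simp only [meanFS, (FS hE H).normSq_section _ hx, FS_normSq_frame hE hu hx, ← mul_assoc,
    ← Finset.sum_mul]
  rw [mul_assoc, inv_mul_cancel₀ h0.ne', mul_one]

/-- Differentiate `m ∑ |f_α|² = ∑ l_α |f_α|²` instead of a quotient and solve for `∂_j m`. The
vector `(l_α - m) f_α` appears, to which Cauchy-Schwarz will be applied. -/
theorem dz_meanFS (hu : IsONB H u) (l : ι → ℝ) (x : X) (j : Fin n) :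
    dz j (fun z : Fin n → ℂ => (loc (meanFS hE u H l) x z : ℂ)) (chartAt (Fin n → ℂ) x x) =
      (∑ α, coordGrad x (u α : Cₛ^ω⟮𝓘(ℂ, Fin n → ℂ); ℂ, L⟯) j *
        conj (((l α - meanFS hE u H l x : ℝ) : ℂ) * evalForm E x (u α))) /
          (∑ α, ‖evalForm E x (u α)‖ ^ 2 : ℝ) := by
  have hx := mem_chartDomain (n := n) (L := L) x
  have hf := fun α => contDiffAt_localCoord (u α : Cₛ^ω⟮𝓘(ℂ, Fin n → ℂ); ℂ, L⟯) hx
  have hfd := fun α => (hf α).differentiableAt (by simp)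
  have h0 := evalForm_sum_pos (hE.evalForm_ne_zero x) u
  set z₀ := chartAt (Fin n → ℂ) x x with hz₀
  let f : ι → (Fin n → ℂ) → ℂ := fun α z => localCoord x ((chartAt (Fin n → ℂ) x).symm z)
    (u α : Cₛ^ω⟮𝓘(ℂ, Fin n → ℂ); ℂ, L⟯)
  have hsm : ∀ α, ContDiffAt ℝ ∞ (fun w => f α w * conj (f α w)) z₀ := fun α =>
    (contDiffAt_real_of_complex (hf α)).mul
      (Complex.conjCLE.contDiff.contDiffAt.comp z₀ (contDiffAt_real_of_complex (hf α)))
  have hF := contDiffAt_loc (contMDiff_meanFS hE (u := u) (H := H) l) hx.1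
  have hS := contDiffAt_sum_mul_conj hf
  have h1 : (fun z : Fin n → ℂ => (loc (meanFS hE u H l) x z : ℂ) * ∑ α, f α z * conj (f α z))
      =ᶠ[𝓝 z₀] fun z => ∑ α, (l α : ℂ) * (f α z * conj (f α z)) := by
    filter_upwards [(isOpen_coordDomain x).mem_nhds (chart_mem_coordDomain hx)] with z hz
    simp only [Complex.mul_conj']
    exact_mod_cast meanFS_mul_sum hE hu l hz.2
  have e1 : ∀ α, f α z₀ = evalForm E x (u α) := fun α => by
    simp only [f, hz₀, chart_symm_chart hx.1]
    rfl
  have hdz : ∀ α, dz j (fun z => f α z * conj (f α z)) z₀ =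
      coordGrad x (u α : Cₛ^ω⟮𝓘(ℂ, Fin n → ℂ); ℂ, L⟯) j * conj (evalForm E x (u α)) :=
    fun α => by
    rw [dz_mul_conj (hfd α) (hfd α), ← e1]
    rfl
  have h2 := wirt_congr (a := Pi.single j (1 : ℂ)) (b := Pi.single j Complex.I)
    (c := -Complex.I) h1
  rw [wirt_mul hF.diff hS.diff,
    wirt_sum (f := fun α z => f α z * conj (f α z)) fun α _ => (hsm α).diff,
    wirt_sum (f := fun α z => (l α : ℂ) * (f α z * conj (f α z)))
      fun α _ => (hsm α).diff.const_mul _] at h2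
  simp only [wirt_const_mul _ (hsm _).diff] at h2
  simp only [← dz_eq_wirt, hdz] at h2
  have e2 : loc (meanFS hE u H l) x z₀ = meanFS hE u H l x := by
    rw [loc, chart_symm_chart hx.1]
  have e3 : ∑ α, f α z₀ * conj (f α z₀) = ((∑ α, ‖evalForm E x (u α)‖ ^ 2 : ℝ) : ℂ) := by
    push_cast
    exact Finset.sum_congr rfl fun α _ => by rw [Complex.mul_conj', e1]
  rw [e3, e2] at h2
  rw [eq_div_iff (Complex.ofReal_ne_zero.2 h0.ne'), eq_sub_of_add_eq h2, Finset.mul_sum,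
    ← Finset.sum_sub_distrib]
  refine Finset.sum_congr rfl fun α _ => ?_
  rw [map_mul, Complex.conj_ofReal, Complex.ofReal_sub]
  ring

/-- The gradient of the mean is bounded by the variance. -/
theorem gradRatio_meanFS_le (hu : IsONB H u) (l : ι → ℝ) (x : X)
    {A : Matrix (Fin n) (Fin n) ℂ} (hA : 0 < A.det.re) :
    gradRatio A ((FS hE H).curvAt x) (meanFS hE u H l) x ≤
      (meanFS hE u H (fun α => l α ^ 2) x - meanFS hE u H l x ^ 2) *
        maRatio A ((FS hE H).curvAt x) := by
  have hx := mem_chartDomain (n := n) (L := L) x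
  have h0 := evalForm_sum_pos (hE.evalForm_ne_zero x) u
  have hN := (isPositive_FS hE H) x
  rw [← HermMetric.curvAt] at hN
  set m := meanFS hE u H l x with hm
  have hm1 : m * ∑ α, ‖evalForm E x (u α)‖ ^ 2 = ∑ α, l α * ‖evalForm E x (u α)‖ ^ 2 :=
    meanFS_mul_sum hE hu l hx.2
  have hm2 : meanFS hE u H (fun α => l α ^ 2) x * ∑ α, ‖evalForm E x (u α)‖ ^ 2 =
      ∑ α, l α ^ 2 * ‖evalForm E x (u α)‖ ^ 2 := meanFS_mul_sum hE hu _ hx.2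
  -- Orthogonality to the lift says that deviations from the mean have mean zero.
  have he : ∑ α, evalForm E x (u α) *
      conj (((l α - m : ℝ) : ℂ) * evalForm E x (u α)) = 0 := by
    have e : ∀ α, evalForm E x (u α) * conj (((l α - m : ℝ) : ℂ) * evalForm E x (u α)) =
        ((l α * ‖evalForm E x (u α)‖ ^ 2 - m * ‖evalForm E x (u α)‖ ^ 2 : ℝ) : ℂ) := fun α => by
      rw [map_mul, Complex.conj_ofReal, mul_left_comm, Complex.mul_conj', ← sub_mul]
      push_cast
      rfl
    simp only [e, ← Complex.ofReal_sum, Finset.sum_sub_distrib, ← Finset.mul_sum, hm1, sub_self,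
      Complex.ofReal_zero]
  have hF := (contDiffAt_loc (contMDiff_meanFS hE (u := u) (H := H) l) hx.1).diff
  have hbar : ∀ k, dzbar k (fun z : Fin n → ℂ => (loc (meanFS hE u H l) x z : ℂ))
      (chartAt (Fin n → ℂ) x x) = conj (dz k (fun z : Fin n → ℂ =>
        (loc (meanFS hE u H l) x z : ℂ)) (chartAt (Fin n → ℂ) x x)) := fun k => by
    rw [← dzbar_conj hF]
    simp only [Complex.conj_ofReal]
  rw [curvAt_FS hE hu] at hN
  have key := re_adjugate_fsMatrix_le h0 hN he (dz_meanFS hE hu l x)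
  rw [curvAt_FS hE hu, gradRatio, maRatio, ← mul_div_assoc]
  refine div_le_div_of_nonneg_right ?_ hA.le
  simp only [hbar]
  refine key.trans_eq ?_
  congr 1
  rw [div_eq_iff h0.ne']
  -- Expanding the square turns the normalized length of `e` into the second moment minus the
  -- squared mean.
  have e : ∀ α, ‖((l α - m : ℝ) : ℂ) * evalForm E x (u α)‖ ^ 2 =
      l α ^ 2 * ‖evalForm E x (u α)‖ ^ 2 - 2 * m * (l α * ‖evalForm E x (u α)‖ ^ 2) +
        m ^ 2 * ‖evalForm E x (u α)‖ ^ 2 := fun α => by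
    rw [norm_mul, mul_pow, Complex.norm_real, Real.norm_eq_abs, sq_abs]
    ring
  simp only [e, Finset.sum_add_distrib, Finset.sum_sub_distrib, ← Finset.mul_sum, ← hm1, ← hm2]
  ring

end FubiniStudyMetric

/-! ### Hermitian metrics on a finite-dimensional space -/

section HermitianForms

variable {E : Type*} [AddCommGroup E] [Module ℂ E] {ι : Type*} [Fintype ι]

theorem core_smul_right (H : InnerProductSpace.Core ℂ E) (x y : E) (c : ℂ) :
    H.inner x (c • y) = c * H.inner x y := by
  rw [← H.conj_inner_symm, H.smul_left, map_mul, Complex.conj_conj, H.conj_inner_symm]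

theorem core_inner_eq_sum (H : InnerProductSpace.Core ℂ E) (s : Module.Basis ι ℂ E) (x y : E) :
    H.inner x y = ∑ i, ∑ j, conj (s.repr x i) * s.repr y j * H.inner (s i) (s j) := by
  let : NormedAddCommGroup E := @InnerProductSpace.Core.toNormedAddCommGroup ℂ E _ _ _ H
  let : InnerProductSpace ℂ E := InnerProductSpace.ofCore H.toCore
  change inner ℂ x y = ∑ i, ∑ j, conj (s.repr x i) * s.repr y j * inner ℂ (s i) (s j)
  conv_lhs => rw [← s.sum_repr x, ← s.sum_repr y, sum_inner]
  refine Finset.sum_congr rfl fun i _ => ?_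
  rw [inner_sum]
  refine Finset.sum_congr rfl fun j _ => ?_
  rw [inner_smul_left, inner_smul_right, mul_assoc]

theorem core_ext_basis {H H' : InnerProductSpace.Core ℂ E} (s : Module.Basis ι ℂ E)
    (h : ∀ i j, H.inner (s i) (s j) = H'.inner (s i) (s j)) : H = H' := by
  have h1 : H.inner = H'.inner := by
    ext x y
    rw [core_inner_eq_sum H s, core_inner_eq_sum H' s]
    simp only [h]
  obtain ⟨⟨⟨i⟩, a, b, c, d⟩, e⟩ := H
  obtain ⟨⟨⟨i'⟩, a', b', c', d'⟩, e'⟩ := H'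
  obtain rfl : i = i' := h1
  rfl

/-- The Hermitian metric which is diagonal with respect to a given basis. -/
@[reducible] def diagCore [DecidableEq ι] (s : Module.Basis ι ℂ E) (w : ι → ℝ) (hw : ∀ i, 0 < w i) :
    InnerProductSpace.Core ℂ E where
  inner x y := ∑ i, (w i : ℂ) * (conj (s.repr x i) * s.repr y i)
  conj_inner_symm x y := by
    simp only [map_sum, map_mul, Complex.conj_ofReal, Complex.conj_conj]
    exact Finset.sum_congr rfl fun i _ => by ring
  re_inner_nonneg x := by
    have : ∑ i, (w i : ℂ) * (conj (s.repr x i) * s.repr x i) =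
        ((∑ i, w i * ‖s.repr x i‖ ^ 2 : ℝ) : ℂ) := by
      push_cast
      exact Finset.sum_congr rfl fun i _ => by rw [Complex.conj_mul']
    rw [this]
    exact Finset.sum_nonneg fun i _ => mul_nonneg (hw i).le (by positivity)
  add_left x y z := by
    simp only [map_add, Finsupp.add_apply, ← Finset.sum_add_distrib]
    exact Finset.sum_congr rfl fun i _ => by ring
  smul_left x y r := by
    simp only [map_smul, Finsupp.smul_apply, smul_eq_mul, map_mul, Finset.mul_sum]
    exact Finset.sum_congr rfl fun i _ => by ring
  definite x h := by
    have : ∑ i, (w i : ℂ) * (conj (s.repr x i) * s.repr x i) =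
        ((∑ i, w i * ‖s.repr x i‖ ^ 2 : ℝ) : ℂ) := by
      push_cast
      exact Finset.sum_congr rfl fun i _ => by rw [Complex.conj_mul']
    have h1 := (Finset.sum_eq_zero_iff_of_nonneg fun i _ =>
      mul_nonneg (hw i).le (sq_nonneg ‖s.repr x i‖)).1 (Complex.ofReal_eq_zero.1 (this ▸ h))
    refine s.ext_elem fun i => ?_
    have h2 := (mul_eq_zero.1 (h1 i (Finset.mem_univ i))).resolve_left (hw i).ne'
    simpa using h2

theorem diagCore_inner [DecidableEq ι] (s : Module.Basis ι ℂ E) (w : ι → ℝ) (hw : ∀ i, 0 < w i)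
    (i j : ι) : (diagCore s w hw).inner (s i) (s j) = if i = j then (w i : ℂ) else 0 := by
  change ∑ k, (w k : ℂ) * (conj (s.repr (s i) k) * s.repr (s j) k) = _
  rw [Finset.sum_eq_single i]
  · rw [s.repr_self, s.repr_self, Finsupp.single_eq_same, map_one, one_mul, Finsupp.single_apply]
    simp only [eq_comm, mul_ite, mul_one, mul_zero]
  · intro k _ hk
    rw [s.repr_self, Finsupp.single_eq_of_ne hk, map_zero, zero_mul, mul_zero]
  · exact fun h => absurd (Finset.mem_univ i) h

variable [FiniteDimensional ℂ E]

/-- Simultaneous diagonalization of two Hermitian metrics. -/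
theorem exists_isONB_diagonal (H₀ H₁ : InnerProductSpace.Core ℂ E) :
    ∃ (s : Module.Basis (Fin (Module.finrank ℂ E)) ℂ E) (w : Fin (Module.finrank ℂ E) → ℝ),
      (∀ i, 0 < w i) ∧ IsONB H₀ s ∧
        ∀ i j, H₁.inner (s i) (s j) = if i = j then (w i : ℂ) else 0 := by
  let : NormedAddCommGroup E := @InnerProductSpace.Core.toNormedAddCommGroup ℂ E _ _ _ H₀
  let : InnerProductSpace ℂ E := InnerProductSpace.ofCore H₀.toCore
  let e := stdOrthonormalBasis ℂ E
  -- The endomorphism representing `H₁` with respect to `H₀`. It is symmetric, and its eigenbasis is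
  -- orthonormal for `H₀` and orthogonal for `H₁`.
  let T : E →ₗ[ℂ] E :=
    { toFun := fun x => ∑ i, H₁.inner (e i) x • e i
      map_add' := fun x y => by
        have h : ∀ z, H₁.inner z (x + y) = H₁.inner z x + H₁.inner z y := fun z => by
          rw [← H₁.conj_inner_symm, H₁.add_left, map_add, H₁.conj_inner_symm, H₁.conj_inner_symm]
        simp only [h, add_smul, Finset.sum_add_distrib]
      map_smul' := fun c x => by
        simp only [core_smul_right, Finset.smul_sum, smul_smul, RingHom.id_apply] }
  have hT : ∀ x y, inner ℂ y (T x) = H₁.inner y x := fun x y => by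
    have h1 := core_inner_eq_sum H₁ e.toBasis y x
    have h2 : ∀ i, H₁.inner (e i) x = ∑ j, e.toBasis.repr x j * H₁.inner (e i) (e j) :=
      fun i => by
      have := core_inner_eq_sum H₁ e.toBasis (e i) x
      rw [Finset.sum_eq_single i] at this
      · simpa using this
      · intro k _ hk
        simp [hk]
      · exact fun h => absurd (Finset.mem_univ i) h
    rw [h1]
    change inner ℂ y (∑ i, H₁.inner (e i) x • e i) = _
    rw [inner_sum]
    refine Finset.sum_congr rfl fun i _ => ?_
    rw [inner_smul_right, h2, Finset.sum_mul]
    refine Finset.sum_congr rfl fun j _ => ?_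
    rw [OrthonormalBasis.coe_toBasis, OrthonormalBasis.coe_toBasis_repr_apply,
      OrthonormalBasis.coe_toBasis_repr_apply, e.repr_apply_apply y, inner_conj_symm]
    ring
  have hsymm : T.IsSymmetric := fun x y => by
    rw [hT, ← inner_conj_symm, hT, H₁.conj_inner_symm]
  let v := hsymm.eigenvectorBasis rfl
  have hv : ∀ i j, H₁.inner (v i) (v j) =
      if i = j then (hsymm.eigenvalues rfl i : ℂ) else 0 := fun i j => by
    rw [← hT, hsymm.apply_eigenvectorBasis, inner_smul_right,
      orthonormal_iff_ite.1 v.orthonormal i j]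
    split_ifs with h
    · rw [h, mul_one]
      rfl
    · rw [mul_zero]
  refine ⟨v.toBasis, hsymm.eigenvalues rfl, fun i => ?_, fun i j => ?_, fun i j => ?_⟩
  · have h1 := hv i i
    rw [if_pos rfl] at h1
    have h2 := H₁.re_inner_nonneg (v i)
    rw [h1] at h2
    refine lt_of_le_of_ne h2 fun h => v.orthonormal.ne_zero i (H₁.definite _ ?_)
    rw [h1, ← h, Complex.ofReal_zero]
  · rw [v.coe_toBasis]
    exact orthonormal_iff_ite.1 v.orthonormal i j
  · rw [v.coe_toBasis]
    exact hv i j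

/-- In a basis diagonalizing both metrics, the exponents are the logarithms of the diagonal entries
of `H₁`. -/
theorem exists_geodesic (H₀ H₁ : InnerProductSpace.Core ℂ E) :
    ∃ γ : ℝ → InnerProductSpace.Core ℂ E, IsGeodesic γ ∧ γ 0 = H₀ ∧ γ 1 = H₁ := by
  obtain ⟨s, w, hw, h0, h1⟩ := exists_isONB_diagonal H₀ H₁
  have hγ := fun t : ℝ => diagCore_inner s (fun i => Real.exp (Real.log (w i) * t))
    fun i => Real.exp_pos _
  refine ⟨fun t => diagCore s (fun i => Real.exp (Real.log (w i) * t)) fun i => Real.exp_pos _,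
    ⟨s, fun i => Real.log (w i), fun t i j => ?_⟩, core_ext_basis s fun i j => ?_,
    core_ext_basis s fun i j => ?_⟩
  · rw [hγ]
  · rw [hγ, h0]
    simp
  · rw [hγ, h1, mul_one, Real.exp_log (hw i)]

/-- The logarithm of the determinant is affine along geodesics. -/
theorem exists_logDet_eq {d : ℕ} (b : Module.Basis (Fin d) ℂ E)
    {γ : ℝ → InnerProductSpace.Core ℂ E} {s : Module.Basis (Fin d) ℂ E} {l : Fin d → ℝ}
    (hγ : ∀ t i j, (γ t).inner (s i) (s j) = if i = j then (Real.exp (l i * t) : ℂ) else 0) :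
    ∃ c, ∀ t, logDet b (γ t) = c + t * ∑ i, l i := by
  set P := s.toMatrix b with hP
  have hdet : P.det ≠ 0 := by
    have := congrArg Matrix.det (s.toMatrix_mul_toMatrix_flip b)
    rw [Matrix.det_mul, Matrix.det_one] at this
    exact left_ne_zero_of_mul (this.trans_ne one_ne_zero)
  refine ⟨Real.log (‖P.det‖ ^ 2), fun t => ?_⟩
  have h1 : (Matrix.of fun i j => (γ t).inner (b i) (b j)) =
      P.conjTranspose * Matrix.diagonal (fun i => (Real.exp (l i * t) : ℂ)) * P := by
    ext i j
    rw [Matrix.of_apply, core_inner_eq_sum _ s, Matrix.mul_apply]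
    refine Finset.sum_congr rfl fun k _ => ?_
    rw [Finset.sum_eq_single k, Matrix.mul_diagonal, hγ, if_pos rfl]
    · simp only [hP, Module.Basis.toMatrix_apply, Matrix.conjTranspose_apply, starRingEnd_apply]
      ring
    · intro m _ hm
      rw [hγ, if_neg hm.symm, mul_zero]
    · exact fun h => absurd (Finset.mem_univ k) h
  have h2 : (Matrix.of fun i j => (γ t).inner (b i) (b j)).det =
      ((‖P.det‖ ^ 2 * Real.exp (t * ∑ i, l i) : ℝ) : ℂ) := by
    rw [h1, Matrix.det_mul, Matrix.det_mul, Matrix.det_conjTranspose, Matrix.det_diagonal,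
      ← Complex.ofReal_prod, ← Real.exp_sum, mul_right_comm, ← Finset.sum_mul, mul_comm _ t,
      Complex.ofReal_mul, Complex.ofReal_pow, ← Complex.conj_mul']
    rfl
  rw [logDet, h2, Complex.ofReal_re, Real.log_mul (by positivity) (Real.exp_ne_zero _),
    Real.log_exp]

end HermitianForms

/-! ### Geodesics -/

section Geodesic

open Filter Topology MeasureTheory

variable {n : ℕ} {X : Type*} [TopologicalSpace X] [ChartedSpace (Fin n → ℂ) X]
  {L : X → Type*} [TopologicalSpace (Bundle.TotalSpace ℂ L)]
  [∀ x, AddCommGroup (L x)] [∀ x, Module ℂ (L x)] [∀ x, TopologicalSpace (L x)]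
  [FiberBundle ℂ L] [VectorBundle ℂ ℂ L]
  [IsManifold 𝓘(ℂ, Fin n → ℂ) ω X] [ContMDiffVectorBundle ω ℂ L 𝓘(ℂ, Fin n → ℂ)]
  {E : Submodule ℂ (Cₛ^ω⟮𝓘(ℂ, Fin n → ℂ); ℂ, L⟯)} [FiniteDimensional ℂ E]
  (hE : GivesProjectiveEmbedding E) {ι : Type*} [Fintype ι] [DecidableEq ι]
  (s : Module.Basis ι ℂ E) (l : ι → ℝ) {γ : ℝ → InnerProductSpace.Core ℂ E}

/-- The path of metrics `diag (e^{l_α t})` with respect to the basis `s`. -/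
def IsDiagonalPath (γ : ℝ → InnerProductSpace.Core ℂ E) : Prop :=
  ∀ t i j, (γ t).inner (s i) (s j) = if i = j then (Real.exp (l i * t) : ℂ) else 0

/-- The basis `s` rescaled so as to be orthonormal at time `t`. -/
def geodesicBasis (t : ℝ) : Module.Basis ι ℂ E :=
  s.isUnitSMul (w := fun α => (Real.exp (-(l α * t) / 2) : ℂ)) fun _ =>
    (Complex.ofReal_ne_zero.2 (Real.exp_ne_zero _)).isUnit

theorem geodesicBasis_apply (t : ℝ) (α : ι) :
    geodesicBasis s l t α = (Real.exp (-(l α * t) / 2) : ℂ) • s α :=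
  s.isUnitSMul_apply _ _

theorem norm_exp_half_sq (r : ℝ) : ‖(Real.exp (r / 2) : ℂ)‖ ^ 2 = Real.exp r := by
  rw [Complex.norm_real, Real.norm_of_nonneg (Real.exp_pos _).le, ← Real.exp_nat_mul]
  congr 1
  push_cast
  ring

variable {s l}

theorem isONB_geodesicBasis
    (hγ : IsDiagonalPath s l γ)
    (t : ℝ) : IsONB (γ t) (geodesicBasis s l t) := fun i j => by
  rw [geodesicBasis_apply, geodesicBasis_apply, core_smul_right, (γ t).smul_left, hγ t i j]
  split_ifs with h
  · rw [h, Complex.conj_ofReal, ← Complex.ofReal_mul, ← Complex.ofReal_mul, ← Real.exp_add,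
      ← Real.exp_add, ← Complex.ofReal_one, ← Real.exp_zero]
    congr 2
    ring
  · rw [mul_zero, mul_zero]

theorem isONB_of_diagonal
    (hγ : IsDiagonalPath s l γ) :
    IsONB (γ 0) s := fun i j => by
  rw [hγ 0 i j, mul_zero, Real.exp_zero, Complex.ofReal_one]

variable (s l γ)

/-- The sums `∑ l_α^k e^{-l_α t} |s_α|²` in the metric `FS(γ 0)`. -/
def expSum (k : ℕ) (t : ℝ) (x : X) : ℝ :=
  ∑ α, l α ^ k * Real.exp (-(l α * t)) *
    (FS hE (γ 0)).normSq x ((s α : Cₛ^ω⟮𝓘(ℂ, Fin n → ℂ); ℂ, L⟯) x)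

/-- The logarithm of the ratio of `FS(γ t)` and `FS(γ 0)`. -/
def fsPotential (t : ℝ) (x : X) : ℝ := - Real.log (expSum hE s l γ 0 t x)

theorem smoothFamily_expSum (k : ℕ) : SmoothFamily (n := n) (expSum hE s l γ k) := by
  refine contMDiff_finsetSum fun α _ => ContMDiff.mul ?_ ?_
  · have h : ContDiff ℝ ∞ fun t : ℝ => l α ^ k * Real.exp (-(l α * t)) := by fun_prop
    exact h.contMDiff.comp contMDiff_fst
  · exact ((FS hE (γ 0)).contMDiff_normSq_section _).comp contMDiff_snd

theorem hasDerivAt_expSum (k : ℕ) (t : ℝ) (x : X) :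
    HasDerivAt (fun r => expSum hE s l γ k r x) (- expSum hE s l γ (k + 1) t x) t := by
  have h : ∀ α, HasDerivAt (fun r => l α ^ k * Real.exp (-(l α * r)) *
      (FS hE (γ 0)).normSq x ((s α : Cₛ^ω⟮𝓘(ℂ, Fin n → ℂ); ℂ, L⟯) x))
      (-(l α ^ (k + 1) * Real.exp (-(l α * t)) *
        (FS hE (γ 0)).normSq x ((s α : Cₛ^ω⟮𝓘(ℂ, Fin n → ℂ); ℂ, L⟯) x))) t := fun α => by
    have h1 : HasDerivAt (fun r => -(l α * r)) (-(l α * 1)) t :=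
      ((hasDerivAt_id t).const_mul (l α)).neg
    refine ((h1.exp.const_mul (l α ^ k)).mul_const _).congr_deriv ?_
    ring
  have := HasDerivAt.fun_sum (u := Finset.univ) fun α _ => h α
  rwa [Finset.sum_neg_distrib] at this

variable {s l γ}

/-- Both metrics are inverse to sums of squares of orthonormal sections, and the rescaled basis
supplies the factors `e^{-l_α t}`. The product form needs no positivity of `expSum`, which is
deduced from it. -/
theorem normSq_FS_geodesic_mul (hγ : IsDiagonalPath s l γ) (t : ℝ) (x : X) (v : L x) :
    (FS hE (γ t)).normSq x v * expSum hE s l γ 0 t x = (FS hE (γ 0)).normSq x v := by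
  have hx := FiberBundle.mem_baseSet_trivializationAt' (F := ℂ) (E := L) x
  have h1 := sum_localCoord_pos hE (isONB_geodesicBasis hγ t) hx
  have e : ∀ α, ‖localCoord x x
      (geodesicBasis s l t α : Cₛ^ω⟮𝓘(ℂ, Fin n → ℂ); ℂ, L⟯)‖ ^ 2 = Real.exp (-(l α * t)) *
        ‖localCoord x x (s α : Cₛ^ω⟮𝓘(ℂ, Fin n → ℂ); ℂ, L⟯)‖ ^ 2 := fun α => by
    rw [geodesicBasis_apply, Submodule.coe_smul, localCoord_smul hx, norm_mul, mul_pow,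
      norm_exp_half_sq]
  rw [localCoord_smul_frame x x hx v, HermMetric.normSq_smul, HermMetric.normSq_smul, expSum]
  simp only [(FS hE (γ 0)).normSq_section _ hx, pow_zero, one_mul, ← mul_assoc, ← e,
    ← Finset.sum_mul]
  rw [FS_normSq_frame hE (isONB_geodesicBasis hγ t) hx]
  field_simp

theorem expSum_zero_pos (hγ : IsDiagonalPath s l γ) (t : ℝ) (x : X) : 0 < expSum hE s l γ 0 t x := by
  have hx := FiberBundle.mem_baseSet_trivializationAt' (F := ℂ) (E := L) x
  have h := (FS hE (γ 0)).normSq_frame_pos hx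
  rw [← normSq_FS_geodesic_mul hE hγ t] at h
  exact (pos_iff_pos_of_mul_pos h).1 ((FS hE (γ t)).normSq_frame_pos hx)

theorem normSq_FS_geodesic (hγ : IsDiagonalPath s l γ) (t : ℝ) (x : X) (v : L x) :
    (FS hE (γ t)).normSq x v =
      Real.exp (fsPotential hE s l γ t x) * (FS hE (γ 0)).normSq x v := by
  have h := expSum_zero_pos hE hγ t x
  rw [fsPotential, Real.exp_neg, Real.exp_log h, ← normSq_FS_geodesic_mul hE hγ t]
  field_simp

theorem smoothFamily_fsPotential (hγ : IsDiagonalPath s l γ) : SmoothFamily (n := n) (fsPotential hE s l γ) := by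
  intro p
  have h := (Real.contDiffAt_log (n := ∞).2 (expSum_zero_pos hE hγ p.1 p.2).ne').contMDiffAt.comp p
    ((smoothFamily_expSum hE s l γ 0) p)
  exact h.neg

/-- `expSum` of order `k`, once normalized, is the `k`-th moment of `l` for the weights at time `t`.
As each time derivative raises `k` by one, `φ̇` is a mean and `φ̈` minus a variance. -/
theorem meanFS_geodesic (hγ : IsDiagonalPath s l γ) (k : ℕ) (t : ℝ) (x : X) :
    meanFS hE (geodesicBasis s l t) (γ t) (fun α => l α ^ k) x =
      expSum hE s l γ k t x / expSum hE s l γ 0 t x := by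
  have h := expSum_zero_pos hE hγ t x
  rw [eq_div_iff h.ne', meanFS, Finset.sum_mul]
  refine Finset.sum_congr rfl fun α _ => ?_
  rw [mul_assoc, normSq_FS_geodesic_mul hE hγ, geodesicBasis_apply, Submodule.coe_smul]
  have := (FS hE (γ 0)).normSq_smul x (Real.exp (-(l α * t) / 2) : ℂ)
    ((s α : Cₛ^ω⟮𝓘(ℂ, Fin n → ℂ); ℂ, L⟯) x)
  rw [norm_exp_half_sq] at this
  rw [mul_assoc, ← this]
  rfl

theorem timeDeriv_fsPotential (hγ : IsDiagonalPath s l γ) :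
    timeDeriv (fsPotential hE s l γ) =
      fun t x => expSum hE s l γ 1 t x / expSum hE s l γ 0 t x := by
  ext t x
  have h := expSum_zero_pos hE hγ t x
  have h1 := ((hasDerivAt_expSum hE s l γ 0 t x).log h.ne').fun_neg.deriv
  rw [zero_add, neg_div, neg_neg] at h1
  exact h1

theorem timeDeriv_fsPotential_eq_meanFS (hγ : IsDiagonalPath s l γ) (t : ℝ) :
    timeDeriv (fsPotential hE s l γ) t = meanFS hE (geodesicBasis s l t) (γ t) l := by
  ext x
  have := meanFS_geodesic hE hγ 1 t x
  simp only [pow_one] at this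
  rw [timeDeriv_fsPotential hE hγ]
  exact this.symm

theorem timeDeriv_timeDeriv_fsPotential (hγ : IsDiagonalPath s l γ) (t : ℝ) (x : X) :
    timeDeriv (timeDeriv (fsPotential hE s l γ)) t x =
      -(meanFS hE (geodesicBasis s l t) (γ t) (fun α => l α ^ 2) x -
        meanFS hE (geodesicBasis s l t) (γ t) l x ^ 2) := by
  have h := expSum_zero_pos hE hγ t x
  rw [← timeDeriv_fsPotential_eq_meanFS hE hγ, timeDeriv_fsPotential hE hγ,
    meanFS_geodesic hE hγ 2, timeDeriv,
    ((hasDerivAt_expSum hE s l γ 1 t x).fun_div (hasDerivAt_expSum hE s l γ 0 t x) h.ne').deriv]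
  field_simp
  ring

variable [CompactSpace X] [T2Space X] [MeasurableSpace X] [BorelSpace X]

/-- All integrals are pulled back to the fixed measure of `FS(γ 0)`. The pointwise condition of
`antitone_integral_timeDeriv` then holds because `φ̈` is minus the variance and the variance
dominates the gradient term. -/
theorem antitone_integral_fsPotential (hγ : IsDiagonalPath s l γ) :
    Antitone fun t => ∫ x, timeDeriv (fsPotential hE s l γ) t x ∂(FS hE (γ t)).measure := by
  have hφ := smoothFamily_fsPotential hE hγ
  have hp := isPositive_FS hE
  simp only [fun t => integral_measure_of_eq_exp (hp (γ 0)) (hp (γ t)) (hφ.contMDiff t)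
    (normSq_FS_geodesic hE hγ t) (hφ.timeDeriv.contMDiff t).continuous]
  refine antitone_integral_timeDeriv (hp (γ 0)) hφ fun t x => ?_
  have hx := mem_chartDomain (n := n) (L := L) x
  have hN : (FS hE (γ t)).curvAt x = (FS hE (γ 0)).curvAt x -
      ((1 : ℝ) : ℂ) • hessAt n (fsPotential hE s l γ t) x :=
    curvMatrix_of_eq_exp (hφ.contMDiff t) (normSq_FS_geodesic hE hγ t) hx
  have h1 := gradRatio_meanFS_le hE (isONB_geodesicBasis hγ t) l x ((hp (γ 0)).det_pos hx)
  rw [← hN, timeDeriv_timeDeriv_fsPotential hE hγ, timeDeriv_fsPotential_eq_meanFS hE hγ]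
  rw [← HermMetric.curvAt] at h1
  linarith

theorem hasDerivAt_energy_FS (hγ : IsDiagonalPath s l γ) {I : HermMetric n L → ℝ} (hI : IsEnergyFunctional I) (t : ℝ) :
    HasDerivAt (fun r => I (FS hE (γ r)))
      (∫ x, timeDeriv (fsPotential hE s l γ) t x ∂(FS hE (γ t)).measure) t :=
  hI (FS hE (γ 0)) (fun r => FS hE (γ r)) (fsPotential hE s l γ) (isPositive_FS hE _)
    (smoothFamily_fsPotential hE hγ) (normSq_FS_geodesic hE hγ)
    (fun t => isPositive_FS hE (γ t)) t

/-- At a balanced point, the sections of an orthonormal basis have equal masses. -/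
theorem integral_timeDeriv_of_isBalanced {V : ℝ} (hγ : IsDiagonalPath s l γ) (hb : IsBalanced V hE (γ 0)) :
    ∫ x, timeDeriv (fsPotential hE s l γ) 0 x ∂(FS hE (γ 0)).measure =
      V / Module.finrank ℂ E * ∑ α, l α := by
  have hs := isONB_of_diagonal hγ
  have h0 : ∀ x, expSum hE s l γ 0 0 x = 1 := fun x => by
    rw [expSum, ← sum_FS_normSq hE (γ 0) s hs x]
    simp
  have h1 : timeDeriv (fsPotential hE s l γ) 0 = fun x => ∑ α, l α *
      (FS hE (γ 0)).normSq x ((s α : Cₛ^ω⟮𝓘(ℂ, Fin n → ℂ); ℂ, L⟯) x) := by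
    ext x
    rw [timeDeriv_fsPotential hE hγ]
    change expSum hE s l γ 1 0 x / expSum hE s l γ 0 0 x = _
    rw [h0, div_one]
    simp only [expSum, mul_zero, neg_zero, Real.exp_zero, mul_one, pow_one]
  have hc := fun α => ((FS hE (γ 0)).contMDiff_normSq_section
    (s α : Cₛ^ω⟮𝓘(ℂ, Fin n → ℂ); ℂ, L⟯)).continuous
  have h2 : ∀ α, ∫ x, (FS hE (γ 0)).normSq x ((s α : Cₛ^ω⟮𝓘(ℂ, Fin n → ℂ); ℂ, L⟯) x)
      ∂(FS hE (γ 0)).measure = V / Module.finrank ℂ E := fun α => by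
    have h := hb (s α)
    rw [hs, if_pos rfl, ← Complex.ofReal_one, Complex.ofReal_inj, hilbNormSq] at h
    rw [eq_inv_of_mul_eq_one_right h, inv_div]
  rw [h1, integral_finsetSum _ fun α _ => (integrable_of_continuous _ (hc α)).const_mul _]
  simp only [integral_const_mul, h2, ← Finset.sum_mul]
  rw [mul_comm]

end Geodesic

/-! ### Convexity of `Z̃` and minimality at balanced points. -/

section Convexity

open MeasureTheory

variable {n : ℕ} {X : Type*} [TopologicalSpace X] [ChartedSpace (Fin n → ℂ) X]
  {L : X → Type*} [TopologicalSpace (Bundle.TotalSpace ℂ L)]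
  [∀ x, AddCommGroup (L x)] [∀ x, Module ℂ (L x)] [∀ x, TopologicalSpace (L x)]
  [FiberBundle ℂ L] [VectorBundle ℂ ℂ L]
  [IsManifold 𝓘(ℂ, Fin n → ℂ) ω X] [ContMDiffVectorBundle ω ℂ L 𝓘(ℂ, Fin n → ℂ)]
  [CompactSpace X] [T2Space X] [MeasurableSpace X] [BorelSpace X]
  {E : Submodule ℂ (Cₛ^ω⟮𝓘(ℂ, Fin n → ℂ); ℂ, L⟯)} [FiniteDimensional ℂ E]
  (hE : GivesProjectiveEmbedding E) {V : ℝ} {I : HermMetric n L → ℝ}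
  {γ : ℝ → InnerProductSpace.Core ℂ E}
  (b : Module.Basis (Fin (Module.finrank ℂ E)) ℂ E)

theorem hasDerivAt_Ztilde (hI : IsEnergyFunctional I)
    {s : Module.Basis (Fin (Module.finrank ℂ E)) ℂ E} {l : Fin (Module.finrank ℂ E) → ℝ}
    (hγ : IsDiagonalPath s l γ)
    (t : ℝ) :
    HasDerivAt (fun r => Ztilde V I hE b (γ r))
      (-(∫ x, timeDeriv (fsPotential hE s l γ) t x ∂(FS hE (γ t)).measure) +
        V / Module.finrank ℂ E * ∑ i, l i) t := by
  obtain ⟨c, hc⟩ := exists_logDet_eq b hγ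
  have h1 : HasDerivAt (fun r => logDet b (γ r)) (∑ i, l i) t := by
    simp only [hc]
    simpa using ((hasDerivAt_id t).mul_const (∑ i, l i)).const_add c
  exact (hasDerivAt_energy_FS hE hγ hI t).fun_neg.fun_add (h1.const_mul _)

theorem convexOn_Ztilde (hI : IsEnergyFunctional I) (hγ : IsGeodesic γ) :
    ConvexOn ℝ Set.univ fun t => Ztilde V I hE b (γ t) := by
  obtain ⟨s, l, hγ⟩ := hγ
  have hγ' : IsDiagonalPath s l γ := hγ
  have hd := hasDerivAt_Ztilde (V := V) hE b hI hγ'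
  refine Monotone.convexOn_univ_of_deriv (fun t => (hd t).differentiableAt) fun t t' htt' => ?_
  rw [(hd t).deriv, (hd t').deriv]
  have := antitone_integral_fsPotential hE hγ' htt'
  simp only at this
  linarith

/-- Along the geodesic from `H'` to `H` the derivative at time `0` vanishes by balancedness, so
convexity makes the slope from `0` to `1` nonnegative. The number `V` is arbitrary as long as it is
the same in the balanced condition and in `Z̃`. -/
theorem Ztilde_le_of_isBalanced (hI : IsEnergyFunctional I) {H' : InnerProductSpace.Core ℂ E}
    (hb : IsBalanced V hE H') (H : InnerProductSpace.Core ℂ E) :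
    Ztilde V I hE b H' ≤ Ztilde V I hE b H := by
  obtain ⟨γ, hγ, rfl, rfl⟩ := exists_geodesic H' H
  have hc := convexOn_Ztilde (V := V) hE b hI hγ
  obtain ⟨s, l, hγ⟩ := hγ
  have hγ' : IsDiagonalPath s l γ := hγ
  have hd := hasDerivAt_Ztilde (V := V) hE b hI hγ' 0
  rw [integral_timeDeriv_of_isBalanced hE hγ' hb, neg_add_cancel] at hd
  have h := hc.le_slope_of_hasDerivAt (Set.mem_univ 0) (Set.mem_univ 1) zero_lt_one hd
  rw [slope_def_field, sub_zero, div_one, sub_nonneg] at h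
  exact h

end Convexity

end KahlerQuantization

end

theorem corollary2 {n : ℕ} {X : Type*} [TopologicalSpace X] [ChartedSpace (Fin n → ℂ) X]
    [IsManifold (modelWithCornersSelf ℂ (Fin n → ℂ)) ω X] [CompactSpace X] [T2Space X]
    [MeasurableSpace X] [BorelSpace X]
    {L : X → Type*} [TopologicalSpace (Bundle.TotalSpace ℂ L)]
    [∀ x, AddCommGroup (L x)] [∀ x, Module ℂ (L x)] [∀ x, TopologicalSpace (L x)]
    [FiberBundle ℂ L] [VectorBundle ℂ ℂ L]
    [ContMDiffVectorBundle ω ℂ L (modelWithCornersSelf ℂ (Fin n → ℂ))]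
    (E : Submodule ℂ (ContMDiffSection (modelWithCornersSelf ℂ (Fin n → ℂ)) ℂ ω L))
    [FiniteDimensional ℂ E] (hE : KahlerQuantization.GivesProjectiveEmbedding E)
    (b : Module.Basis (Fin (Module.finrank ℂ E)) ℂ E)
    (h₀ : KahlerQuantization.HermMetric n L) (hh₀ : h₀.IsPositive) :
    -- `FS` maps `M` to `𝒦`, and the functional `I` exists
    (∀ H : InnerProductSpace.Core ℂ E, (KahlerQuantization.FS hE H).IsPositive) ∧
    (∃ I : KahlerQuantization.HermMetric n L → ℝ, KahlerQuantization.IsEnergyFunctional I) ∧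
    -- any two points of `M` are joined by a geodesic
    (∀ H₀ H₁ : InnerProductSpace.Core ℂ E, ∃ γ : ℝ → InnerProductSpace.Core ℂ E,
      KahlerQuantization.IsGeodesic γ ∧ γ 0 = H₀ ∧ γ 1 = H₁) ∧
    ∀ I : KahlerQuantization.HermMetric n L → ℝ, KahlerQuantization.IsEnergyFunctional I →
      -- `Z̃` is geodesically convex
      (∀ γ : ℝ → InnerProductSpace.Core ℂ E, KahlerQuantization.IsGeodesic γ →
        ConvexOn ℝ Set.univ fun t => KahlerQuantization.Ztilde h₀.vol I hE b (γ t)) ∧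
      -- a balanced point is an absolute minimum of `Z̃`
      (∀ H' : InnerProductSpace.Core ℂ E, KahlerQuantization.IsBalanced h₀.vol hE H' →
        ∀ H : InnerProductSpace.Core ℂ E, KahlerQuantization.Ztilde h₀.vol I hE b H' ≤
          KahlerQuantization.Ztilde h₀.vol I hE b H) := by
  -- The given positive metric `h₀` serves as the base point of the energy.
  refine ⟨KahlerQuantization.isPositive_FS hE,
    ⟨_, KahlerQuantization.isEnergyFunctional_energy hh₀⟩,
    KahlerQuantization.exists_geodesic, fun I hI => ⟨fun γ hγ => ?_, fun H' hH' H => ?_⟩⟩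
  · exact KahlerQuantization.convexOn_Ztilde hE b hI hγ
  · exact KahlerQuantization.Ztilde_le_of_isBalanced hE b hI hH' H
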